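/- Let $F$ be a non-archimedean local field of characteristic $0$, let $\psi$ be a non-trivial continuous unitary character of $F$, and let $n\ge 1$. Let $w_m$ be the $m\times m$ matrix with ones on the antidiagonal and zeros elsewhere, and let $G=\mathrm{SO}(2n+1)=\{g\in \mathrm{SL}_{2n+1}(F) : {}^tg\,w_{2n+1}\,g=w_{2n+1}\}$, with the topology induced by that of $F$. For a closed subgroup $H$ of $G$ and a continuous unitary character $\chi$ of $H$, let $C^{\mathrm{sm}}(H\backslash G,\chi)$ be the space of functions $f:G\to\mathbb C$ such that $f(hg)=\chi(h)f(g)$ for all $h\in H$, $g\in G$ and such that $f$ is right invariant under some open subgroup of $G$; $G$ acts on it by right translation. A smooth complex representation $\sigma$ of $G$ is said to have an $(H,\chi)$ model if there is a non-zero $G$-equivariant map from $\sigma$ to $C^{\mathrm{sm}}(H\backslash G,\chi)$. The Bessel subgroup of $G$ is $$B=\left\{\begin{pmatrix}u&*&*\\&\begin{smallmatrix}t&&\\&1&\\&&t^{-1}\end{smallmatrix}&*\\&&u^*\end{pmatrix}\in G\;:\;u\in N_{\mathrm{GL}_{n-1}},\ t\in F^\times\right\},$$ where $N_{\mathrm{GL}_{n-1}}$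 is the group of upper unitriangular $(n-1)\times(n-1)$ matrices and $u^*=w_{n-1}\,{}^tu^{-1}w_{n-1}$. Its character is $\psi_B(b)=\psi(b_{1,2}+\dots+b_{n-2,n-1}+b_{n-1,n+1})$; this means $\psi(b_{1,3})$ if $n=2$ and the trivial character if $n=1$. A Bessel model of $\sigma$ is a $(B,\psi_B)$ model. Let $N$ be the group of upper unitriangular matrices in $G$. A continuous character $\psi_N$ of $N$ is non-degenerate if it is non-trivial on the root subgroup of each simple root, and $\sigma$ is generic if it has an $(N,\psi_N)$ model for some non-degenerate $\psi_N$. An irreducible smooth representation $\sigma$ of $G$ is tempered if for all $v$ in the space of $\sigma$ and all $\ell$ in the space of the contragredient $\sigma^\vee$ the matrix coefficient $g\mapsto\ell(\sigma(g)v)$ lies in $L^{2+\varepsilon}(G)$ for every $\varepsilon>0$. Let $\sigma$ be an irreducible tempered smooth representation of $G$. If $\sigma$ has a Bessel model, then $\sigma$ is generic. -/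

import Mathlib

open Matrix MeasureTheory

/-! ## The split odd special orthogonal group -/

/-- The antidiagonal matrix `w` of size `2n+1`: ones on the antidiagonal, zeros elsewhere. -/
def antidiag (n : ℕ) (F : Type*) [Field F] : Matrix (Fin (2 * n + 1)) (Fin (2 * n + 1)) F :=
  Matrix.of fun i j => if j = i.rev then 1 else 0

theorem antidiag_mul_apply {n : ℕ} {F : Type*} [Field F]
    (A : Matrix (Fin (2 * n + 1)) (Fin (2 * n + 1)) F) (i j : Fin (2 * n + 1)) :
    (antidiag n F * A) i j = A i.rev j := by
  simp [antidiag, Matrix.mul_apply]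

theorem mul_antidiag_apply {n : ℕ} {F : Type*} [Field F]
    (A : Matrix (Fin (2 * n + 1)) (Fin (2 * n + 1)) F) (i j : Fin (2 * n + 1)) :
    (A * antidiag n F) i j = A i j.rev := by
  have h : ∀ k : Fin (2 * n + 1), j = k.rev ↔ k = j.rev := fun k =>
    ⟨fun h => by rw [h, Fin.rev_rev], fun h => by rw [h, Fin.rev_rev]⟩
  simp [antidiag, Matrix.mul_apply, h]

/-- The group of `F`-points of split `SO(2n+1)`: the matrices `g` of determinant one with `ᵗg w g = w`. Its topology is the one
induced from the space of matrices. -/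
def SOodd (n : ℕ) (F : Type*) [Field F] :
    Subgroup (Matrix.SpecialLinearGroup (Fin (2 * n + 1)) F) where
  carrier := {g | (g : Matrix _ _ F)ᵀ * antidiag n F * (g : Matrix _ _ F) = antidiag n F}
  one_mem' := by simp
  mul_mem' := by
    intro a b ha hb
    simp only [Set.mem_ofPred_eq, Matrix.SpecialLinearGroup.coe_mul, Matrix.transpose_mul] at *
    calc _ = (b : Matrix _ _ F)ᵀ * ((a : Matrix _ _ F)ᵀ * antidiag n F * (a : Matrix _ _ F))
              * (b : Matrix _ _ F) := by simp only [Matrix.mul_assoc]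
      _ = _ := by rw [ha, hb]
  inv_mem' := by
    intro a ha
    simp only [Set.mem_ofPred_eq] at *
    have h1 : a.1 * (a⁻¹).1 = 1 := by
      change (a * a⁻¹).1 = 1
      rw [mul_inv_cancel]
      rfl
    have h2 : (a⁻¹).1ᵀ * a.1ᵀ = 1 := by
      rw [← Matrix.transpose_mul, h1, Matrix.transpose_one]
    calc (a⁻¹).1ᵀ * antidiag n F * (a⁻¹).1
        = (a⁻¹).1ᵀ * (a.1ᵀ * antidiag n F * a.1) * (a⁻¹).1 := by rw [ha]
      _ = ((a⁻¹).1ᵀ * a.1ᵀ) * antidiag n F * (a.1 * (a⁻¹).1) := by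
          simp only [Matrix.mul_assoc]
      _ = _ := by rw [h1, h2, Matrix.one_mul, Matrix.mul_one]

/-- The matrix underlying an element of `SO(2n+1)`. -/
def SOodd.mat {n : ℕ} {F : Type*} [Field F] (g : SOodd n F) :
    Matrix (Fin (2 * n + 1)) (Fin (2 * n + 1)) F :=
  (g.1 : Matrix (Fin (2 * n + 1)) (Fin (2 * n + 1)) F)

namespace SOodd

variable {n : ℕ} {F : Type*} [Field F]

theorem mat_one : mat (1 : SOodd n F) = 1 := rfl

theorem mat_mul (a b : SOodd n F) : mat (a * b) = mat a * mat b := rfl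

theorem mat_mul_apply (a b : SOodd n F) (i j : Fin (2 * n + 1)) :
    mat (a * b) i j = ∑ k, mat a i k * mat b k j := rfl

theorem mat_inv_apply (a : SOodd n F) (i j : Fin (2 * n + 1)) :
    mat a⁻¹ i j = mat a j.rev i.rev := by
  have h : (mat a)ᵀ * antidiag n F * mat a = antidiag n F := a.2
  have h1 : mat a * mat a⁻¹ = 1 := by rw [← mat_mul, mul_inv_cancel, mat_one]
  have h2 : (mat a)ᵀ * antidiag n F = antidiag n F * mat a⁻¹ := by
    rw [← Matrix.mul_one ((mat a)ᵀ * antidiag n F), ← h1, ← Matrix.mul_assoc, h]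
  have h3 := congrFun (congrFun h2 i.rev) j
  rw [mul_antidiag_apply, antidiag_mul_apply, Fin.rev_rev, Matrix.transpose_apply] at h3
  exact h3.symm

/-- Upper triangular elements: the diagonal entries multiply. -/
theorem mat_mul_diag {a b : SOodd n F} (ha : ∀ i j, j < i → mat a i j = 0)
    (hb : ∀ i j, j < i → mat b i j = 0) (i : Fin (2 * n + 1)) :
    mat (a * b) i i = mat a i i * mat b i i := by
  rw [mat_mul_apply]
  refine Finset.sum_eq_single i (fun k _ hk => ?_) (by simp)
  rcases lt_or_gt_of_ne hk with h | h
  · rw [ha i k h, zero_mul]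
  · rw [hb k i h, mul_zero]

theorem mat_mul_lower {a b : SOodd n F} (ha : ∀ i j, j < i → mat a i j = 0)
    (hb : ∀ i j, j < i → mat b i j = 0) (i j : Fin (2 * n + 1)) (hij : j < i) :
    mat (a * b) i j = 0 := by
  rw [mat_mul_apply]
  refine Finset.sum_eq_zero fun k _ => ?_
  rcases lt_or_ge k i with h | h
  · rw [ha i k h, zero_mul]
  · rw [hb k j (lt_of_lt_of_le hij h), mul_zero]

/-- First superdiagonal of a product of upper triangular elements. -/
theorem mat_mul_super {a b : SOodd n F} (ha : ∀ i j, j < i → mat a i j = 0)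
    (hb : ∀ i j, j < i → mat b i j = 0) (i j : Fin (2 * n + 1)) (hij : i.val + 1 = j.val) :
    mat (a * b) i j = mat a i i * mat b i j + mat a i j * mat b j j := by
  rw [mat_mul_apply]
  have hne : i ≠ j := fun h => by rw [h] at hij; omega
  rw [← Finset.sum_pair (f := fun k => mat a i k * mat b k j) hne]
  refine (Finset.sum_subset (Finset.subset_univ _) fun k _ hk => ?_).symm
  simp only [Finset.mem_insert, Finset.mem_singleton, not_or] at hk
  have h1 : k.val ≠ i.val := fun h => hk.1 (Fin.ext h)
  have h2 : k.val ≠ j.val := fun h => hk.2 (Fin.ext h)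
  rcases lt_or_ge k.val i.val with h | h
  · rw [ha i k h, zero_mul]
  · rw [hb k j (show j.val < k.val by omega), mul_zero]

/-- Second superdiagonal of a product of upper triangular elements. -/
theorem mat_mul_super_two {a b : SOodd n F} (ha : ∀ i j, j < i → mat a i j = 0)
    (hb : ∀ i j, j < i → mat b i j = 0) (i j k : Fin (2 * n + 1)) (hij : i.val + 1 = j.val)
    (hjk : j.val + 1 = k.val) :
    mat (a * b) i k = mat a i i * mat b i k + mat a i j * mat b j k + mat a i k * mat b k k := by
  rw [mat_mul_apply]
  have hne : i ≠ j := fun h => by rw [h] at hij; omega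
  have hne2 : j ≠ k := fun h => by rw [h] at hjk; omega
  have hne3 : i ≠ k := fun h => by rw [h] at hij; omega
  have hs : ∑ l ∈ ({i, j, k} : Finset (Fin (2 * n + 1))), mat a i l * mat b l k
      = mat a i i * mat b i k + mat a i j * mat b j k + mat a i k * mat b k k := by
    rw [Finset.sum_insert (by simp [hne, hne3]), Finset.sum_pair hne2, add_assoc]
  rw [← hs]
  refine (Finset.sum_subset (Finset.subset_univ _) fun l _ hl => ?_).symm
  simp only [Finset.mem_insert, Finset.mem_singleton, not_or] at hl
  have h1 : l.val ≠ i.val := fun h => hl.1 (Fin.ext h)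
  have h2 : l.val ≠ j.val := fun h => hl.2.1 (Fin.ext h)
  have h3 : l.val ≠ k.val := fun h => hl.2.2 (Fin.ext h)
  rcases lt_or_ge l.val i.val with h | h
  · rw [ha i l h, zero_mul]
  · rw [hb l k (show k.val < l.val by omega), mul_zero]

/-! ## The maximal unipotent subgroup and its non-degenerate characters -/

/-- The maximal unipotent subgroup `N` of upper unitriangular matrices in `SO(2n+1)`. -/
def unip (n : ℕ) (F : Type*) [Field F] : Subgroup (SOodd n F) where
  carrier := {u | (∀ i j, j < i → mat u i j = 0) ∧ ∀ i, mat u i i = 1}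
  one_mem' := ⟨fun i j h => by rw [mat_one, Matrix.one_apply_ne h.ne'],
    fun i => by rw [mat_one, Matrix.one_apply_eq]⟩
  mul_mem' := fun {a b} ha hb => ⟨mat_mul_lower ha.1 hb.1,
    fun i => by rw [mat_mul_diag ha.1 hb.1, ha.2, hb.2, one_mul]⟩
  inv_mem' := fun {a} ha => ⟨fun i j h => by
      rw [mat_inv_apply]; exact ha.1 _ _ (Fin.rev_lt_rev.mpr h),
    fun i => by rw [mat_inv_apply]; exact ha.2 _⟩

/-- `u ∈ N` lies in the root subgroup of the `i`-th simple root `diag(t) ↦ tᵢ / tᵢ₊₁` (rows and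
columns are numbered from `0`, and `0 ≤ i < n`). Off the diagonal, `u` may be non-zero only in the
position `(i, i+1)` and its mirror image under the antidiagonal and, for the short root `i = n-1`,
in the position `(n-1, n+1)`. -/
def InSimpleRootSubgroup (u : unip n F) (i : Fin n) : Prop :=
  ∀ j k : Fin (2 * n + 1), j < k → mat u.1 j k ≠ 0 →
    (j.val = i.val ∧ k.val = i.val + 1) ∨
    (j.rev.val = i.val + 1 ∧ k.rev.val = i.val) ∨
    (i.val + 1 = n ∧ j.val = i.val ∧ k.rev.val = i.val)

/-- A character of `N` is non-degenerate if it is continuous and non-trivial on the root subgroup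
of every simple root. -/
def IsNondegenerate [TopologicalSpace F] (χ : unip n F →* Circle) : Prop :=
  Continuous χ ∧ ∀ i : Fin n, ∃ u : unip n F, InSimpleRootSubgroup u i ∧ χ u ≠ 1

/-! ## The Bessel subgroup and its character -/

/-- The Bessel subgroup, consisting of the block upper triangular elements of `SO(2n+1)` with
diagonal blocks `u`, `diag(t, 1, t⁻¹)`, `u*`, where `u` is upper unitriangular of size `n - 1` and
`t` is a non-zero scalar. With rows and columns numbered from `0`, the middle block occupies the
rows and columns `n-1`, `n`, `n+1`; membership in `SO(2n+1)` forces the entry at `(n+1, n+1)` to be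
the inverse of the one at `(n-1, n-1)`, and the last block to be determined by the first. -/
def bessel (n : ℕ) (F : Type*) [Field F] : Subgroup (SOodd n F) where
  carrier := {b | (∀ i j, j < i → mat b i j = 0) ∧
    (∀ i, i.val + 1 ≠ n → i.val ≠ n + 1 → mat b i i = 1) ∧
    (∀ i j, i < j → n ≤ i.val + 1 → j.val ≤ n + 1 → mat b i j = 0)}
  one_mem' := ⟨fun i j h => by rw [mat_one, Matrix.one_apply_ne h.ne'],
    fun i _ _ => by rw [mat_one, Matrix.one_apply_eq],
    fun i j h _ _ => by rw [mat_one, Matrix.one_apply_ne h.ne]⟩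
  mul_mem' := fun {a b} ha hb => ⟨mat_mul_lower ha.1 hb.1,
    fun i h h' => by rw [mat_mul_diag ha.1 hb.1, ha.2.1 i h h', hb.2.1 i h h', one_mul],
    fun i j hij hi hj => by
      rw [mat_mul_apply]
      refine Finset.sum_eq_zero fun k _ => ?_
      rcases lt_or_ge k i with h | h
      · rw [ha.1 i k h, zero_mul]
      rcases eq_or_lt_of_le h with h | h
      · subst h; rw [hb.2.2 i j hij hi hj, mul_zero]
      rcases lt_or_ge j k with h' | h'
      · rw [hb.1 k j h', mul_zero]
      · rw [ha.2.2 i k h hi (le_trans h' hj), zero_mul]⟩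
  inv_mem' := fun {a} ha => ⟨fun i j h => by
      rw [mat_inv_apply]; exact ha.1 _ _ (Fin.rev_lt_rev.mpr h),
    fun i h h' => by
      rw [mat_inv_apply]
      refine ha.2.1 _ ?_ ?_ <;> rw [Fin.val_rev] <;> omega,
    fun i j hij hi hj => by
      rw [mat_inv_apply]
      refine ha.2.2 _ _ (Fin.rev_lt_rev.mpr hij) ?_ ?_ <;> rw [Fin.val_rev] <;> omega⟩

/-- The linear form `b₁,₂ + ⋯ + bₙ₋₂,ₙ₋₁ + bₙ₋₁,ₙ₊₁` (with rows and columns numbered from `1`; here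
they are numbered from `0`). It is `b₁,₃` for `n = 2`, and zero (the empty sum) for `n = 1`. -/
def besselForm (b : SOodd n F) : F :=
  (∑ i : Fin (n - 2), mat b ⟨i.val, by omega⟩ ⟨i.val + 1, by omega⟩) +
    if h : 2 ≤ n then mat b ⟨n - 2, by omega⟩ ⟨n, by omega⟩ else 0

theorem besselForm_one : besselForm (1 : SOodd n F) = 0 := by
  unfold besselForm
  rw [Finset.sum_eq_zero, zero_add]
  · split_ifs with h
    · rw [mat_one, Matrix.one_apply_ne]
      intro h'; rw [Fin.mk.injEq] at h'; omega
    · rfl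
  · intro i _
    rw [mat_one, Matrix.one_apply_ne]
    intro h'; rw [Fin.mk.injEq] at h'; omega

theorem besselForm_mul {a b : SOodd n F} (ha : a ∈ bessel n F) (hb : b ∈ bessel n F) :
    besselForm (a * b) = besselForm a + besselForm b := by
  unfold besselForm
  have h1 : ∀ i : Fin (n - 2), mat (a * b) ⟨i.val, by omega⟩ ⟨i.val + 1, by omega⟩
      = mat a ⟨i.val, by omega⟩ ⟨i.val + 1, by omega⟩
        + mat b ⟨i.val, by omega⟩ ⟨i.val + 1, by omega⟩ := fun i => by
    rw [mat_mul_super ha.1 hb.1 _ _ rfl, ha.2.1 _ (by simp only; omega) (by simp only; omega),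
      hb.2.1 _ (by simp only; omega) (by simp only; omega), one_mul, mul_one, add_comm]
  rw [Finset.sum_congr rfl fun i _ => h1 i, Finset.sum_add_distrib]
  split_ifs with h
  · rw [mat_mul_super_two ha.1 hb.1 ⟨n - 2, by omega⟩ ⟨n - 1, by omega⟩ ⟨n, by omega⟩
      (by simp only; omega) (by simp only; omega),
      ha.2.1 ⟨n - 2, by omega⟩ (by simp only; omega) (by simp only; omega),
      hb.2.1 ⟨n, by omega⟩ (by simp only; omega) (by simp only; omega),
      hb.2.2 ⟨n - 1, by omega⟩ ⟨n, by omega⟩ (Fin.mk_lt_mk.mpr (by omega)) (by simp only; omega)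
        (by simp only; omega)]
    ring
  · ring

/-- The character `b ↦ ψ(b₁,₂ + ⋯ + bₙ₋₂,ₙ₋₁ + bₙ₋₁,ₙ₊₁)` of the Bessel subgroup. -/
noncomputable def besselChar (ψ : AddChar F Circle) : bessel n F →* Circle where
  toFun b := ψ (besselForm b.1)
  map_one' := by rw [Subgroup.coe_one, besselForm_one, AddChar.map_zero_eq_one]
  map_mul' a b := by rw [Subgroup.coe_mul, besselForm_mul a.2 b.2, AddChar.map_add_eq_mul]

end SOodd

/-! ## Smooth representations -/

/-- A complex representation of a topological group is smooth if every vector has an open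
stabilizer. -/
def IsSmoothRep {G V : Type*} [Group G] [TopologicalSpace G] [AddCommGroup V] [Module ℂ V]
    (σ : Representation ℂ G V) : Prop :=
  ∀ v : V, IsOpen {g : G | σ g v = v}

/-- A linear form is smooth (that is, belongs to the space of the contragredient representation)
if it is invariant under an open subgroup. -/
def IsSmoothForm {G V : Type*} [Group G] [TopologicalSpace G] [AddCommGroup V] [Module ℂ V]
    (σ : Representation ℂ G V) (l : Module.Dual ℂ V) : Prop :=
  ∃ K : OpenSubgroup G, ∀ k ∈ K, ∀ v : V, l (σ k v) = l v

/-- Temperedness of an irreducible smooth representation of a `p`-adic reductive group with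
trivial centre: every matrix coefficient `g ↦ l(σ(g)v)`, with `v` in the space of `σ` and `l` in
that of the contragredient, lies in `L^{2+ε}(G)` for all `ε > 0`, with respect to Haar measure. -/
def IsTemperedRep {G V : Type*} [Group G] [TopologicalSpace G] [IsTopologicalGroup G]
    [LocallyCompactSpace G] [AddCommGroup V] [Module ℂ V] (σ : Representation ℂ G V) : Prop :=
  letI : MeasurableSpace G := borel G
  haveI : BorelSpace G := ⟨rfl⟩
  ∀ (v : V) (l : Module.Dual ℂ V), IsSmoothForm σ l → ∀ ε : ℝ, 0 < ε →
    MemLp (fun g : G => l (σ g v)) (ENNReal.ofReal (2 + ε)) (Measure.haar : Measure G)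

/-- The space `C^∞(H\G, χ)` of the functions `f : G → ℂ` that satisfy `f(hg) = χ(h) f(g)` for `h`
in `H`, and that are right invariant under some open subgroup of `G`. -/
def smoothIndSpace {G : Type*} [Group G] [TopologicalSpace G] (H : Subgroup G)
    (χ : H →* Circle) : Submodule ℂ (G → ℂ) where
  carrier := {f | (∀ (h : H) (g : G), f (h * g) = (χ h : ℂ) * f g) ∧
    ∃ K : OpenSubgroup G, ∀ k ∈ K, ∀ g : G, f (g * k) = f g}
  zero_mem' := ⟨fun h g => by simp, ⊤, fun k _ g => rfl⟩
  add_mem' := by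
    rintro f f' ⟨h1, K, h2⟩ ⟨h1', K', h2'⟩
    refine ⟨fun h g => ?_, K ⊓ K', fun k hk g => ?_⟩
    · simp only [Pi.add_apply, h1, h1', mul_add]
    · simp only [Pi.add_apply, h2 k hk.1, h2' k hk.2]
  smul_mem' := by
    rintro c f ⟨h1, K, h2⟩
    refine ⟨fun h g => ?_, K, fun k hk g => ?_⟩
    · simp only [Pi.smul_apply, h1, smul_eq_mul]; ring
    · simp only [Pi.smul_apply, h2 k hk]

/-- The representation of `G` on `C^∞(H\G, χ)` by right translation. -/
def smoothInd {G : Type*} [Group G] [TopologicalSpace G] [IsTopologicalGroup G] (H : Subgroup G)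
    (χ : H →* Circle) : Representation ℂ G (smoothIndSpace H χ) where
  toFun g :=
    { toFun := fun f => ⟨fun x => f.1 (x * g), fun h x => by
        change f.1 (h * x * g) = _
        rw [mul_assoc]
        exact f.2.1 h (x * g), by
        obtain ⟨K, hK⟩ := f.2.2
        refine ⟨K.comap (MulAut.conj g⁻¹).toMonoidHom ?_, fun k hk x => ?_⟩
        · change Continuous fun x => g⁻¹ * x * g⁻¹⁻¹
          fun_prop
        · have hk' : g⁻¹ * k * g ∈ K := by
            have : (MulAut.conj g⁻¹).toMonoidHom k ∈ K := hk
            simpa [MulAut.conj_apply] using this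
          have h2 : x * k * g = x * g * (g⁻¹ * k * g) := by group
          change f.1 (x * k * g) = f.1 (x * g)
          rw [h2]
          exact hK _ hk' (x * g)⟩
      map_add' := fun _ _ => rfl
      map_smul' := fun _ _ => rfl }
  map_one' := by
    ext f x
    simp
  map_mul' a b := by
    ext f x
    simp [mul_assoc]

/-- `σ` has an `(H, χ)` model: there is a non-zero `G`-equivariant map from `σ` to
`C^∞(H\G, χ)`. -/
def HasModel {G V : Type*} [Group G] [TopologicalSpace G] [IsTopologicalGroup G] [AddCommGroup V]
    [Module ℂ V] (σ : Representation ℂ G V) (H : Subgroup G) (χ : H →* Circle) : Prop :=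
  ∃ Φ : Representation.IntertwiningMap σ (smoothInd H χ), Φ ≠ 0

/-! ## The notions for `SO(2n+1)` -/

namespace SOodd

variable {n : ℕ} {F : Type*} [Field F]

theorem isClosed [TopologicalSpace F] [IsTopologicalRing F] [T2Space F] :
    IsClosed (SOodd n F : Set (Matrix.SpecialLinearGroup (Fin (2 * n + 1)) F)) := by
  have hc : Continuous fun g : Matrix.SpecialLinearGroup (Fin (2 * n + 1)) F =>
      (g : Matrix (Fin (2 * n + 1)) (Fin (2 * n + 1)) F) :=
    continuous_subtype_val
  exact isClosed_eq ((hc.matrix_transpose.matrix_mul continuous_const).matrix_mul hc)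
    continuous_const

instance locallyCompactSpace [ValuativeRel F] [TopologicalSpace F]
    [IsNonarchimedeanLocalField F] : LocallyCompactSpace (SOodd n F) := by
  have : T2Space F := by
    let := IsTopologicalAddGroup.rightUniformSpace F
    have := isUniformAddGroup_of_addCommGroup (G := F)
    infer_instance
  have : LocallyCompactSpace (Matrix (Fin (2 * n + 1)) (Fin (2 * n + 1)) F) :=
    inferInstanceAs (LocallyCompactSpace (Fin (2 * n + 1) → Fin (2 * n + 1) → F))
  have : LocallyCompactSpace (Matrix.SpecialLinearGroup (Fin (2 * n + 1)) F) :=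
    Matrix.SpecialLinearGroup.isClosedEmbedding_val.locallyCompactSpace
  exact (isClosed (n := n) (F := F)).isClosedEmbedding_subtypeVal.locallyCompactSpace

variable [TopologicalSpace F] [IsTopologicalRing F] {V : Type*} [AddCommGroup V] [Module ℂ V]

/-- A representation of `SO(2n+1)` has a Bessel model (with respect to `ψ`) if it maps
non-trivially to the smooth functions on the group that are equivariant under the Bessel
subgroup and its character. -/
def HasBesselModel (ψ : AddChar F Circle) (σ : Representation ℂ (SOodd n F) V) : Prop :=
  HasModel σ (bessel n F) (besselChar ψ)

/-- A representation of `SO(2n+1)` is generic if it has a Whittaker model for some non-degenerate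
character of `N`. -/
def IsGeneric (σ : Representation ℂ (SOodd n F) V) : Prop :=
  ∃ χ : unip n F →* Circle, IsNondegenerate χ ∧ HasModel σ (unip n F) χ

end SOodd

/-! Write P for the stabilizer of the line of the first coordinate vector, `radP` and `radM` for its
unipotent radical and the opposite one, and q for the index of `t 𝒪` in `𝒪`, where t is a fixed
non-zero element with |t| < 1. The proof turns the Bessel functional into a form that is equivariant
under all of N except possibly one simple root group. Either that root group yields a Whittaker
functional, or the form gives a Jacquet module exponent along P that temperedness forbids.

Translating the Bessel functional by the Weyl element `weyl` gives a form `l` with three properties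
(`HasBesselModel.exists_exchangeForm`). It transforms by ψ of the superdiagonal in rows 1, …, n-1
under the unipotent matrices whose first row vanishes in columns 1, …, n. It is invariant under
`radM c` for c in an isotropic space of dimension n-1. It is invariant under diag(t, 1, …, 1, t⁻¹),
which comes from the torus of the Bessel subgroup.

Root exchange (`IsExchangeForm.exists_succ`) trades the coordinates of c one by one for missing
entries of the first row. The new form is v ↦ ∫ l(σ(step r) v) dr. The commutator of `step r` with
the opposite root element of parameter s lies in a simple root group where the character takes the
value ψ(rs). Hence the integrand has compact support, and moving v by the opposite root group
computes the Fourier transform of the integrand, so that the new form is not zero. Translating r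
gives equivariance under the enlarged group; rescaling r by t⁻¹ multiplies the torus eigenvalue by
q⁻¹.

After n-1 exchanges only the root group of the first simple root is uncontrolled. If `l` is not
invariant under it, a non-trivial character of this root group occurs in the twisted coinvariants,
and σ is generic (`isGeneric_of_ne`, resting on `exists_equivariant_form`).

Otherwise `l` is invariant under the radical of P, and the torus element acts on it by q^{-(n-1)},
whereas the square root of the modulus character of P is q^{-(2n-1)/2}, which is smaller. This
contradicts the exponent criterion for temperedness, and `not_isTemperedRep` makes the contradiction
explicit. Average `l` over a small congruence subgroup K. By the Iwahori decomposition
(`exists_iwahori`) the resulting coefficient still decays only like q^{-(n-1)M} at the M-th power of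
the torus element, while the corresponding double cosets of K contain at least a constant times
q^{(2n-1)M} left cosets. The integral of the power 2 + 1/n therefore diverges. -/

/-! ## Balls in a non-archimedean local field -/

namespace LocalBall

open ValuativeRel

variable {F : Type*} [Field F] [ValuativeRel F]

/-- The fractional ideal `t ^ m 𝒪`. -/
def ball (t : F) (m : ℤ) : AddSubgroup F where
  carrier := {x | valuation F x ≤ valuation F t ^ m}
  zero_mem' := by simp
  add_mem' {a b} ha hb := by
    rw [Set.mem_ofPred_eq] at *
    exact (Valuation.map_add _ a b).trans (max_le ha hb)
  neg_mem' {a} ha := by simpa [Valuation.map_neg] using ha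

theorem mem_ball {t : F} {m : ℤ} {x : F} :
    x ∈ ball t m ↔ valuation F x ≤ valuation F t ^ m := Iff.rfl

variable {t : F}

theorem zpow_mul_mem (ht : t ≠ 0) {m k : ℤ} {x : F} :
    t ^ k * x ∈ ball t (m + k) ↔ x ∈ ball t m := by
  have h0 : valuation F t ≠ 0 := by simpa using ht
  rw [mem_ball, mem_ball, map_mul, map_zpow₀, zpow_add₀ h0, mul_comm]
  exact mul_le_mul_iff_left₀ (zero_lt_iff.mpr (zpow_ne_zero _ h0))

theorem mul_mem {t : F} (ht : t ≠ 0) {m k : ℤ} {x y : F} (hx : x ∈ ball t m)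
    (hy : y ∈ ball t k) : x * y ∈ ball t (m + k) := by
  have h0 : valuation F t ≠ 0 := by simpa using ht
  rw [mem_ball, map_mul, zpow_add₀ h0]
  exact mul_le_mul' hx hy

theorem one_mem : (1 : F) ∈ ball t 0 := by simp [mem_ball]

theorem ball_anti (ht : t ≠ 0) (ht1 : valuation F t < 1) {m k : ℤ} (h : m ≤ k) :
    ball t k ≤ ball t m := fun x hx => by
  have h0 : 0 < valuation F t := zero_lt_iff.mpr (by simpa using ht)
  exact le_trans (mem_ball.mp hx) (zpow_le_zpow_right_of_le_one₀ h0 ht1.le h)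

variable [TopologicalSpace F] [IsNonarchimedeanLocalField F]

/-- The element need not generate the maximal ideal: everywhere below the index `resIndex t` plays
the role of the residue cardinality, so |t| < 1 is enough. -/
theorem exists_uniformizer (F : Type*) [Field F] [ValuativeRel F] [TopologicalSpace F]
    [IsNonarchimedeanLocalField F] : ∃ t : F, t ≠ 0 ∧ valuation F t < 1 := by
  obtain ⟨r, hr, hr1⟩ := Valuation.IsNontrivial.exists_lt_one (v := valuation F)
  exact ⟨r, by simpa using hr, hr1⟩

theorem exists_pow_lt (ht1 : valuation F t < 1) {γ : ValueGroupWithZero F} (hγ : γ ≠ 0) :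
    ∃ m : ℕ, valuation F t ^ m < γ := by
  exact exists_pow_lt₀ ht1 (Units.mk0 γ hγ)

theorem exists_ball_subset (ht1 : valuation F t < 1) {U : Set F} (hU : U ∈ nhds (0 : F)) :
    ∃ m : ℕ, (ball t m : Set F) ⊆ U := by
  obtain ⟨γ, hγ, h⟩ := (IsValuativeTopology.hasBasis_nhds_zero' F).mem_iff.mp hU
  obtain ⟨m, hm⟩ := exists_pow_lt ht1 hγ
  exact ⟨m, fun x hx => h (lt_of_le_of_lt (mem_ball.mp hx) (by simpa using hm))⟩

theorem exists_mem_ball (ht : t ≠ 0) (ht1 : valuation F t < 1) (x : F) :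
    ∃ m : ℕ, x ∈ ball t (-m) := by
  by_cases hx : x = 0
  · exact ⟨0, hx ▸ (ball t _).zero_mem⟩
  obtain ⟨m, hm⟩ := exists_pow_lt ht1 (γ := valuation F x⁻¹) (by simpa using hx)
  refine ⟨m, ?_⟩
  rw [mem_ball, _root_.zpow_neg, zpow_natCast]
  rw [map_inv₀] at hm
  have h0 : 0 < valuation F t ^ m := zero_lt_iff.mpr (pow_ne_zero _ (by simpa using ht))
  exact ((lt_inv_comm₀ h0 (zero_lt_iff.mpr (by simpa using hx))).mp hm).le

theorem ball_isOpen (ht : t ≠ 0) (m : ℤ) : IsOpen (ball t m : Set F) := by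
  refine (ball t m).isOpen_of_mem_nhds (g := 0) ?_
  refine (IsValuativeTopology.hasBasis_nhds_zero' F).mem_iff.mpr
    ⟨valuation F t ^ m, zpow_ne_zero _ (by simpa using ht), fun x hx => mem_ball.mpr (le_of_lt ?_)⟩
  rwa [Set.mem_ofPred_eq] at hx

theorem ball_isCompact (m : ℤ) : IsCompact (ball t m : Set F) :=
  IsNonarchimedeanLocalField.isCompact_closedBall F _

instance : T2Space F := by
  let := IsTopologicalAddGroup.rightUniformSpace F
  have := isUniformAddGroup_of_addCommGroup (G := F)
  infer_instance

/-- An open additive subgroup contains a positive multiple of every element. -/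
theorem exists_nsmul_mem (ht : t ≠ 0) (ht1 : valuation F t < 1) (A : AddSubgroup F)
    (hA : IsOpen (A : Set F)) (x : F) : ∃ N : ℕ, 0 < N ∧ N • x ∈ A := by
  obtain ⟨m, hm⟩ := exists_mem_ball ht ht1 x
  -- The element x lies in a compact ball, in which the open subgroup A has finite index; that index
  -- is the required multiple.
  have hc : CompactSpace (ball t (-m : ℤ)) := isCompact_iff_compactSpace.mp (ball_isCompact _)
  have ho : IsOpen ((A.addSubgroupOf (ball t (-m : ℤ)) : AddSubgroup _) : Set (ball t (-m : ℤ))) :=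
    hA.preimage continuous_subtype_val
  have hq := AddSubgroup.quotient_finite_of_isOpen _ ho
  have hf : (A.addSubgroupOf (ball t (-m : ℤ))).FiniteIndex :=
    AddSubgroup.finiteIndex_of_finite_quotient
  refine ⟨(A.addSubgroupOf (ball t (-m : ℤ))).index, Nat.pos_of_ne_zero hf.index_ne_zero, ?_⟩
  have := AddSubgroup.nsmul_index_mem (A.addSubgroupOf (ball t (-m : ℤ))) ⟨x, hm⟩
  simpa [AddSubgroup.mem_addSubgroupOf] using this

/-- Multiplication by a non-zero scalar as an automorphism of the additive group. -/
def scale {a : F} (ha : a ≠ 0) : F ≃ₜ+ F where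
  toFun x := a * x
  invFun x := a⁻¹ * x
  left_inv x := by simp [ha]
  right_inv x := by simp [ha]
  map_add' := mul_add a
  continuous_toFun := continuous_const_mul a
  continuous_invFun := continuous_const_mul a⁻¹

/-- The index of `t 𝒪` in `𝒪`. -/
noncomputable def resIndex (t : F) : ℕ := (ball t 1).relIndex (ball t 0)

theorem relIndex_succ (ht : t ≠ 0) (m : ℤ) :
    (ball t (m + 1)).relIndex (ball t m) = resIndex t := by
  let e : F ≃+ F := (scale (zpow_ne_zero m ht)).toAddEquiv
  have h : ∀ k : ℤ, ball t (k + m) = (ball t k).map e.toAddMonoidHom := fun k => by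
    ext x
    rw [AddSubgroup.mem_map_equiv]
    have hx : x = t ^ m * e.symm x := (e.apply_symm_apply x).symm
    rw [hx, zpow_mul_mem ht, ← hx]
  have h0 := h 0
  rw [zero_add] at h0
  rw [h0, add_comm m 1, h 1]
  exact AddSubgroup.relIndex_map_map_of_injective _ _ e.injective

theorem relIndex_eq_pow (ht : t ≠ 0) (ht1 : valuation F t < 1) (m : ℕ) :
    (ball t m).relIndex (ball t 0) = resIndex t ^ m := by
  induction m with
  | zero => simp
  | succ k ih =>
    have h := AddSubgroup.relIndex_mul_relIndex (ball t ((k + 1 : ℕ) : ℤ)) (ball t k) (ball t 0)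
      (ball_anti ht ht1 (by simp)) (ball_anti ht ht1 (by simp))
    rw [← h, ih, pow_succ, mul_comm]
    congr 1
    exact_mod_cast relIndex_succ ht k

theorem relIndex_ne_zero (ht : t ≠ 0) (m k : ℤ) : (ball t m).relIndex (ball t k) ≠ 0 := by
  have hc : CompactSpace (ball t k) := isCompact_iff_compactSpace.mp (ball_isCompact _)
  have ho : IsOpen (((ball t m).addSubgroupOf (ball t k) : AddSubgroup _) : Set (ball t k)) :=
    (ball_isOpen ht m).preimage continuous_subtype_val
  have hq := AddSubgroup.quotient_finite_of_isOpen _ ho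
  exact AddSubgroup.index_ne_zero_of_finite

theorem one_lt_resIndex (ht : t ≠ 0) (ht1 : valuation F t < 1) : 1 < resIndex t := by
  have h0 : resIndex t ≠ 0 := relIndex_ne_zero ht 1 0
  have h1 : resIndex t ≠ 1 := fun h => by
    have := AddSubgroup.relIndex_eq_one.mp h (one_mem (t := t))
    rw [mem_ball] at this
    simp at this
    exact absurd this (not_le.mpr ht1)
  omega

/-- Representatives of `𝒪 / t ^ m 𝒪`. -/
theorem exists_representatives (ht : t ≠ 0) (ht1 : valuation F t < 1) (m : ℕ) :
    ∃ R : Finset F, R.card = resIndex t ^ m ∧ (∀ x ∈ R, x ∈ ball t 0) ∧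
      ∀ x ∈ R, ∀ y ∈ R, x - y ∈ ball t m → x = y := by
  classical
  have hf : Finite (ball t 0 ⧸ (ball t (m : ℤ)).addSubgroupOf (ball t 0)) := by
    have := relIndex_ne_zero ht (m : ℤ) 0
    exact (AddSubgroup.finiteIndex_iff_finite_quotient).mp ⟨this⟩
  have := Fintype.ofFinite (ball t 0 ⧸ (ball t (m : ℤ)).addSubgroupOf (ball t 0))
  let f : (ball t 0 ⧸ (ball t (m : ℤ)).addSubgroupOf (ball t 0)) → F := fun c => (Quotient.out c : ball t 0)
  have key : ∀ c d, f c - f d ∈ ball t m → c = d := fun c d h => by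
    rw [← Quotient.out_eq c, ← Quotient.out_eq d]
    refine (QuotientAddGroup.eq (s := (ball t (m : ℤ)).addSubgroupOf (ball t 0))).mpr ?_
    rw [AddSubgroup.mem_addSubgroupOf]
    have := (ball t (m : ℤ)).neg_mem h
    simpa [f, sub_eq_neg_add] using this
  have hinj : Function.Injective f := fun c d h => key c d (by rw [h, sub_self]; exact zero_mem _)
  refine ⟨Finset.univ.image f, ?_, ?_, ?_⟩
  · rw [Finset.card_image_of_injective _ hinj, ← relIndex_eq_pow ht ht1, Finset.card_univ,
      ← Nat.card_eq_fintype_card]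
    rfl
  · simp [f]
  · simp only [Finset.mem_image, Finset.mem_univ, true_and]
    rintro _ ⟨c, rfl⟩ _ ⟨d, rfl⟩ h
    rw [key c d h]

/-- The elements that pair trivially with an open subgroup under a non-trivial character of `F`
lie in a ball. -/
theorem exists_annihilator_subset (ht : t ≠ 0) (ht1 : valuation F t < 1) {ψ : AddChar F Circle}
    (hψ1 : ψ ≠ 1) : ∃ k : ℤ, ∀ (m : ℤ) (r : F), (∀ s ∈ ball t m, ψ (r * s) = 1) → r ∈ ball t (k - m) := by
  obtain ⟨a, ha⟩ := AddChar.ne_one_iff.mp hψ1 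
  obtain ⟨j, hj⟩ := exists_mem_ball ht ht1 a
  refine ⟨-j, fun m r hr => ?_⟩
  by_contra hrk
  have h0 : 0 < valuation F t := zero_lt_iff.mpr (by simpa using ht)
  rw [mem_ball, not_le] at hrk
  have hr0 : r ≠ 0 := fun h => by simp [h] at hrk
  refine ha ?_
  -- If r is too large, then s = a / r already lies in the ball, and ψ(rs) = ψ(a) ≠ 1.
  have := hr (a / r) ?_
  · rwa [mul_div_cancel₀ _ hr0] at this
  · rw [mem_ball, map_div₀, div_le_iff₀ (zero_lt_iff.mpr (by simpa using hr0))]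
    calc valuation F a ≤ valuation F t ^ (-(j : ℤ)) := mem_ball.mp hj
      _ = valuation F t ^ m * valuation F t ^ (-(j : ℤ) - m) := by
        rw [← zpow_add₀ h0.ne']; congr 1; ring
      _ ≤ _ := mul_le_mul_right hrk.le _

theorem ball_isClosed (ht : t ≠ 0) (m : ℤ) : IsClosed (ball t m : Set F) :=
  AddSubgroup.isClosed_of_isOpen _ (ball_isOpen ht m)

/-! ### Haar measure on the additive group of the field -/

section Measure

variable [MeasurableSpace F] [BorelSpace F]

/-- Scaling by `t` multiplies integrals by the inverse index of `t 𝒪` in `𝒪`. -/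
theorem integral_inv_mul (ht : t ≠ 0) (ht1 : valuation F t < 1) (μ : Measure F) [μ.IsAddHaarMeasure]
    [μ.Regular] (f : F → ℂ) :
    ∫ r, f (t⁻¹ * r) ∂μ = (resIndex t : ℂ)⁻¹ * ∫ r, f r ∂μ := by
  let φ : F ≃ₜ+ F := scale (inv_ne_zero ht)
  -- The scaling factor of the measure is read off from one set: `𝒪` consists of `resIndex t` cosets
  -- of `t 𝒪`, and multiplication by t⁻¹ pulls `𝒪` back to `t 𝒪`.
  have hb : μ (ball t 0) = resIndex t * μ (ball t 1) := by
    let ν : Measure (ball t (0 : ℤ)) := μ.comap Subtype.val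
    have hme : MeasurableEmbedding (Subtype.val : ball t (0 : ℤ) → F) :=
      MeasurableEmbedding.subtype_coe (ball_isOpen ht 0).measurableSet
    have hinv : ν.IsAddLeftInvariant :=
      Measure.IsAddLeftInvariant.comap μ (f := (ball t (0 : ℤ)).subtype) hme
    have hfi : ((ball t 1).addSubgroupOf (ball t 0)).FiniteIndex := ⟨relIndex_ne_zero ht 1 0⟩
    have h := AddSubgroup.index_mul_measure ((ball t 1).addSubgroupOf (ball t 0))
      (hme.measurable (ball_isOpen ht 1).measurableSet) ν
    rw [hme.comap_apply, hme.comap_apply, Set.image_univ, Subtype.range_coe_subtype] at h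
    have himg : (Subtype.val '' (((ball t 1).addSubgroupOf (ball t 0) : AddSubgroup _) :
        Set (ball t (0 : ℤ)))) = (ball t 1 : Set F) := by
      ext x
      simp only [Set.mem_image, SetLike.mem_coe, AddSubgroup.mem_addSubgroupOf, Subtype.exists,
        exists_and_left, exists_prop, exists_eq_right_right, and_iff_left_iff_imp]
      exact fun hx => ball_anti ht ht1 zero_le_one hx
    rw [himg] at h
    exact h.symm
  have h1 := addEquivAddHaarChar_smul_map μ φ
  have hφ : φ ⁻¹' (ball t 0) = (ball t 1 : Set F) := by
    ext x
    have := zpow_mul_mem ht (m := 1) (k := -1) (x := x)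
    rw [_root_.zpow_neg_one] at this
    exact this
  have h2 : (addEquivAddHaarChar φ : ℝ) = resIndex t := by
    have h := addEquivAddHaarChar_smul_preimage μ (X := ball t 0) φ
    rw [hφ, hb] at h
    have hpos : μ (ball t 1) ≠ 0 :=
      ((ball_isOpen ht 1).measure_pos μ ⟨0, zero_mem _⟩).ne'
    have hfin : μ (ball t 1) ≠ ⊤ := (ball_isCompact 1).measure_lt_top.ne
    have h' := (ENNReal.mul_left_inj hpos hfin).mp h
    have := congrArg ENNReal.toReal h'
    simpa using this
  have hq : (resIndex t : ℂ) ≠ 0 := by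
    have := relIndex_ne_zero ht 1 0
    exact_mod_cast this
  have h3 : ∫ r, f (t⁻¹ * r) ∂μ = ∫ r, f r ∂(μ.map φ) :=
    ((φ.toHomeomorph.toMeasurableEquiv.measurableEmbedding).integral_map f).symm
  rw [h3]
  nth_rw 2 [← h1]
  rw [integral_smul_nnreal_measure, NNReal.smul_def, h2, Complex.real_smul]
  push_cast
  rw [inv_mul_cancel_left₀ hq]

/-- The mass of a character of `F` on a ball. -/
theorem integral_char_ball (μ : Measure F) [μ.IsAddHaarMeasure] (ψ : AddChar F Circle)
    (m : ℤ) (r : F) (h : ∃ s ∈ ball t m, ψ (r * s) ≠ 1) :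
    ∫ s, (ball t m : Set F).indicator (fun s => (ψ (r * s) : ℂ)) s ∂μ = 0 := by
  obtain ⟨s₀, hs₀, h1⟩ := h
  set I := ∫ s, (ball t m : Set F).indicator (fun s => (ψ (r * s) : ℂ)) s ∂μ with hI
  -- Translation by s₀ preserves the ball and the measure but multiplies the integrand by ψ(r s₀) ≠
  -- 1.
  have h2 : I = (ψ (r * s₀) : ℂ) * I := by
    rw [hI, ← integral_const_mul]
    conv_lhs => rw [← integral_add_left_eq_self _ s₀]
    refine integral_congr_ae (Filter.Eventually.of_forall fun s => ?_)
    beta_reduce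
    by_cases hs : s ∈ ball t m
    · rw [Set.indicator_of_mem (show s₀ + s ∈ (ball t m : Set F) from add_mem hs₀ hs),
        Set.indicator_of_mem (show s ∈ (ball t m : Set F) from hs), mul_add,
        AddChar.map_add_eq_mul, Circle.coe_mul]
    · rw [Set.indicator_of_notMem
        (show s₀ + s ∉ (ball t m : Set F) from fun h => hs (((ball t m).add_mem_cancel_left hs₀).mp h)),
        Set.indicator_of_notMem (show s ∉ (ball t m : Set F) from hs), mul_zero]
  by_contra hne
  refine h1 (Circle.ext ?_)
  rw [Circle.coe_one]
  exact mul_right_cancel₀ hne (by rw [← h2, one_mul])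

end Measure

end LocalBall

/-! ## Characters occurring in locally finite representations of commutative groups -/

section CommGroup

variable {X W : Type*} [CommGroup X] [AddCommGroup W] [Module ℂ W]

/-- If every element of the commutative group `X` acts on each vector through a finite cyclic
group, then each non-zero vector survives in the coinvariants of some unitary character of `X`. -/
theorem exists_equivariant_form (ρ : Representation ℂ X W)
    (hfin : ∀ x w, ∃ N : ℕ, 0 < N ∧ ρ (x ^ N) w = w) {w₀ : W} (hw₀ : w₀ ≠ 0) :
    ∃ (χ : X →* Circle) (l : Module.Dual ℂ W),
      (∀ x w, l (ρ x w) = (χ x : ℂ) * l w) ∧ l w₀ ≠ 0 := by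
  -- The annihilator of w₀ is a proper ideal of the commutative group algebra; the character comes
  -- from a maximal ideal above it.
  let I : Ideal (MonoidAlgebra ℂ X) :=
    { carrier := {a | ρ.asAlgebraHom a w₀ = 0}
      zero_mem' := by simp
      add_mem' := fun {a b} ha hb => by
        rw [Set.mem_ofPred_eq] at *
        rw [map_add, LinearMap.add_apply, ha, hb, add_zero]
      smul_mem' := fun c a ha => by
        rw [Set.mem_ofPred_eq] at *
        rw [smul_eq_mul, map_mul, Module.End.mul_apply, ha, map_zero] }
  have hI : ∀ a, a ∈ I ↔ ρ.asAlgebraHom a w₀ = 0 := fun a => Iff.rfl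
  have hI1 : I ≠ ⊤ := fun h => by
    have := (hI 1).mp (h ▸ Submodule.mem_top)
    rw [map_one, Module.End.one_apply] at this
    exact hw₀ this
  obtain ⟨m, hm, hIm⟩ := Ideal.exists_le_maximal I hI1
  let : Field (MonoidAlgebra ℂ X ⧸ m) := Ideal.Quotient.field m
  let q := Ideal.Quotient.mkₐ ℂ m
  have hof : ∀ x, ∃ N : ℕ, 0 < N ∧ q (MonoidAlgebra.of ℂ X x) ^ N = 1 := fun x => by
    obtain ⟨N, hN, hx⟩ := hfin x w₀
    refine ⟨N, hN, ?_⟩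
    rw [← map_pow, ← map_pow, ← sub_eq_zero, ← map_one q, ← map_sub]
    refine Ideal.Quotient.eq_zero_iff_mem.mpr (hIm ((hI _).mpr ?_))
    rw [map_sub, map_one, MonoidAlgebra.of_apply, Representation.asAlgebraHom_single_one,
      LinearMap.sub_apply, hx, Module.End.one_apply, sub_self]
  -- Group elements become roots of unity in the residue field, which is therefore algebraic over ℂ
  -- and equal to ℂ, although X need not be finitely generated.
  have hint : Algebra.IsIntegral ℂ (MonoidAlgebra ℂ X ⧸ m) := ⟨fun y => by
    obtain ⟨a, rfl⟩ := Ideal.Quotient.mkₐ_surjective ℂ m y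
    induction a using MonoidAlgebra.induction_on with
    | of x =>
      obtain ⟨N, hN, hx⟩ := hof x
      exact IsIntegral.of_pow hN (by rw [hx]; exact isIntegral_one)
    | add a b ha hb => rw [map_add]; exact ha.add hb
    | smul c a ha => rw [map_smul]; exact ha.smul c⟩
  have hbij : Function.Bijective (Algebra.ofId ℂ (MonoidAlgebra ℂ X ⧸ m)) :=
    IsAlgClosed.algebraMap_bijective_of_isIntegral
  let e := (AlgEquiv.ofBijective (Algebra.ofId ℂ (MonoidAlgebra ℂ X ⧸ m)) hbij).symm
  let π : MonoidAlgebra ℂ X →ₐ[ℂ] ℂ := (e : _ →ₐ[ℂ] ℂ).comp q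
  have hπ' : ∀ a ∈ m, π a = 0 := fun a ha => by
    change e (q a) = 0
    rw [show q a = 0 from Ideal.Quotient.eq_zero_iff_mem.mpr ha, map_zero]
  have hπof : ∀ x, ∃ N : ℕ, 0 < N ∧ π (MonoidAlgebra.of ℂ X x) ^ N = 1 := fun x => by
    obtain ⟨N, hN, hx⟩ := hof x
    refine ⟨N, hN, ?_⟩
    change e (q (MonoidAlgebra.of ℂ X x)) ^ N = 1
    rw [← map_pow, hx, map_one]
  let χ : X →* Circle :=
    { toFun := fun x => ⟨π (MonoidAlgebra.of ℂ X x), by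
        obtain ⟨N, hN, hx⟩ := hπof x
        rw [Submonoid.unitSphere, ← SetLike.mem_coe]
        exact mem_sphere_zero_iff_norm.mpr (Complex.norm_eq_one_of_pow_eq_one hx hN.ne')⟩
      map_one' := Circle.ext (by
        change π (MonoidAlgebra.of ℂ X 1) = 1
        rw [map_one, map_one])
      map_mul' := fun x y => Circle.ext (by
        change π (MonoidAlgebra.of ℂ X (x * y)) = _
        rw [map_mul, map_mul]
        rfl) }
  have hχ : ∀ x, (χ x : ℂ) = π (MonoidAlgebra.of ℂ X x) := fun x => rfl
  let S : Submodule ℂ W := Submodule.span ℂ {y | ∃ x w, y = ρ x w - (χ x : ℂ) • w}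
  -- Every vector of S is killed by an element outside the maximal ideal, whereas the annihilator of
  -- w₀ is inside it. Hence w₀ is not in S.
  have key : ∀ y ∈ S, ∃ a, π a ≠ 0 ∧ ρ.asAlgebraHom a y = 0 := fun y hy => by
    induction hy using Submodule.span_induction with
    | zero => exact ⟨1, by simp, by simp⟩
    | add y z _ _ hy hz =>
      obtain ⟨a, ha, hay⟩ := hy
      obtain ⟨b, hb, hbz⟩ := hz
      refine ⟨a * b, by rw [map_mul]; exact mul_ne_zero ha hb, ?_⟩
      rw [map_add]
      nth_rw 1 [mul_comm a b]
      rw [map_mul, map_mul, Module.End.mul_apply, Module.End.mul_apply, hay, hbz, map_zero,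
        map_zero, add_zero]
    | smul c y _ hy =>
      obtain ⟨a, ha, hay⟩ := hy
      exact ⟨a, ha, by rw [map_smul, hay, smul_zero]⟩
    | mem y hy =>
      obtain ⟨x, w, rfl⟩ := hy
      obtain ⟨N, hN, hxw⟩ := hfin x w
      obtain ⟨M, hM, hxM⟩ := hπof x
      set z := π (MonoidAlgebra.of ℂ X x) with hz
      set g := MonoidAlgebra.of ℂ X x with hg
      have hz0 : z ≠ 0 := fun h => by rw [h, zero_pow hM.ne'] at hxM; exact zero_ne_one hxM
      -- This geometric sum times g - z is g^{NM} - z^{NM}, which kills w because x^N fixes w and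
      -- z^M = 1. Its image under π is NM z^{NM-1}, non-zero in characteristic 0.
      refine ⟨∑ j ∈ Finset.range (N * M), g ^ j * (algebraMap ℂ _ z) ^ (N * M - 1 - j), ?_, ?_⟩
      · rw [map_sum, Finset.sum_congr rfl (g := fun _ => z ^ (N * M - 1)), Finset.sum_const,
          Finset.card_range, nsmul_eq_mul]
        · exact mul_ne_zero (by exact_mod_cast (Nat.mul_pos hN hM).ne') (pow_ne_zero _ hz0)
        · intro j hj
          rw [map_mul, map_pow, map_pow, AlgHom.commutes, ← hz, Algebra.algebraMap_self,
            RingHom.id_apply, ← pow_add]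
          congr 1
          have := Finset.mem_range.mp hj
          omega
      · have h1 : ρ x w - (χ x : ℂ) • w = ρ.asAlgebraHom (g - algebraMap ℂ _ z) w := by
          rw [map_sub, AlgHom.commutes, hg, MonoidAlgebra.of_apply,
            Representation.asAlgebraHom_single_one]
          rfl
        have h2 : z ^ (N * M) = 1 := by rw [mul_comm, pow_mul, hxM, one_pow]
        have h3 : ∀ k : ℕ, ρ ((x ^ N) ^ k) w = w := fun k => by
          induction k with
          | zero => rw [pow_zero, map_one, Module.End.one_apply]
          | succ k ih => rw [pow_succ, map_mul, Module.End.mul_apply, hxw, ih]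
        have h4 : ρ.asAlgebraHom (g ^ (N * M)) w = w := by
          rw [hg, ← map_pow, pow_mul, MonoidAlgebra.of_apply,
            Representation.asAlgebraHom_single_one, h3]
        rw [h1, ← Module.End.mul_apply, ← map_mul, (Commute.all _ _).geom_sum₂_mul, map_sub,
          LinearMap.sub_apply, h4, ← map_pow, h2, map_one, map_one, Module.End.one_apply, sub_self]
  have hw₀S : S.mkQ w₀ ≠ 0 := fun h => by
    rw [Submodule.mkQ_apply, Submodule.Quotient.mk_eq_zero] at h
    obtain ⟨a, ha, ha0⟩ := key w₀ h
    exact ha (hπ' a (hIm ((hI a).mpr ha0)))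
  have hl : ∃ l : Module.Dual ℂ (W ⧸ S), l (S.mkQ w₀) ≠ 0 := by
    by_contra! h
    exact hw₀S ((Module.forall_dual_apply_eq_zero_iff ℂ _).mp h)
  obtain ⟨l, hl⟩ := hl
  refine ⟨χ, l.comp S.mkQ, fun x w => ?_, hl⟩
  have : S.mkQ (ρ x w - (χ x : ℂ) • w) = 0 := by
    rw [Submodule.mkQ_apply, Submodule.Quotient.mk_eq_zero]
    exact Submodule.subset_span ⟨x, w, rfl⟩
  rw [map_sub, map_smul, sub_eq_zero] at this
  rw [LinearMap.comp_apply, this, map_smul, smul_eq_mul, LinearMap.comp_apply]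

end CommGroup

/-! ## Eichler transformations -/

namespace SOodd

variable {n : ℕ} {F : Type*} [Field F]

theorem mat_injective : Function.Injective (mat : SOodd n F → Matrix _ _ F) :=
  Subtype.val_injective.comp Subtype.val_injective

/-- The symmetric bilinear form with the antidiagonal Gram matrix. -/
def bil (x y : Fin (2 * n + 1) → F) : F := ∑ i, x i * y i.rev

theorem bil_comm (x y : Fin (2 * n + 1) → F) : bil x y = bil y x := by
  unfold bil
  rw [← Equiv.sum_comp Fin.revPerm]
  refine Finset.sum_congr rfl fun i _ => ?_
  rw [Fin.revPerm_apply, Fin.rev_rev, mul_comm]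

theorem bil_add_left (x y z : Fin (2 * n + 1) → F) : bil (x + y) z = bil x z + bil y z := by
  simp [bil, add_mul, Finset.sum_add_distrib]

theorem bil_smul_left (a : F) (x z : Fin (2 * n + 1) → F) : bil (a • x) z = a * bil x z := by
  simp [bil, Finset.mul_sum, mul_assoc]

theorem bil_neg_left (x z : Fin (2 * n + 1) → F) : bil (-x) z = -bil x z := by
  simp [bil]

theorem bil_sub_left (x y z : Fin (2 * n + 1) → F) : bil (x - y) z = bil x z - bil y z := by
  rw [sub_eq_add_neg, bil_add_left, bil_neg_left, sub_eq_add_neg]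

theorem bil_add_right (x y z : Fin (2 * n + 1) → F) : bil x (y + z) = bil x y + bil x z := by
  rw [bil_comm, bil_add_left, bil_comm y, bil_comm z]

theorem bil_smul_right (a : F) (x z : Fin (2 * n + 1) → F) : bil x (a • z) = a * bil x z := by
  rw [bil_comm, bil_smul_left, bil_comm]

theorem bil_sub_right (x y z : Fin (2 * n + 1) → F) : bil x (y - z) = bil x y - bil x z := by
  rw [bil_comm, bil_sub_left, bil_comm y, bil_comm z]

theorem bil_single_left (i : Fin (2 * n + 1)) (a : F) (x : Fin (2 * n + 1) → F) :
    bil (Pi.single i a) x = a * x i.rev := by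
  unfold bil
  rw [Finset.sum_eq_single i (fun j _ hj => by rw [Pi.single_eq_of_ne hj, zero_mul]) (by simp),
    Pi.single_eq_same]

theorem bil_single_right (i : Fin (2 * n + 1)) (a : F) (x : Fin (2 * n + 1) → F) :
    bil x (Pi.single i a) = a * x i.rev := by
  rw [bil_comm, bil_single_left]

theorem preserves_of_bil {A : Matrix (Fin (2 * n + 1)) (Fin (2 * n + 1)) F}
    (hA : ∀ x y, bil (A *ᵥ x) (A *ᵥ y) = bil x y) : Aᵀ * antidiag n F * A = antidiag n F := by
  ext i j
  have h := hA (Pi.single i 1) (Pi.single j 1)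
  rw [bil_single_left, one_mul] at h
  rw [Matrix.mul_apply]
  simp only [mul_antidiag_apply, Matrix.transpose_apply]
  have h1 : ∑ k, A k.rev i * A k j = bil (A *ᵥ Pi.single i 1) (A *ᵥ Pi.single j 1) := by
    unfold bil
    rw [← Equiv.sum_comp Fin.revPerm]
    refine Finset.sum_congr rfl fun k _ => ?_
    simp
  rw [h1, h]
  simp only [antidiag, Matrix.of_apply, Pi.single_apply]
  congr 1
  exact propext ⟨fun h => h.symm, fun h => h.symm⟩

theorem bil_mulVec (g : SOodd n F) (x y : Fin (2 * n + 1) → F) :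
    bil (mat g *ᵥ x) (mat g *ᵥ y) = bil x y := by
  have h : (mat g)ᵀ * antidiag n F * mat g = antidiag n F := g.2
  have hb : ∀ x y : Fin (2 * n + 1) → F, bil x y = x ⬝ᵥ (antidiag n F *ᵥ y) := fun x y => by
    simp only [bil, dotProduct]
    refine Finset.sum_congr rfl fun i _ => ?_
    congr 1
    simp [antidiag, Matrix.mulVec, dotProduct]
  rw [hb, hb, Matrix.mulVec_mulVec, ← Matrix.vecMul_transpose, ← Matrix.dotProduct_mulVec,
    Matrix.mulVec_mulVec, ← Matrix.mul_assoc, h]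

theorem det_sq_eq_one {A : Matrix (Fin (2 * n + 1)) (Fin (2 * n + 1)) F}
    (hA : Aᵀ * antidiag n F * A = antidiag n F) : A.det * A.det = 1 := by
  have hw : antidiag n F * antidiag n F = 1 := by
    ext i j
    rw [antidiag_mul_apply]
    simp [antidiag, Matrix.one_apply, eq_comm]
  have hd : (antidiag n F).det ≠ 0 := fun h => by
    have := congrArg Matrix.det hw
    rw [Matrix.det_mul, h, zero_mul, Matrix.det_one] at this
    exact zero_ne_one this
  have h := congrArg Matrix.det hA
  rw [Matrix.det_mul, Matrix.det_mul, Matrix.det_transpose] at h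
  exact mul_right_cancel₀ hd (by linear_combination h)

/-- The element of `SO(2n+1)` with a given matrix. -/
def mk (A : Matrix (Fin (2 * n + 1)) (Fin (2 * n + 1)) F)
    (hA : ∀ x y, bil (A *ᵥ x) (A *ᵥ y) = bil x y) (hd : A.det = 1) : SOodd n F :=
  ⟨⟨A, hd⟩, preserves_of_bil hA⟩

/-- The matrix of `x ↦ x + (q, x) u - (u, x) q - (q, q) (u, x) u / 2`. -/
def eichlerMat (u q : Fin (2 * n + 1) → F) : Matrix (Fin (2 * n + 1)) (Fin (2 * n + 1)) F :=
  Matrix.of fun i j => (if i = j then 1 else 0) + u i * q j.rev - q i * u j.rev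
    - bil q q / 2 * (u i * u j.rev)

theorem eichlerMat_mulVec (u q x : Fin (2 * n + 1) → F) :
    eichlerMat u q *ᵥ x = x + bil q x • u - bil u x • q - (bil q q / 2 * bil u x) • u := by
  have hb : ∀ y : Fin (2 * n + 1) → F, bil y x = ∑ j, y j.rev * x j := fun y => by
    rw [bil, ← Equiv.sum_comp Fin.revPerm]
    simp
  ext i
  simp only [Matrix.mulVec, dotProduct, eichlerMat, Matrix.of_apply, Pi.add_apply, Pi.sub_apply,
    Pi.smul_apply, smul_eq_mul, sub_mul, add_mul, Finset.sum_sub_distrib, Finset.sum_add_distrib,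
    ite_mul, one_mul, zero_mul, Finset.sum_ite_eq, Finset.mem_univ, if_true]
  rw [hb q, hb u, Finset.sum_mul, Finset.sum_mul, Finset.mul_sum, Finset.sum_mul]
  congr 1
  · congr 1
    · congr 1
      exact Finset.sum_congr rfl fun j _ => by ring
    · exact Finset.sum_congr rfl fun j _ => by ring
  · exact Finset.sum_congr rfl fun j _ => by ring

theorem eichlerMat_mul [CharZero F] {u q q' : Fin (2 * n + 1) → F} (hu : bil u u = 0)
    (h : bil u q = 0) (h' : bil u q' = 0) :
    eichlerMat u q * eichlerMat u q' = eichlerMat u (q + q') := by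
  refine Matrix.mulVec_injective (funext fun x => ?_)
  have hq : bil q u = 0 := by rw [bil_comm, h]
  rw [← Matrix.mulVec_mulVec]
  simp only [eichlerMat_mulVec, bil_add_right, bil_sub_right, bil_smul_right, bil_add_left, hu,
    h', hq, bil_comm q' q]
  module

theorem bil_eichlerMat [CharZero F] {u q : Fin (2 * n + 1) → F} (hu : bil u u = 0)
    (h : bil u q = 0) (x y : Fin (2 * n + 1) → F) :
    bil (eichlerMat u q *ᵥ x) (eichlerMat u q *ᵥ y) = bil x y := by
  have hq : bil q u = 0 := by rw [bil_comm, h]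
  simp only [eichlerMat_mulVec, bil_add_right, bil_sub_right, bil_smul_right, bil_add_left,
    bil_sub_left, bil_smul_left, hu, h, hq, bil_comm x u, bil_comm x q]
  ring

/-- Halving q exhibits the transformation as the square of an isometry, and an isometry has
determinant ±1. -/
theorem eichlerMat_det [CharZero F] {u q : Fin (2 * n + 1) → F} (hu : bil u u = 0)
    (h : bil u q = 0) : (eichlerMat u q).det = 1 := by
  have h2 : bil u ((1 / 2 : F) • q) = 0 := by rw [bil_smul_right, h, mul_zero]
  have h1 : eichlerMat u q = eichlerMat u ((1 / 2 : F) • q) * eichlerMat u ((1 / 2 : F) • q) := by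
    rw [eichlerMat_mul hu h2 h2]
    congr 1
    module
  rw [h1, Matrix.det_mul]
  exact det_sq_eq_one (preserves_of_bil (bil_eichlerMat hu h2))

/-- The Eichler transformation attached to an isotropic vector `u` and a vector `q` orthogonal
to it. -/
def eichler [CharZero F] (u q : Fin (2 * n + 1) → F) (hu : bil u u = 0) (h : bil u q = 0) :
    SOodd n F :=
  mk (eichlerMat u q) (bil_eichlerMat hu h) (eichlerMat_det hu h)

theorem mat_eichler [CharZero F] (u q : Fin (2 * n + 1) → F) (hu : bil u u = 0)
    (h : bil u q = 0) : mat (eichler u q hu h) = eichlerMat u q := rfl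

/-- The commutation relation of the unipotent radicals of opposite parabolic subgroups
stabilizing isotropic lines. -/
theorem eichlerMat_exchange [CharZero F] {u v b c : Fin (2 * n + 1) → F} (hu : bil u u = 0)
    (huv : bil u v = 1) (hub : bil u b = 0) (huc : bil u c = 0)
    (hvb : bil v b = 0) (hvc : bil v c = 0) (hbc : bil b c = 0) (hcc : bil c c = 0) :
    eichlerMat u b * eichlerMat v c =
      eichlerMat v c * eichlerMat c b * eichlerMat u (-(bil b b / 2) • c) * eichlerMat u b := by
  refine Matrix.mulVec_injective (funext fun x => ?_)
  have hvu : bil v u = 1 := by rw [bil_comm, huv]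
  have hbu : bil b u = 0 := by rw [bil_comm, hub]
  have hcu : bil c u = 0 := by rw [bil_comm, huc]
  have hbv : bil b v = 0 := by rw [bil_comm, hvb]
  have hcv : bil c v = 0 := by rw [bil_comm, hvc]
  have hcb : bil c b = 0 := by rw [bil_comm, hbc]
  simp only [← Matrix.mulVec_mulVec, eichlerMat_mulVec, bil_add_right, bil_sub_right, bil_smul_right,
    bil_smul_left, hu, huv, hub, huc, hvb, hvc, hbc, hcc, hvu, hbu,
    hcu, hbv, hcb]
  module

end SOodd

/-! ## Unipotent elements, the torus and a Weyl element -/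

namespace SOodd

/-! ### Filtration of the unipotent group by its first row -/

section Filtration

variable {n : ℕ} {F : Type*} [Field F]

/-- In the sum over l, the range 0 < l < j is killed by the hypothesis on a and the range l > j by
triangularity of b. This additivity makes `rowSubgroup` a group and `rowEntry` a homomorphism on the
next step of the filtration. -/
theorem row_mul {a b : SOodd n F} (ha : a ∈ unip n F) (hb : b ∈ unip n F) {j : Fin (2 * n + 1)}
    (hj : 0 < j) (h : ∀ l, 0 < l → l < j → mat a 0 l = 0) :
    mat (a * b) 0 j = mat a 0 j + mat b 0 j := by
  have hs : ∑ l ∈ ({0, j} : Finset (Fin (2 * n + 1))), mat a 0 l * mat b l j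
      = mat a 0 j + mat b 0 j := by
    rw [Finset.sum_pair hj.ne, ha.2, hb.2, one_mul, mul_one, add_comm]
  rw [mat_mul_apply, ← hs]
  refine (Finset.sum_subset (Finset.subset_univ _) fun l _ hl => ?_).symm
  simp only [Finset.mem_insert, Finset.mem_singleton, not_or] at hl
  rcases lt_or_gt_of_ne hl.2 with h1 | h1
  · rw [h l (Fin.pos_of_ne_zero hl.1) h1, zero_mul]
  · rw [hb.1 l j h1, mul_zero]

theorem row_inv {a : SOodd n F} (ha : a ∈ unip n F) {j : Fin (2 * n + 1)}
    (hj : 0 < j) (h : ∀ l, 0 < l → l < j → mat a 0 l = 0) : mat a⁻¹ 0 j = -mat a 0 j := by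
  have := row_mul ha ((unip n F).inv_mem ha) hj h
  rw [mul_inv_cancel, mat_one, Matrix.one_apply_ne hj.ne] at this
  linear_combination -this

/-- The unipotent elements whose first row vanishes in the columns `1, …, n - k`. -/
def rowSubgroup (n k : ℕ) (F : Type*) [Field F] : Subgroup (SOodd n F) where
  carrier := {u | u ∈ unip n F ∧ ∀ j, 0 < j → j.val + k ≤ n → mat u 0 j = 0}
  one_mem' := ⟨one_mem _, fun j hj _ => by rw [mat_one, Matrix.one_apply_ne hj.ne]⟩
  mul_mem' := fun {a b} ha hb => ⟨mul_mem ha.1 hb.1, fun j hj h => by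
    rw [row_mul ha.1 hb.1 hj fun l hl hlj => ha.2 l hl (by
      have : l.val < j.val := hlj
      omega), ha.2 j hj h, hb.2 j hj h, add_zero]⟩
  inv_mem' := fun {a} ha => ⟨inv_mem ha.1, fun j hj h => by
    rw [row_inv ha.1 hj fun l hl hlj => ha.2 l hl (by
      have : l.val < j.val := hlj
      omega), ha.2 j hj h, neg_zero]⟩

theorem rowSubgroup_le_unip (k : ℕ) : rowSubgroup n k F ≤ unip n F := fun _ h => h.1

theorem rowSubgroup_mono {k l : ℕ} (h : k ≤ l) : rowSubgroup n k F ≤ rowSubgroup n l F :=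
  fun _ hu => ⟨hu.1, fun j hj h' => hu.2 j hj (by omega)⟩

theorem rowSubgroup_self : rowSubgroup n n F = unip n F :=
  le_antisymm (rowSubgroup_le_unip n) fun _ hu => ⟨hu, fun j hj h => by
    have : 0 < j.val := hj
    omega⟩

/-- The entry of the first row that distinguishes `rowSubgroup n k F` in
`rowSubgroup n (k + 1) F`. -/
def rowEntry (k : ℕ) (u : SOodd n F) : F := mat u 0 ⟨n - k, by omega⟩

theorem zero_lt_rowIndex {k : ℕ} (hk : k < n) : (0 : Fin (2 * n + 1)) < ⟨n - k, by omega⟩ :=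
  Fin.lt_def.mpr (by rw [Fin.val_zero]; simp only; omega)

theorem rowEntry_mul {k : ℕ} (hk : k < n) {a b : SOodd n F} (ha : a ∈ rowSubgroup n (k + 1) F)
    (hb : b ∈ unip n F) : rowEntry k (a * b) = rowEntry k a + rowEntry k b := by
  refine row_mul ha.1 hb (zero_lt_rowIndex hk) fun l hl hlj => ha.2 l hl ?_
  have : l.val < n - k := hlj
  omega

/-- Each step of the filtration is the kernel of `rowEntry` on the next one. The lemma is used to
split off a representative `step r` from a unipotent element. -/
theorem mul_inv_mem_rowSubgroup {k : ℕ} (hk : k < n) {a b : SOodd n F}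
    (ha : a ∈ rowSubgroup n (k + 1) F) (hb : b ∈ rowSubgroup n (k + 1) F)
    (hab : rowEntry k a = rowEntry k b) : a * b⁻¹ ∈ rowSubgroup n k F := by
  have h := mul_mem ha (inv_mem hb)
  refine ⟨h.1, fun j hj hjk => ?_⟩
  rcases Nat.lt_or_ge (j.val + k) n with h' | h'
  · exact h.2 j hj (by omega)
  · have hj' : j = ⟨n - k, by omega⟩ := Fin.ext (by simp only; omega)
    have h1 : mat (a * b⁻¹) 0 j = rowEntry k (a * b⁻¹) := by rw [rowEntry, hj']
    have h2 := rowEntry_mul hk hb (inv_mem hb).1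
    have h3 : rowEntry k (1 : SOodd n F) = 0 := by
      rw [rowEntry, mat_one, Matrix.one_apply_ne]
      exact (zero_lt_rowIndex hk).ne
    rw [mul_inv_cancel, h3] at h2
    rw [h1, rowEntry_mul hk ha (inv_mem hb).1, hab, ← h2]

/-- The sum of the entries of the first superdiagonal in the rows `1, …, n - 1`. -/
def superForm (u : SOodd n F) : F :=
  ∑ i : Fin (n - 1), mat u ⟨i.val + 1, by omega⟩ ⟨i.val + 2, by omega⟩

theorem superForm_mul {a b : SOodd n F} (ha : a ∈ unip n F) (hb : b ∈ unip n F) :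
    superForm (a * b) = superForm a + superForm b := by
  unfold superForm
  rw [← Finset.sum_add_distrib]
  refine Finset.sum_congr rfl fun i _ => ?_
  rw [mat_mul_super ha.1 hb.1 _ _ rfl, ha.2, hb.2, one_mul, mul_one, add_comm]

theorem superForm_one : superForm (1 : SOodd n F) = 0 := by
  refine Finset.sum_eq_zero fun i _ => ?_
  rw [mat_one, Matrix.one_apply_ne]
  exact (Fin.mk_lt_mk.mpr (by omega)).ne

theorem superForm_inv {a : SOodd n F} (ha : a ∈ unip n F) : superForm a⁻¹ = -superForm a := by
  have h := superForm_mul ha (inv_mem ha)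
  rw [mul_inv_cancel, superForm_one] at h
  linear_combination -h

end Filtration

/-! ### The unipotent radicals of the line stabilizer and its opposite -/

section Radical

variable (n : ℕ) (F : Type*) [Field F]

theorem last_ne_zero [NeZero n] : Fin.last (2 * n) ≠ 0 := fun h => by
  have h := congrArg Fin.val h
  have := NeZero.ne n
  rw [Fin.val_last, Fin.val_zero] at h
  omega

/-- The vectors with vanishing first and last coordinate. -/
def midSpace : Submodule F (Fin (2 * n + 1) → F) where
  carrier := {q | q 0 = 0 ∧ q (Fin.last _) = 0}
  zero_mem' := ⟨rfl, rfl⟩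
  add_mem' := fun {a b} ha hb => ⟨by rw [Pi.add_apply, ha.1, hb.1, add_zero],
    by rw [Pi.add_apply, ha.2, hb.2, add_zero]⟩
  smul_mem' := fun c a ha => ⟨by rw [Pi.smul_apply, ha.1, smul_zero],
    by rw [Pi.smul_apply, ha.2, smul_zero]⟩

variable {n F}

theorem bil_first_mid (q : midSpace n F) : bil (Pi.single 0 1) (q : Fin (2 * n + 1) → F) = 0 := by
  rw [bil_single_left, Fin.rev_zero, q.2.2, mul_zero]

theorem bil_last_mid (q : midSpace n F) :
    bil (Pi.single (Fin.last _) 1) (q : Fin (2 * n + 1) → F) = 0 := by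
  rw [bil_single_left, Fin.rev_last, q.2.1, mul_zero]

theorem bil_first_last :
    bil (Pi.single 0 1 : Fin (2 * n + 1) → F) (Pi.single (Fin.last _) 1) = 1 := by
  rw [bil_single_left, Fin.rev_zero, Pi.single_eq_same, mul_one]

/-- Multiples of a coordinate vector different from the first and the last one. -/
def midSingle (i : Fin (2 * n + 1)) (h0 : i ≠ 0) (h1 : i ≠ Fin.last _) : F →ₗ[F] midSpace n F where
  toFun r := ⟨Pi.single i r, Pi.single_eq_of_ne h0.symm _, Pi.single_eq_of_ne h1.symm _⟩
  map_add' r s := Subtype.ext (Pi.single_add (f := fun _ => F) i r s)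
  map_smul' r s := Subtype.ext (Pi.single_smul (f := fun _ => F) i r s)

theorem midSingle_coe (i : Fin (2 * n + 1)) (h0 : i ≠ 0) (h1 : i ≠ Fin.last _) (r : F) :
    (midSingle i h0 h1 r : Fin (2 * n + 1) → F) = Pi.single i r := rfl

variable [NeZero n]

theorem bil_first_self :
    bil (Pi.single 0 1 : Fin (2 * n + 1) → F) (Pi.single 0 1) = 0 := by
  rw [bil_single_left, Fin.rev_zero, Pi.single_eq_of_ne (last_ne_zero n), mul_zero]

theorem bil_last_self :
    bil (Pi.single (Fin.last _) 1 : Fin (2 * n + 1) → F) (Pi.single (Fin.last _) 1) = 0 := by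
  rw [bil_single_left, Fin.rev_last, Pi.single_eq_of_ne (last_ne_zero n).symm, mul_zero]

variable [CharZero F]

/-- The unipotent radical of the stabilizer of the line of the first coordinate vector. -/
def radP (q : midSpace n F) : SOodd n F :=
  eichler (Pi.single 0 1) q bil_first_self (bil_first_mid q)

/-- The unipotent radical of the opposite parabolic subgroup. -/
def radM (q : midSpace n F) : SOodd n F :=
  eichler (Pi.single (Fin.last _) 1) q bil_last_self (bil_last_mid q)

theorem radP_apply (q : midSpace n F) (i j : Fin (2 * n + 1)) :
    mat (radP q) i j = (if i = j then 1 else 0) + (if i = 0 then q.1 j.rev else 0)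
      - (if j = Fin.last _ then q.1 i else 0)
      - (if j = Fin.last _ then if i = 0 then bil q.1 q.1 / 2 else 0 else 0) := by
  rw [radP, mat_eichler, eichlerMat, Matrix.of_apply]
  have : j.rev = 0 ↔ j = Fin.last _ := by rw [← Fin.rev_last, Fin.rev_inj]
  simp [Pi.single_apply, this]

theorem radM_apply (q : midSpace n F) (i j : Fin (2 * n + 1)) :
    mat (radM q) i j = (if i = j then 1 else 0) + (if i = Fin.last _ then q.1 j.rev else 0)
      - (if j = 0 then q.1 i else 0)
      - (if j = 0 then if i = Fin.last _ then bil q.1 q.1 / 2 else 0 else 0) := by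
  rw [radM, mat_eichler, eichlerMat, Matrix.of_apply]
  have : j.rev = Fin.last _ ↔ j = 0 := by rw [← Fin.rev_zero, Fin.rev_inj]
  simp [Pi.single_apply, this]

theorem radP_add (q q' : midSpace n F) : radP (q + q') = radP q * radP q' :=
  mat_injective (eichlerMat_mul bil_first_self (bil_first_mid q) (bil_first_mid q')).symm

theorem radP_zero : radP (0 : midSpace n F) = 1 := by
  have := radP_add (0 : midSpace n F) 0
  rw [add_zero] at this
  exact (mul_eq_left.mp this.symm)

theorem radP_neg (q : midSpace n F) : radP (-q) = (radP q)⁻¹ := by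
  rw [eq_inv_iff_mul_eq_one, ← radP_add, neg_add_cancel, radP_zero]

theorem radM_add (q q' : midSpace n F) : radM (q + q') = radM q * radM q' :=
  mat_injective (eichlerMat_mul bil_last_self (bil_last_mid q) (bil_last_mid q')).symm

theorem radM_zero : radM (0 : midSpace n F) = 1 := by
  have := radM_add (0 : midSpace n F) 0
  rw [add_zero] at this
  exact (mul_eq_left.mp this.symm)

theorem radM_neg (q : midSpace n F) : radM (-q) = (radM q)⁻¹ := by
  rw [eq_inv_iff_mul_eq_one, ← radM_add, neg_add_cancel, radM_zero]

/-- When c is isotropic and orthogonal to b, moving `radP b` past `radM c` costs no torus part: only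
a unipotent element of the Levi subgroup and an element of the radical in the direction of c appear.
-/
theorem radP_mul_radM (b c : midSpace n F) (hbc : bil b.1 c.1 = 0) (hcc : bil c.1 c.1 = 0) :
    radP b * radM c = radM c * eichler c.1 b.1 hcc (by rw [bil_comm, hbc])
      * radP (-(bil b.1 b.1 / 2) • c) * radP b :=
  mat_injective (eichlerMat_exchange bil_first_self bil_first_last (bil_first_mid b)
    (bil_first_mid c) (bil_last_mid b) (bil_last_mid c) hbc hcc)

theorem radP_mem_unip (q : midSpace n F) : radP q ∈ unip n F := by
  refine ⟨fun i j hij => ?_, fun i => ?_⟩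
  · rw [radP_apply, if_neg hij.ne', if_neg (ne_of_gt (lt_of_le_of_lt (Fin.zero_le _) hij)),
      if_neg (ne_of_lt (lt_of_lt_of_le hij (Fin.le_last _))),
      if_neg (ne_of_lt (lt_of_lt_of_le hij (Fin.le_last _)))]
    simp
  · rw [radP_apply, if_pos rfl]
    by_cases h : i = 0
    · subst h
      simp [(last_ne_zero n).symm, q.2.2]
    · by_cases h' : i = Fin.last _
      · subst h'
        simp [last_ne_zero n, q.2.2]
      · simp [h, h']

theorem radP_mem_rowSubgroup {k : ℕ} {q : midSpace n F}
    (hq : ∀ i : Fin (2 * n + 1), n + k ≤ i.val → q.1 i = 0) : radP q ∈ rowSubgroup n k F := by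
  refine ⟨radP_mem_unip q, fun j hj hjk => ?_⟩
  have hn := NeZero.ne n
  have h1 : j ≠ Fin.last _ := fun h => by rw [h, Fin.val_last] at hjk; omega
  rw [radP_apply, if_neg hj.ne, if_pos rfl, if_neg h1, if_neg h1,
    hq j.rev (by rw [Fin.val_rev]; omega)]
  simp

/-- Off the diagonal the radical lives in row 0 and in the last column, neither of which `superForm`
reads. -/
theorem superForm_radP (q : midSpace n F) : superForm (radP q) = 0 := by
  refine Finset.sum_eq_zero fun i _ => ?_
  have h1 : (⟨i.val + 1, by omega⟩ : Fin (2 * n + 1)) ≠ 0 := fun h => by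
    simpa using congrArg Fin.val h
  have h2 : (⟨i.val + 2, by omega⟩ : Fin (2 * n + 1)) ≠ Fin.last _ := fun h => by
    have := congrArg Fin.val h
    simp only [Fin.val_last] at this
    omega
  rw [radP_apply, if_neg (Fin.mk_lt_mk.mpr (by omega)).ne, if_neg h1, if_neg h2, if_neg h2]
  simp

end Radical

end SOodd

namespace SOodd

/-! ### The pairs of roots that are exchanged -/

section RootVectors

variable {n : ℕ} {F : Type*} [Field F]

/-- The multiples of the coordinate vector number `n + k`. -/
def stepVec (k : ℕ) [NeZero n] (hk : k < n) : F →ₗ[F] midSpace n F :=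
  midSingle ⟨n + k, by omega⟩
    (fun h => by
      have h := congrArg Fin.val h
      rw [Fin.val_zero] at h
      simp only at h
      omega)
    (fun h => by
      have h := congrArg Fin.val h
      rw [Fin.val_last] at h
      simp only at h
      omega)

variable [NeZero n] {k : ℕ} (hk : k < n)

theorem stepVec_apply (r : F) (i : Fin (2 * n + 1)) :
    (stepVec k hk r).1 i = if i.val = n + k then r else 0 := by
  rw [stepVec, midSingle_coe, Pi.single_apply]
  congr 1
  rw [Fin.ext_iff]

/-- Vectors supported in the coordinates `0, …, n - 1 - k`. -/
def LowSupport (k : ℕ) (c : Fin (2 * n + 1) → F) : Prop :=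
  ∀ i : Fin (2 * n + 1), n ≤ i.val + k → c i = 0

theorem bil_stepVec {c : Fin (2 * n + 1) → F} (hc : LowSupport k c) (r : F) :
    bil (stepVec k hk r).1 c = 0 := by
  rw [stepVec, midSingle_coe, bil_single_left, hc _ (by rw [Fin.val_rev]; simp only; omega),
    mul_zero]

theorem LowSupport.bil_self {n k : ℕ} {c : Fin (2 * n + 1) → F} (hc : LowSupport k c) :
    bil c c = 0 := by
  refine Finset.sum_eq_zero fun i _ => ?_
  rcases Nat.lt_or_ge (i.val + k) n with h | h
  · rw [hc i.rev (by rw [Fin.val_rev]; omega), mul_zero]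
  · rw [hc i h, zero_mul]

variable [CharZero F]

/-- The one-parameter group of the exchanged root. -/
def step (r : F) : SOodd n F := radP (stepVec k hk r)

theorem step_add (r s : F) : step hk (r + s) = step hk r * step hk s := by
  rw [step, map_add, radP_add]; rfl

theorem step_mem (r : F) : step hk r ∈ rowSubgroup n (k + 1) F :=
  radP_mem_rowSubgroup fun i hi => by
    rw [stepVec_apply, if_neg (by omega)]

theorem rowEntry_step (r : F) : rowEntry k (step hk r) = r := by
  have h1 : (⟨n - k, by omega⟩ : Fin (2 * n + 1)) ≠ Fin.last _ := fun h => by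
    have h := congrArg Fin.val h
    rw [Fin.val_last] at h
    simp only at h
    omega
  rw [rowEntry, step, radP_apply, if_neg (zero_lt_rowIndex hk).ne, if_pos rfl, if_neg h1, if_neg h1,
    stepVec_apply, if_pos (by rw [Fin.val_rev]; simp only; omega)]
  simp

theorem superForm_step (r : F) : superForm (step hk r) = 0 := superForm_radP _

/-- The commutator of the exchanged roots. -/
def stepComm {c : Fin (2 * n + 1) → F} (hc : LowSupport k c) (r : F) : SOodd n F :=
  eichler c (stepVec k hk r).1 hc.bil_self (by rw [bil_comm, bil_stepVec hk hc])

theorem stepComm_apply {c : Fin (2 * n + 1) → F} (hc : LowSupport k c) (r : F)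
    (i j : Fin (2 * n + 1)) :
    mat (stepComm hk hc r) i j = (if i = j then 1 else 0)
      + c i * (if j.val + k = n then r else 0) - (if i.val = n + k then r else 0) * c j.rev
      - bil (stepVec k hk r).1 (stepVec k hk r).1 / 2 * (c i * c j.rev) := by
  rw [stepComm, mat_eichler, eichlerMat, Matrix.of_apply, stepVec_apply, stepVec_apply]
  have h : j.rev.val = n + k ↔ j.val + k = n := by
    rw [Fin.val_rev]
    omega
  simp only [h]

/-- The supports of c and of the step vector leave nothing on or below the diagonal except the
identity, and c 0 = 0 keeps row 0 trivial. -/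
theorem stepComm_mem {c : Fin (2 * n + 1) → F} (hc : LowSupport k c) (hc0 : c 0 = 0) (r : F) :
    stepComm hk hc r ∈ rowSubgroup n 0 F := by
  have key : ∀ i j : Fin (2 * n + 1), j ≤ i →
      mat (stepComm hk hc r) i j = if i = j then 1 else 0 := fun i j hij => by
    have hij' : j.val ≤ i.val := hij
    have h1 : c i * (if j.val + k = n then r else 0) = 0 := by
      split_ifs with h
      · rw [hc i (by omega), zero_mul]
      · rw [mul_zero]
    have h2 : (if i.val = n + k then r else 0) * c j.rev = 0 := by
      split_ifs with h
      · rw [hc j.rev (by rw [Fin.val_rev]; omega), mul_zero]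
      · rw [zero_mul]
    have h3 : c i * c j.rev = 0 := by
      rcases Nat.lt_or_ge (i.val + k) n with h | h
      · rw [hc j.rev (by rw [Fin.val_rev]; omega), mul_zero]
      · rw [hc i h, zero_mul]
    rw [stepComm_apply, h1, h2, h3]
    ring
  refine ⟨⟨fun i j hij => by rw [key i j hij.le, if_neg hij.ne'],
    fun i => by rw [key i i le_rfl, if_pos rfl]⟩, fun j hj _ => ?_⟩
  have h0 : ¬ ((0 : Fin (2 * n + 1)).val = n + k) := by rw [Fin.val_zero]; omega
  rw [stepComm_apply, if_neg hj.ne, hc0, if_neg h0]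
  ring

/-- In the rows read by `superForm`, the commutator meets the superdiagonal only at (n-1-k, n-k).
This is the pairing behind the exchange; the bound k + 1 < n says that row n-1-k is not row 0. -/
theorem superForm_stepComm (hk' : k + 1 < n) {c : Fin (2 * n + 1) → F} (hc : LowSupport k c)
    (r : F) : superForm (stepComm hk hc r) = c ⟨n - 1 - k, by omega⟩ * r := by
  unfold superForm
  -- Summand i of `superForm` belongs to row i + 1, so row n-1-k has index n-2-k.
  rw [Finset.sum_eq_single (⟨n - 2 - k, by omega⟩ : Fin (n - 1))]
  · rw [stepComm_apply, if_neg (Fin.mk_lt_mk.mpr (by omega)).ne, if_pos (by simp only; omega),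
      if_neg (by simp only; omega), hc (Fin.rev _) (by rw [Fin.val_rev]; simp only; omega)]
    have : (⟨n - 2 - k + 1, by omega⟩ : Fin (2 * n + 1)) = ⟨n - 1 - k, by omega⟩ :=
      Fin.ext (by simp only; omega)
    rw [this]
    ring
  · intro i _ hi
    have hi' : i.val ≠ n - 2 - k := fun h => hi (Fin.ext h)
    rw [stepComm_apply, if_neg (Fin.mk_lt_mk.mpr (by omega)).ne, if_neg (by simp only; omega),
      if_neg (by simp only; omega), hc (Fin.rev _) (by rw [Fin.val_rev]; simp only; omega)]
    ring
  · simp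

/-- The price u of the interchange stays in the smallest group `rowSubgroup n 0 F`, under which
every exchange form is equivariant. Its radical factor can be non-trivial only for k = 0, where the
step vector is anisotropic, and is invisible to the character. -/
theorem step_mul_radM (c : midSpace n F) (hc : LowSupport k c.1) (r : F) :
    ∃ u ∈ rowSubgroup n 0 F, superForm u = superForm (stepComm hk hc r) ∧
      step hk r * radM c = radM c * u * step hk r := by
  set b := stepVec k hk r with hb
  have h0 := stepComm_mem hk hc c.2.1 r
  have h1 : radP (-(bil b.1 b.1 / 2) • c) ∈ rowSubgroup n 0 F := radP_mem_rowSubgroup fun i hi => by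
    have : c.1 i = 0 := hc i (by omega)
    simp [this]
  refine ⟨stepComm hk hc r * radP (-(bil b.1 b.1 / 2) • c), mul_mem h0 h1, ?_, ?_⟩
  · rw [superForm_mul h0.1 h1.1, superForm_radP, add_zero]
  · rw [step, radP_mul_radM b c (bil_stepVec hk hc r) hc.bil_self, mul_assoc (radM c)]
    rfl

end RootVectors

/-! ### The torus of the first coordinate -/

section Torus

variable {n : ℕ} {F : Type*} [Field F]

/-- The diagonal entries of the torus of the first coordinate. -/
def torVal (n : ℕ) (t : F) (i : Fin (2 * n + 1)) : F :=
  if i = 0 then t else if i = Fin.last _ then t⁻¹ else 1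

theorem torVal_zero (t : F) : torVal n t 0 = t := if_pos rfl

theorem torVal_mid (t : F) {i : Fin (2 * n + 1)} (h0 : i ≠ 0) (h1 : i ≠ Fin.last _) :
    torVal n t i = 1 := by
  rw [torVal, if_neg h0, if_neg h1]

variable [NeZero n]

theorem torVal_last (t : F) : torVal n t (Fin.last _) = t⁻¹ := by
  rw [torVal, if_neg (last_ne_zero n), if_pos rfl]

theorem torVal_mul_rev {t : F} (ht : t ≠ 0) (i : Fin (2 * n + 1)) :
    torVal n t i * torVal n t i.rev = 1 := by
  by_cases h0 : i = 0
  · subst h0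
    rw [Fin.rev_zero, torVal_zero, torVal_last, mul_inv_cancel₀ ht]
  by_cases h1 : i = Fin.last _
  · subst h1
    rw [Fin.rev_last, torVal_zero, torVal_last, inv_mul_cancel₀ ht]
  rw [torVal_mid t h0 h1, torVal_mid t, one_mul]
  · rwa [← Fin.rev_last, Ne, Fin.rev_inj]
  · rwa [← Fin.rev_zero, Ne, Fin.rev_inj]

/-- The torus `diag(t, 1, …, 1, t⁻¹)`. -/
def tor (t : F) (ht : t ≠ 0) : SOodd n F :=
  mk (Matrix.diagonal (torVal n t))
    (fun x y => by
      unfold bil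
      refine Finset.sum_congr rfl fun i _ => ?_
      rw [Matrix.mulVec_diagonal, Matrix.mulVec_diagonal]
      linear_combination (x i * y i.rev) * torVal_mul_rev ht i)
    (by
      rw [Matrix.det_diagonal, Finset.prod_eq_mul (0 : Fin (2 * n + 1)) (Fin.last _)
        (last_ne_zero n).symm (fun i _ h => torVal_mid t h.1 h.2) (by simp) (by simp),
        torVal_zero, torVal_last, mul_inv_cancel₀ ht])

theorem mat_tor (t : F) (ht : t ≠ 0) : mat (tor t ht : SOodd n F) = Matrix.diagonal (torVal n t) :=
  rfl

theorem tor_mul_apply (t : F) (ht : t ≠ 0) (g : SOodd n F) (i j : Fin (2 * n + 1)) :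
    mat (tor t ht * g) i j = torVal n t i * mat g i j := by
  rw [mat_mul, mat_tor, Matrix.diagonal_mul]

theorem mul_tor_apply (t : F) (ht : t ≠ 0) (g : SOodd n F) (i j : Fin (2 * n + 1)) :
    mat (g * tor t ht) i j = mat g i j * torVal n t j := by
  rw [mat_mul, mat_tor, Matrix.mul_diagonal]

theorem tor_mul_radP [CharZero F] (t : F) (ht : t ≠ 0) (q : midSpace n F) :
    tor t ht * radP q = radP (t • q) * tor t ht := by
  refine mat_injective (Matrix.ext fun i j => ?_)
  have hq0 := q.2.1
  have hq1 := q.2.2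
  have hl := last_ne_zero n
  rw [tor_mul_apply, mul_tor_apply, radP_apply, radP_apply]
  simp only [Submodule.coe_smul, bil_smul_left, bil_smul_right, Pi.smul_apply, smul_eq_mul]
  by_cases hi : i = 0 <;> by_cases hj : j = 0 <;> by_cases hj' : j = Fin.last _ <;>
    by_cases hi' : i = Fin.last _ <;> by_cases hij : i = j <;>
    simp_all [torVal] <;> field_simp

theorem tor_mul_radM [CharZero F] (t : F) (ht : t ≠ 0) (q : midSpace n F) :
    tor t ht * radM q = radM (t⁻¹ • q) * tor t ht := by
  refine mat_injective (Matrix.ext fun i j => ?_)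
  have hq0 := q.2.1
  have hq1 := q.2.2
  have hl := last_ne_zero n
  rw [tor_mul_apply, mul_tor_apply, radM_apply, radM_apply]
  simp only [Submodule.coe_smul, bil_smul_left, bil_smul_right, Pi.smul_apply, smul_eq_mul]
  by_cases hi : i = 0 <;> by_cases hj : j = 0 <;> by_cases hj' : j = Fin.last _ <;>
    by_cases hi' : i = Fin.last _ <;> by_cases hij : i = j <;>
    simp_all [torVal] <;> field_simp

end Torus

/-! ### The Weyl element relating the Bessel subgroup to the line stabilizer -/

section Weyl

variable {n : ℕ} {F : Type*} [Field F]

/-- The permutation that moves the coordinate `n - 1` in front of the coordinates `0, …, n - 2`,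
and its mirror image. -/
def shift (n : ℕ) (a : Fin (2 * n + 1)) : Fin (2 * n + 1) :=
  ⟨if a.val + 1 < n then a.val + 1 else if a.val + 1 = n then 0 else if a.val = n then n else
    if a.val = n + 1 then 2 * n else a.val - 1, by have := a.2; split_ifs <;> omega⟩

theorem shift_val (a : Fin (2 * n + 1)) : (shift n a).val =
    if a.val + 1 < n then a.val + 1 else if a.val + 1 = n then 0 else if a.val = n then n else
    if a.val = n + 1 then 2 * n else a.val - 1 := rfl

theorem shift_injective : Function.Injective (shift n) := fun a b h => by
  have h := congrArg Fin.val h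
  rw [shift_val, shift_val] at h
  have := a.2
  have := b.2
  refine Fin.ext ?_
  split_ifs at h <;> omega

theorem shift_rev (a : Fin (2 * n + 1)) : shift n a.rev = (shift n a).rev := by
  have := a.2
  refine Fin.ext ?_
  rw [Fin.val_rev, shift_val, shift_val, Fin.val_rev]
  split_ifs <;> omega

/-- The permutation `shift` as an equivalence. -/
noncomputable def shiftEquiv (n : ℕ) : Fin (2 * n + 1) ≃ Fin (2 * n + 1) :=
  Equiv.ofBijective (shift n) (Finite.injective_iff_bijective.mp shift_injective)

theorem shiftEquiv_apply (a : Fin (2 * n + 1)) : shiftEquiv n a = shift n a := rfl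

/-- The permutation matrix of `shift`. -/
def shiftMat (n : ℕ) (F : Type*) [Field F] : Matrix (Fin (2 * n + 1)) (Fin (2 * n + 1)) F :=
  Matrix.of fun i j => if i = shift n j then 1 else 0

theorem shiftMat_mul_apply (A : Matrix (Fin (2 * n + 1)) (Fin (2 * n + 1)) F)
    (i j : Fin (2 * n + 1)) : (shiftMat n F * A) (shift n i) j = A i j := by
  simp [shiftMat, Matrix.mul_apply, shift_injective.eq_iff]

theorem mul_shiftMat_apply (A : Matrix (Fin (2 * n + 1)) (Fin (2 * n + 1)) F)
    (i j : Fin (2 * n + 1)) : (A * shiftMat n F) i j = A i (shift n j) := by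
  simp [shiftMat, Matrix.mul_apply]

theorem bil_shiftMat (x y : Fin (2 * n + 1) → F) :
    bil (shiftMat n F *ᵥ x) (shiftMat n F *ᵥ y) = bil x y := by
  have h : ∀ (x : Fin (2 * n + 1) → F) i, (shiftMat n F *ᵥ x) (shift n i) = x i := fun x i => by
    simp [shiftMat, Matrix.mulVec, dotProduct, shift_injective.eq_iff]
  unfold bil
  rw [← Equiv.sum_comp (shiftEquiv n)]
  refine Finset.sum_congr rfl fun i _ => ?_
  rw [shiftEquiv_apply, ← shift_rev, h, h]

/-- Up to a sign, the permutation matrix of `shift`. -/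
def weyl (n : ℕ) (F : Type*) [Field F] : SOodd n F :=
  mk ((shiftMat n F).det • shiftMat n F)
    (fun x y => by
      have h := det_sq_eq_one (preserves_of_bil (bil_shiftMat (n := n) (F := F)))
      rw [Matrix.smul_mulVec, Matrix.smul_mulVec, bil_smul_left, bil_smul_right,
        bil_shiftMat, ← mul_assoc, h, one_mul])
    (by
      have h := det_sq_eq_one (preserves_of_bil (bil_shiftMat (n := n) (F := F)))
      -- The size 2n+1 is odd, so scaling by the sign d = det gives determinant d^{2n+2} = 1.
      rw [Matrix.det_smul, Fintype.card_fin, ← pow_succ,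
        show 2 * n + 1 + 1 = 2 * (n + 1) by ring, pow_mul, sq, h, one_pow])

theorem weyl_conj_apply (g : SOodd n F) (a b : Fin (2 * n + 1)) :
    mat ((weyl n F)⁻¹ * g * weyl n F) a b = mat g (shift n a) (shift n b) := by
  obtain ⟨h, hh⟩ : ∃ h, h = (weyl n F)⁻¹ * g * weyl n F := ⟨_, rfl⟩
  rw [← hh]
  have h1 : weyl n F * h = g * weyl n F := by rw [hh]; group
  have h2 := congrFun (congrFun (congrArg mat h1) (shift n a)) b
  have hw : mat (weyl n F) = (shiftMat n F).det • shiftMat n F := rfl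
  rw [mat_mul, mat_mul, hw, Matrix.smul_mul, Matrix.mul_smul, Matrix.smul_apply, Matrix.smul_apply,
    shiftMat_mul_apply, mul_shiftMat_apply] at h2
  have hd := det_sq_eq_one (preserves_of_bil (bil_shiftMat (n := n) (F := F)))
  have hd0 : (shiftMat n F).det ≠ 0 := fun h => by rw [h, zero_mul] at hd; exact zero_ne_one hd
  exact mul_left_cancel₀ hd0 h2

end Weyl

end SOodd

/-! ## Topology -/

namespace SOodd

theorem sub_one_mul_sub_one {n : ℕ} {F : Type*} [Field F] {g h : SOodd n F} (i j : Fin (2 * n + 1)) :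
    mat (g * h) i j - (1 : Matrix _ _ F) i j
      = ∑ k, (mat g i k - (1 : Matrix _ _ F) i k) * (mat h k j - (1 : Matrix _ _ F) k j)
        + (mat g i j - (1 : Matrix _ _ F) i j) + (mat h i j - (1 : Matrix _ _ F) i j) := by
  have h1 : mat (g * h) - 1 = (mat g - 1) * (mat h - 1) + (mat g - 1) + (mat h - 1) := by
    rw [mat_mul]
    noncomm_ring
  have := congrFun (congrFun h1 i) j
  simpa [Matrix.mul_apply] using this

section Topology

variable {n : ℕ} {F : Type*} [Field F] [TopologicalSpace F]

theorem isInducing_mat : Topology.IsInducing (mat : SOodd n F → Matrix _ _ F) :=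
  (Topology.IsInducing.subtypeVal).comp Topology.IsInducing.subtypeVal

theorem continuous_mat : Continuous (mat : SOodd n F → Matrix _ _ F) := isInducing_mat.continuous

theorem continuous_entry (i j : Fin (2 * n + 1)) : Continuous fun g : SOodd n F => mat g i j :=
  continuous_mat.matrix_elem i j

theorem continuous_ite_zero {X : Type*} [TopologicalSpace X] {p : Prop} [Decidable p] {f : X → F}
    (hf : Continuous f) : Continuous fun x => if p then f x else 0 := by
  split_ifs
  exacts [hf, continuous_const]

theorem continuous_of_entries {X : Type*} [TopologicalSpace X] {f : X → SOodd n F}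
    (h : ∀ i j, Continuous fun x => mat (f x) i j) : Continuous f :=
  isInducing_mat.continuous_iff.mpr (continuous_matrix h)

theorem continuous_midSingle (i : Fin (2 * n + 1)) (h0 : i ≠ 0) (h1 : i ≠ Fin.last _) :
    Continuous (midSingle (F := F) i h0 h1) :=
  continuous_induced_rng.mpr (continuous_single (A := fun _ => F) i)

variable [IsTopologicalRing F]

theorem isClosedEmbedding_mat [T2Space F] :
    Topology.IsClosedEmbedding (mat : SOodd n F → Matrix _ _ F) :=
  Matrix.SpecialLinearGroup.isClosedEmbedding_val.comp
    (isClosed (n := n) (F := F)).isClosedEmbedding_subtypeVal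

variable [NeZero n] [CharZero F]

theorem continuous_radP : Continuous (radP : midSpace n F → SOodd n F) := by
  have hc : ∀ i, Continuous fun q : midSpace n F => q.1 i := fun i =>
    (continuous_apply i).comp continuous_subtype_val
  refine continuous_of_entries fun i j => ?_
  simp only [radP_apply, bil]
  have h1 := hc i
  have h2 := hc j.rev
  have h3 : Continuous fun q : midSpace n F => (∑ k, q.1 k * q.1 k.rev) / 2 := by
    simp only [div_eq_mul_inv]
    exact (continuous_finsetSum _ fun k _ => (hc k).mul (hc k.rev)).mul continuous_const
  exact ((continuous_const.add (continuous_ite_zero h2)).sub (continuous_ite_zero h1)).sub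
    (continuous_ite_zero (continuous_ite_zero h3))

theorem continuous_radM : Continuous (radM : midSpace n F → SOodd n F) := by
  have hc : ∀ i, Continuous fun q : midSpace n F => q.1 i := fun i =>
    (continuous_apply i).comp continuous_subtype_val
  refine continuous_of_entries fun i j => ?_
  simp only [radM_apply, bil]
  have h1 := hc i
  have h2 := hc j.rev
  have h3 : Continuous fun q : midSpace n F => (∑ k, q.1 k * q.1 k.rev) / 2 := by
    simp only [div_eq_mul_inv]
    exact (continuous_finsetSum _ fun k _ => (hc k).mul (hc k.rev)).mul continuous_const
  exact ((continuous_const.add (continuous_ite_zero h2)).sub (continuous_ite_zero h1)).sub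
    (continuous_ite_zero (continuous_ite_zero h3))

theorem continuous_step {k : ℕ} (hk : k < n) : Continuous (step hk : F → SOodd n F) :=
  continuous_radP.comp (continuous_midSingle _ _ _)

end Topology

section Balls

open LocalBall ValuativeRel

variable {F : Type*} [Field F] [ValuativeRel F] {t : F} [TopologicalSpace F]
  [IsNonarchimedeanLocalField F]

theorem exists_forall_sub_mem_ball (ht1 : valuation F t < 1) {x₀ : F} {U : Set F}
    (hU : U ∈ nhds x₀) : ∃ m : ℕ, ∀ x, x - x₀ ∈ ball t m → x ∈ U := by
  have hc : Filter.Tendsto (fun x => x + x₀) (nhds 0) (nhds x₀) := by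
    have := (continuous_add_const x₀).tendsto 0
    rwa [zero_add] at this
  obtain ⟨m, hm⟩ := exists_ball_subset ht1 (hc hU)
  refine ⟨m, fun x hx => ?_⟩
  have := hm hx
  rwa [Set.mem_preimage, sub_add_cancel] at this

theorem exists_forall_sub_mem_ball₁ (ht : t ≠ 0) (ht1 : valuation F t < 1) {ι : Type*} [Fintype ι]
    {x₀ : ι → F} {U : Set (ι → F)} (hU : U ∈ nhds x₀) :
    ∃ m : ℕ, ∀ x, (∀ i, x i - x₀ i ∈ ball t m) → x ∈ U := by
  rw [nhds_pi, Filter.mem_pi] at hU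
  obtain ⟨I, -, S, hS, hSU⟩ := hU
  choose f hf using fun i => exists_forall_sub_mem_ball ht1 (hS i)
  refine ⟨Finset.univ.sup f, fun x hx => hSU fun i _ => hf i _ ?_⟩
  exact ball_anti ht ht1 (by exact_mod_cast Finset.le_sup (Finset.mem_univ i)) (hx i)

theorem exists_forall_sub_mem_ball₂ (ht : t ≠ 0) (ht1 : valuation F t < 1) {ι κ : Type*}
    [Fintype ι] [Fintype κ] {x₀ : ι → κ → F} {U : Set (ι → κ → F)} (hU : U ∈ nhds x₀) :
    ∃ m : ℕ, ∀ x, (∀ i j, x i j - x₀ i j ∈ ball t m) → x ∈ U := by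
  rw [nhds_pi, Filter.mem_pi] at hU
  obtain ⟨I, -, S, hS, hSU⟩ := hU
  choose f hf using fun i => exists_forall_sub_mem_ball₁ ht ht1 (hS i)
  refine ⟨Finset.univ.sup f, fun x hx => hSU fun i _ => hf i _ fun j => ?_⟩
  exact ball_anti ht ht1 (by exact_mod_cast Finset.le_sup (Finset.mem_univ i)) (hx i j)

end Balls

/-! ### Principal congruence subgroups -/

section Congruence

open LocalBall ValuativeRel

variable {n : ℕ} {F : Type*} [Field F] [ValuativeRel F] {t : F}

/-- The principal congruence subgroup of level `t ^ m`. -/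
def congruence (n : ℕ) (t : F) (ht : t ≠ 0) (ht1 : valuation F t < 1) (m : ℕ) :
    Subgroup (SOodd n F) where
  carrier := {g | ∀ i j, mat g i j - (1 : Matrix _ _ F) i j ∈ ball t m}
  one_mem' := fun i j => by rw [mat_one, sub_self]; exact zero_mem _
  mul_mem' := fun {a b} ha hb i j => by
    rw [sub_one_mul_sub_one]
    refine add_mem (add_mem (sum_mem fun k _ => ?_) (ha i j)) (hb i j)
    exact ball_anti ht ht1 (by omega) (mul_mem ht (ha i k) (hb k j))
  inv_mem' := fun {a} ha i j => by
    have h : (1 : Matrix (Fin (2 * n + 1)) (Fin (2 * n + 1)) F) i j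
        = (1 : Matrix (Fin (2 * n + 1)) (Fin (2 * n + 1)) F) j.rev i.rev := by
      simp [Matrix.one_apply, Fin.rev_inj, eq_comm]
    rw [mat_inv_apply, h]
    exact ha _ _

variable (ht : t ≠ 0) (ht1 : valuation F t < 1)

theorem mem_congruence {m : ℕ} {g : SOodd n F} :
    g ∈ congruence n t ht ht1 m ↔ ∀ i j, mat g i j - (1 : Matrix _ _ F) i j ∈ ball t m := Iff.rfl

theorem congruence_anti {m k : ℕ} (h : m ≤ k) :
    congruence n t ht ht1 k ≤ congruence n t ht ht1 m := fun _ hg i j =>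
  ball_anti ht ht1 (by exact_mod_cast h) (hg i j)

variable [TopologicalSpace F] [IsNonarchimedeanLocalField F]

theorem isOpen_congruence (m : ℕ) :
    IsOpen (congruence n t ht ht1 m : Set (SOodd n F)) := by
  have : (congruence n t ht ht1 m : Set (SOodd n F)) =
      ⋂ i, ⋂ j, (fun g => mat g i j - (1 : Matrix _ _ F) i j) ⁻¹' (ball t m) := by
    ext g
    simp only [Set.mem_iInter, Set.mem_preimage, SetLike.mem_coe, mem_congruence]
  rw [this]
  exact isOpen_iInter_of_finite fun i => isOpen_iInter_of_finite fun j =>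
    (ball_isOpen ht m).preimage ((continuous_entry i j).sub continuous_const)

theorem isCompact_congruence (m : ℕ) :
    IsCompact (congruence n t ht ht1 m : Set (SOodd n F)) := by
  have hc : IsCompact (Set.pi Set.univ fun _ => Set.pi Set.univ fun _ => (ball t 0 : Set F) :
      Set (Fin (2 * n + 1) → Fin (2 * n + 1) → F)) :=
    isCompact_univ_pi fun i => isCompact_univ_pi fun j => ball_isCompact 0
  have hcl : IsClosed (congruence n t ht ht1 m : Set (SOodd n F)) :=
    Subgroup.isClosed_of_isOpen _ (isOpen_congruence ht ht1 m)
  refine (isClosedEmbedding_mat.isCompact_preimage hc).of_isClosed_subset hcl fun g hg => ?_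
  refine fun i _ j _ => ?_
  have h1 := ball_anti ht ht1 (Nat.cast_nonneg m) (hg i j)
  have h2 : (1 : Matrix (Fin (2 * n + 1)) (Fin (2 * n + 1)) F) i j ∈ ball t 0 := by
    rw [Matrix.one_apply]
    split_ifs
    · exact one_mem
    · exact zero_mem _
  have := add_mem h1 h2
  rwa [sub_add_cancel] at this

theorem exists_congruence_subset {U : Set (SOodd n F)} (hU : U ∈ nhds (1 : SOodd n F)) :
    ∃ m : ℕ, (congruence n t ht ht1 m : Set (SOodd n F)) ⊆ U := by
  rw [isInducing_mat.nhds_eq_comap] at hU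
  obtain ⟨W, hW, hWU⟩ := hU
  obtain ⟨m, hm⟩ := exists_forall_sub_mem_ball₂ ht ht1 hW
  exact ⟨m, fun g hg => hWU (hm _ hg)⟩

end Congruence

section Smooth

variable {G V : Type*} [Group G] [AddCommGroup V] [Module ℂ V]

/-- The vectors fixed by the image of an additive one-parameter group. -/
def addStabilizer {A : Type*} [AddGroup A] (σ : Representation ℂ G V) (x : A → G)
    (hx : ∀ a b, x (a + b) = x a * x b) (v : V) : AddSubgroup A where
  carrier := {a | σ (x a) v = v}
  zero_mem' := by
    have h : x 0 = 1 := by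
      have := hx 0 0
      rw [add_zero] at this
      exact mul_eq_left.mp this.symm
    rw [Set.mem_ofPred_eq, h, map_one, Module.End.one_apply]
  add_mem' := fun {a b} ha hb => by
    rw [Set.mem_ofPred_eq] at *
    rw [hx, map_mul, Module.End.mul_apply, hb, ha]
  neg_mem' := fun {a} ha => by
    rw [Set.mem_ofPred_eq] at *
    have h : x 0 = 1 := by
      have := hx 0 0
      rw [add_zero] at this
      exact mul_eq_left.mp this.symm
    nth_rw 1 [← ha]
    rw [← Module.End.mul_apply, ← map_mul, ← hx, neg_add_cancel, h, map_one, Module.End.one_apply]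

theorem mem_addStabilizer {A : Type*} [AddGroup A] {σ : Representation ℂ G V} {x : A → G}
    {hx : ∀ a b, x (a + b) = x a * x b} {v : V} {a : A} :
    a ∈ addStabilizer σ x hx v ↔ σ (x a) v = v := Iff.rfl

theorem isOpen_addStabilizer [TopologicalSpace G] {A : Type*} [AddGroup A] [TopologicalSpace A]
    {σ : Representation ℂ G V} (hσ : IsSmoothRep σ) {x : A → G}
    (hx : ∀ a b, x (a + b) = x a * x b) (hc : Continuous x) (v : V) :
    IsOpen (addStabilizer σ x hx v : Set A) := (hσ v).preimage hc

end Smooth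

end SOodd

/-! ## Models and equivariant linear forms -/

section Models

variable {G V : Type*} [Group G] [TopologicalSpace G] [IsTopologicalGroup G] [AddCommGroup V]
  [Module ℂ V] {σ : Representation ℂ G V} {H : Subgroup G} {χ : H →* Circle}

/-- Frobenius reciprocity: evaluate the functions of the model at the identity. The form is not zero
because right translation recovers all other values. -/
theorem HasModel.exists_form (h : HasModel σ H χ) :
    ∃ l : Module.Dual ℂ V, l ≠ 0 ∧ ∀ (b : H) (v : V), l (σ b v) = (χ b : ℂ) * l v := by
  obtain ⟨Φ, hΦ⟩ := h
  have hval : ∀ (g x : G) (v : V), (Φ (σ g v)).1 x = (Φ v).1 (x * g) := fun g x v => by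
    have := Φ.isIntertwining' g
    have h1 := LinearMap.congr_fun this v
    exact congrFun (congrArg Subtype.val h1) x
  let l : Module.Dual ℂ V :=
    { toFun := fun v => (Φ v).1 1
      map_add' := fun v w => by rw [map_add]; rfl
      map_smul' := fun c v => by rw [map_smul]; rfl }
  have hl : ∀ v, l v = (Φ v).1 1 := fun v => rfl
  refine ⟨l, fun h0 => hΦ ?_, fun b v => ?_⟩
  · ext v x
    have := LinearMap.congr_fun h0 (σ x v)
    rw [hl, hval, one_mul] at this
    exact this
  · rw [hl, hl, hval, one_mul, ← (Φ v).2.1 b 1, mul_one]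

/-- The converse direction sends v to g ↦ l(σ(g)v); the open stabilizer of v supplies the right
invariance. -/
theorem hasModel_of_form (hσ : IsSmoothRep σ) {l : Module.Dual ℂ V} (hl : l ≠ 0)
    (h : ∀ (b : H) (v : V), l (σ b v) = (χ b : ℂ) * l v) : HasModel σ H χ := by
  let Φ : V →ₗ[ℂ] smoothIndSpace H χ :=
    { toFun := fun v => ⟨fun g => l (σ g v), fun b g => by
          beta_reduce
          rw [map_mul, Module.End.mul_apply, h],
        ⟨⟨{ carrier := {g | σ g v = v}
            one_mem' := by rw [Set.mem_ofPred_eq, map_one, Module.End.one_apply]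
            mul_mem' := fun {a b} ha hb => by
              rw [Set.mem_ofPred_eq] at *
              rw [map_mul, Module.End.mul_apply, hb, ha]
            inv_mem' := fun {a} ha => by
              rw [Set.mem_ofPred_eq] at *
              nth_rw 1 [← ha]
              rw [← Module.End.mul_apply, ← map_mul, inv_mul_cancel, map_one,
                Module.End.one_apply] }, hσ v⟩, fun k hk g => by
          have hk' : σ k v = v := hk
          beta_reduce
          rw [map_mul, Module.End.mul_apply, hk']⟩⟩
      map_add' := fun v w => by
        refine Subtype.ext (funext fun g => ?_)
        change l (σ g (v + w)) = l (σ g v) + l (σ g w)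
        rw [map_add, map_add]
      map_smul' := fun c v => by
        refine Subtype.ext (funext fun g => ?_)
        change l (σ g (c • v)) = c • l (σ g v)
        rw [map_smul, map_smul] }
  refine ⟨{ Φ with isIntertwining' := fun g => ?_ }, fun h0 => hl ?_⟩
  · refine LinearMap.ext fun v => Subtype.ext (funext fun x => ?_)
    change l (σ x (σ g v)) = l (σ (x * g) v)
    rw [map_mul, Module.End.mul_apply]
  · refine LinearMap.ext fun v => ?_
    have h1 := congrArg (fun Ψ : Representation.IntertwiningMap σ (smoothInd H χ) => (Ψ v).1 1) h0
    change l (σ 1 v) = 0 at h1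
    rwa [map_one] at h1

end Models

namespace SOodd

open LocalBall ValuativeRel

/-! ### Transport of the Bessel subgroup and its character -/

section WeylConj

variable {n : ℕ} {F : Type*} [Field F]

/-- In the rows `n, …, 2n - 1`, the last column of an element of `rowSubgroup n 0 F` vanishes. -/
theorem last_column_eq_zero {g : SOodd n F} (hg : g ∈ rowSubgroup n 0 F) {i : Fin (2 * n + 1)}
    (h1 : n ≤ i.val) (h2 : i.val < 2 * n) : mat g i (Fin.last _) = 0 := by
  have h := (inv_mem hg).2 i.rev (Fin.lt_def.mpr (by rw [Fin.val_zero, Fin.val_rev]; omega))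
    (by rw [Fin.val_rev]; omega)
  rwa [mat_inv_apply, Fin.rev_rev, Fin.rev_zero] at h

theorem weyl_conj_mem_bessel {g : SOodd n F} (h1 : ∀ i j, j < i → mat g (shift n i) (shift n j) = 0)
    (h2 : ∀ i, i.val + 1 ≠ n → i.val ≠ n + 1 → mat g (shift n i) (shift n i) = 1)
    (h3 : ∀ i j, i < j → n ≤ i.val + 1 → j.val ≤ n + 1 → mat g (shift n i) (shift n j) = 0) :
    (weyl n F)⁻¹ * g * weyl n F ∈ bessel n F :=
  ⟨fun i j h => by rw [weyl_conj_apply, h1 i j h], fun i h h' => by rw [weyl_conj_apply, h2 i h h'],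
    fun i j h h' h'' => by rw [weyl_conj_apply, h3 i j h h' h'']⟩

variable [NeZero n]

/-- The permutation raises the indices 0, …, n-2 by one and fixes n. The entries (i, i+1) thus
become the superdiagonal in rows 1, …, n-2, and the entry (n-2, n) becomes (n-1, n). -/
theorem besselForm_weyl_conj (g : SOodd n F) :
    besselForm ((weyl n F)⁻¹ * g * weyl n F) = superForm g := by
  unfold besselForm superForm
  have hs : ∀ (i j i' j' : ℕ) (hi : i < 2 * n + 1) (hj : j < 2 * n + 1) (hi' : i' < 2 * n + 1)
      (hj' : j' < 2 * n + 1), (shift n ⟨i, hi⟩).val = i' → (shift n ⟨j, hj⟩).val = j' →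
      mat ((weyl n F)⁻¹ * g * weyl n F) ⟨i, hi⟩ ⟨j, hj⟩ = mat g ⟨i', hi'⟩ ⟨j', hj'⟩ := by
    intro i j i' j' hi hj hi' hj' h h'
    rw [weyl_conj_apply]
    congr 1 <;> exact Fin.ext ‹_›
  by_cases h : 2 ≤ n
  · rw [dif_pos h]
    obtain ⟨m, rfl⟩ : ∃ m, n = m + 2 := ⟨n - 2, by omega⟩
    change _ = ∑ i : Fin (m + 1), mat g ⟨i.val + 1, by omega⟩ ⟨i.val + 2, by omega⟩
    rw [Fin.sum_univ_castSucc]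
    congr 1
    · refine Finset.sum_congr rfl fun i _ => hs _ _ _ _ _ _ _ _ ?_ ?_
      · have := i.2
        rw [shift_val, if_pos (by simp only; omega)]; rfl
      · have := i.2
        rw [shift_val, if_pos (by simp only; omega)]; rfl
    · refine hs _ _ _ _ _ _ _ _ ?_ ?_
      · rw [shift_val, if_pos (by simp only; omega)]
        simp
      · rw [shift_val, if_neg (by simp only; omega), if_neg (by simp only; omega),
          if_pos (by simp only)]
        simp
  · have h1 : n = 1 := by have := NeZero.ne n; omega
    subst h1
    simp

theorem superForm_tor (t : F) (ht : t ≠ 0) : superForm (tor t ht : SOodd n F) = 0 := by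
  refine Finset.sum_eq_zero fun i _ => ?_
  rw [mat_tor, Matrix.diagonal_apply_ne _ (Fin.mk_lt_mk.mpr (by omega)).ne]

/-- The positions n-1 and n+1 go to 0 and 2n, so this torus is the one in the middle block diag(t,
1, t⁻¹) of the Bessel subgroup. -/
theorem weyl_conj_tor_mem (t : F) (ht : t ≠ 0) :
    (weyl n F)⁻¹ * tor t ht * weyl n F ∈ bessel n F := by
  have hn := NeZero.ne n
  refine weyl_conj_mem_bessel (fun i j hij => ?_) (fun i h1 h2 => ?_) (fun i j hij hi hj => ?_)
  · rw [mat_tor, Matrix.diagonal_apply_ne _ (shift_injective.ne hij.ne')]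
  · rw [mat_tor, Matrix.diagonal_apply_eq, torVal_mid]
    · intro h
      have := congrArg Fin.val h
      rw [Fin.val_zero, shift_val] at this
      split_ifs at this <;> omega
    · intro h
      have := congrArg Fin.val h
      have hi := i.2
      rw [Fin.val_last, shift_val] at this
      split_ifs at this <;> omega
  · rw [mat_tor, Matrix.diagonal_apply_ne _ (shift_injective.ne hij.ne)]

end WeylConj

/-! ### The forms that are carried through the exchange -/

section State

variable {n : ℕ} {F : Type*} [Field F] [NeZero n] [CharZero F] 
  {V : Type*} [AddCommGroup V] [Module ℂ V]

/-- Linear forms that occur between the Bessel functional (`k = 0`) and a degenerate Whittaker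
functional (`k = n - 1`). -/
structure IsExchangeForm (ψ : AddChar F Circle) (σ : Representation ℂ (SOodd n F) V) (t : F)
    (ht : t ≠ 0) (κ : ℂ) (k : ℕ) (l : Module.Dual ℂ V) : Prop where
  unip : ∀ u ∈ rowSubgroup n k F, ∀ v, l (σ u v) = (ψ (superForm u) : ℂ) * l v
  opp : ∀ c : midSpace n F, LowSupport k c.1 → ∀ v, l (σ (radM c) v) = l v
  tor : ∀ v, l (σ (tor t ht) v) = κ ^ k * l v

/-- The first row is isotropic. For k other than 0 and 2n, one of k and its mirror image lies in 1,
…, n, so the relation reduces to twice the corner entry being 0. -/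
theorem corner_eq_zero {g : SOodd n F} (hg : g ∈ rowSubgroup n 0 F) :
    mat g 0 (Fin.last _) = 0 := by
  have h1 : mat (g * g⁻¹) 0 (Fin.last _) = 0 := by
    rw [mul_inv_cancel, mat_one, Matrix.one_apply_ne (last_ne_zero n).symm]
  have hz : ∀ k : Fin (2 * n + 1), k ≠ 0 → k.val ≤ n → mat g 0 k = 0 := fun k hk hk' =>
    hg.2 k (Fin.pos_of_ne_zero hk) hk'
  rw [mat_mul_apply, Finset.sum_eq_add (0 : Fin (2 * n + 1)) (Fin.last _) (last_ne_zero n).symm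
    (fun k _ hk => ?_) (by simp) (by simp), hg.1.2, one_mul, mat_inv_apply, mat_inv_apply,
    Fin.rev_last, Fin.rev_zero, hg.1.2, mul_one, ← two_mul] at h1
  · exact (mul_eq_zero.mp h1).resolve_left two_ne_zero
  · rw [mat_inv_apply, Fin.rev_last]
    have h3 : k.val ≠ 2 * n := fun h => hk.2 (Fin.ext h)
    have := k.2
    rcases Nat.lt_or_ge n k.val with h | h
    · rw [hz k.rev (fun h' => by
        have := congrArg Fin.val h'
        rw [Fin.val_rev, Fin.val_zero] at this
        omega) (by rw [Fin.val_rev]; omega), mul_zero]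
    · rw [hz k hk.1 h, zero_mul]

/-- The entries that conjugation would move below the diagonal or into the off-diagonal part of the
middle block lie in row 0 up to column n, in the last column from row n on, or in the corner, and
all of these vanish. -/
theorem weyl_conj_rowSubgroup_mem {g : SOodd n F} (hg : g ∈ rowSubgroup n 0 F) :
    (weyl n F)⁻¹ * g * weyl n F ∈ bessel n F := by
  have hn := NeZero.ne n
  have hzero : ∀ i j : Fin (2 * n + 1), i.val = 0 → 0 < j.val → j.val ≤ n → mat g i j = 0 :=
    fun i j hi h1 h2 => by
      rw [show i = 0 from Fin.ext (by rw [Fin.val_zero]; exact hi)]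
      exact hg.2 j (Fin.lt_def.mpr (by rw [Fin.val_zero]; exact h1)) h2
  have hlast : ∀ i j : Fin (2 * n + 1), j.val = 2 * n → n ≤ i.val → i.val < 2 * n → mat g i j = 0 :=
    fun i j hj h1 h2 => by
      rw [show j = Fin.last _ from Fin.ext (by rw [Fin.val_last]; exact hj)]
      exact last_column_eq_zero hg h1 h2
  have hcorner : ∀ i j : Fin (2 * n + 1), i.val = 0 → j.val = 2 * n → mat g i j = 0 :=
    fun i j hi hj => by
      rw [show j = Fin.last _ from Fin.ext (by rw [Fin.val_last]; exact hj),
        show i = 0 from Fin.ext (by rw [Fin.val_zero]; exact hi)]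
      exact corner_eq_zero hg
  refine weyl_conj_mem_bessel (fun i j hij => ?_) (fun i _ _ => hg.1.2 _)
    (fun i j hij hi hj => ?_)
  · have hij' : j.val < i.val := hij
    have hi2 := i.2
    rcases lt_or_ge (shift n j) (shift n i) with h | h
    · exact hg.1.1 _ _ h
    have h' : (shift n i).val ≤ (shift n j).val := h
    by_cases hi : i.val + 1 = n
    · refine hzero _ _ ?_ ?_ ?_ <;> (simp only [shift_val]; split_ifs <;> omega)
    · have hj : j.val = n + 1 := by
        rw [shift_val, shift_val] at h'
        split_ifs at h' <;> omega
      refine hlast _ _ ?_ ?_ ?_ <;> (simp only [shift_val]; split_ifs <;> omega)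
  · have hij' : i.val < j.val := hij
    by_cases h1 : i.val + 1 = n
    · by_cases h2 : j.val = n
      · refine hzero _ _ ?_ ?_ ?_ <;> (simp only [shift_val]; split_ifs <;> omega)
      · refine hcorner _ _ ?_ ?_ <;> (simp only [shift_val]; split_ifs <;> omega)
    · refine hlast _ _ ?_ ?_ ?_ <;> (simp only [shift_val]; split_ifs <;> omega)

theorem radM_apply_ne {c : midSpace n F} (hc : LowSupport 0 c.1) {i j : Fin (2 * n + 1)}
    (hij : i ≠ j) (h : mat (radM c) i j ≠ 0) :
    (i.val = 2 * n ∧ n < j.val ∧ j.val < 2 * n) ∨ (j.val = 0 ∧ 0 < i.val ∧ i.val < n) := by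
  have hc0 := c.2.1
  have hcc := hc.bil_self
  rw [radM_apply, if_neg hij, hcc, zero_div] at h
  by_contra hcon
  push Not at hcon
  refine h ?_
  have h1 : (if i = Fin.last _ then c.1 j.rev else 0) = 0 := by
    split_ifs with hi
    · have hi' : i.val = 2 * n := by rw [hi, Fin.val_last]
      rcases Nat.lt_or_ge n j.val with hj | hj
      · have := hcon.1 hi' hj
        have hj2 : j = Fin.last _ := Fin.ext (by rw [Fin.val_last]; omega)
        rw [hj2, Fin.rev_last, hc0]
      · exact hc _ (by rw [Fin.val_rev]; omega)
    · rfl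
  have h2 : (if j = 0 then c.1 i else 0) = 0 := by
    split_ifs with hj
    · have hj' : j.val = 0 := by rw [hj, Fin.val_zero]
      rcases Nat.eq_zero_or_pos i.val with hi | hi
      · rw [show i = 0 from Fin.ext (by rw [Fin.val_zero]; exact hi), hc0]
      · exact hc _ (hcon.2 hj' hi)
    · rfl
  rw [h1, h2]
  simp

theorem radM_apply_self (c : midSpace n F) (i : Fin (2 * n + 1)) : mat (radM c) i i = 1 := by
  have hc0 := c.2.1
  have hc1 := c.2.2
  have hl := last_ne_zero n
  rw [radM_apply]
  by_cases h0 : i = 0 <;> by_cases h1 : i = Fin.last _ <;> simp_all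

/-- Conjugation moves index 0 behind 1, …, n-1, and by symmetry 2n in front of n+1, …, 2n-1. The
only off-diagonal entries, in column 0 and in row 2n, thereby become upper triangular and stay
outside the middle block. -/
theorem weyl_conj_radM_mem {c : midSpace n F} (hc : LowSupport 0 c.1) :
    (weyl n F)⁻¹ * radM c * weyl n F ∈ bessel n F := by
  have hn := NeZero.ne n
  refine weyl_conj_mem_bessel (fun i j hij => ?_) (fun i _ _ => radM_apply_self c _)
    (fun i j hij hi hj => ?_)
  all_goals
    by_contra h
    have hij' := Fin.lt_def.mp hij
    have hi2 := i.2
    have hj2 := j.2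
    rcases radM_apply_ne hc (shift_injective.ne (by first | exact hij.ne | exact hij.ne')) h with
      h1 | h1
    all_goals
      simp only [shift_val] at h1
      split_ifs at h1 <;> first | omega | exact h1.1.elim

theorem superForm_radM {c : midSpace n F} (hc : LowSupport 0 c.1) : superForm (radM c) = 0 := by
  refine Finset.sum_eq_zero fun i _ => ?_
  by_contra h
  have hi := i.2
  rcases radM_apply_ne hc (Fin.mk_lt_mk.mpr (by omega)).ne h with h1 | h1 <;>
    simp only at h1 <;> omega

variable [TopologicalSpace F] [IsTopologicalRing F]

/-- The form is the Bessel functional translated by `weyl`. The eigenvalue `κ` is free because only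
`κ ^ 0` occurs at the start. -/
theorem HasBesselModel.exists_exchangeForm {ψ : AddChar F Circle}
    {σ : Representation ℂ (SOodd n F) V} (h : HasBesselModel ψ σ) (t : F) (ht : t ≠ 0) (κ : ℂ) :
    ∃ l : Module.Dual ℂ V, l ≠ 0 ∧ IsExchangeForm ψ σ t ht κ 0 l := by
  obtain ⟨β, hβ, hb⟩ := HasModel.exists_form h
  have key : ∀ g : SOodd n F, (weyl n F)⁻¹ * g * weyl n F ∈ bessel n F → ∀ v,
      β (σ (weyl n F)⁻¹ (σ g v)) = (ψ (superForm g) : ℂ) * β (σ (weyl n F)⁻¹ v) := fun g hg v => by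
    have := hb ⟨_, hg⟩ (σ (weyl n F)⁻¹ v)
    rw [← Module.End.mul_apply, ← map_mul] at this ⊢
    rw [mul_assoc, mul_inv_cancel, mul_one] at this
    rw [this, ← besselForm_weyl_conj]
    rfl
  refine ⟨β.comp (σ (weyl n F)⁻¹), fun h0 => hβ ?_, ?_, ?_, ?_⟩
  · refine LinearMap.ext fun v => ?_
    have := LinearMap.congr_fun h0 (σ (weyl n F) v)
    rwa [LinearMap.comp_apply, ← Module.End.mul_apply, ← map_mul, inv_mul_cancel, map_one] at this
  · exact fun u hu v => key u (weyl_conj_rowSubgroup_mem hu) v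
  · intro c hc v
    have := key _ (weyl_conj_radM_mem hc) v
    rwa [superForm_radM hc, AddChar.map_zero_eq_one, Circle.coe_one, one_mul] at this
  · intro v
    have := key _ (weyl_conj_tor_mem t ht) v
    rwa [superForm_tor, AddChar.map_zero_eq_one, Circle.coe_one] at this

end State

end SOodd

/-! ## Exchange of roots -/

namespace LocalBall

open ValuativeRel

variable {F : Type*} [Field F] [ValuativeRel F] [TopologicalSpace F] [IsNonarchimedeanLocalField F]
  {t : F} [MeasurableSpace F] [BorelSpace F]

/-- A locally constant function of compact support that does not vanish at the origin has a
non-zero Fourier coefficient. -/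
theorem exists_fourier_ne_zero (ht : t ≠ 0) (ht1 : valuation F t < 1) (μ : Measure F)
    [μ.IsAddHaarMeasure] {ψ : AddChar F Circle} (hψ : Continuous ψ) (hψ1 : ψ ≠ 1) {f : F → ℂ}
    (hf : Continuous f) {k a M : ℤ} (hk : ∀ r, r ∉ ball t k → f r = 0)
    (ha : ∀ r ∈ ball t a, f r = f 0) (hf0 : f 0 ≠ 0)
    (hM : ∀ s ∈ ball t M, ∀ r ∈ ball t a, ψ (r * s) = 1) :
    ∃ s, ∫ r, (ψ (r * s) : ℂ) * f r ∂μ ≠ 0 := by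
  by_contra! hcon
  obtain ⟨j, hj⟩ := exists_annihilator_subset ht ht1 hψ1
  -- With this m the annihilator D of `ball t m` is contained in `ball t a`, where f equals f 0.
  set m : ℤ := j - a with hm
  let B : Set F := ball t m
  have hBo : IsClopen B := ⟨ball_isClosed ht m, ball_isOpen ht m⟩
  let χ : F → ℂ := B.indicator 1
  have hχ : Continuous χ := by
    have := (LocallyConstant.charFn ℂ hBo).continuous
    rwa [LocallyConstant.coe_charFn] at this
  have hχ1 : ∀ s ∈ B, χ s = 1 := fun s hs => by simp [χ, hs]
  have hχ0 : ∀ s ∉ B, χ s = 0 := fun s hs => by simp [χ, hs]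
  -- Integrate the Fourier transform, assumed to vanish, over `ball t m`. In the other order the
  -- integral is μ(B) f(0) μ(D), by orthogonality of characters on the ball.
  have hswap : ∫ s, (∫ r, χ s * ((ψ (r * s) : ℂ) * f r) ∂μ) ∂μ
      = ∫ r, (∫ s, χ s * ((ψ (r * s) : ℂ) * f r) ∂μ) ∂μ := by
    refine integral_integral_swap_of_hasCompactSupport ?_ ?_
    · have h1 : Continuous fun p : F × F => (ψ (p.2 * p.1) : ℂ) :=
        continuous_induced_dom.comp (hψ.comp (continuous_snd.mul continuous_fst))
      exact (hχ.comp continuous_fst).mul (h1.mul (hf.comp continuous_snd))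
    · refine HasCompactSupport.intro ((ball_isCompact (t := t) m).prod (ball_isCompact (t := t) k))
        fun p hp => ?_
      change χ p.1 * ((ψ (p.2 * p.1) : ℂ) * f p.2) = 0
      by_cases h1 : p.1 ∈ B
      · rw [hk p.2 fun h2 => hp ⟨h1, h2⟩, mul_zero, mul_zero]
      · rw [hχ0 _ h1, zero_mul]
  have hleft : ∫ s, (∫ r, χ s * ((ψ (r * s) : ℂ) * f r) ∂μ) ∂μ = 0 := by
    simp only [integral_const_mul, hcon, mul_zero, integral_zero]
  let D : Set F := {r | ∀ s ∈ ball t m, ψ (r * s) = 1}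
  have hDa : ∀ r ∈ D, r ∈ ball t a := fun r hr => by
    have := hj m r hr
    rwa [hm, sub_sub_cancel] at this
  have hright : ∀ r, ∫ s, χ s * ((ψ (r * s) : ℂ) * f r) ∂μ
      = D.indicator (fun _ => (μ.real B : ℂ) * f 0) r := fun r => by
    have h1 : ∀ s, χ s * ((ψ (r * s) : ℂ) * f r) =
        B.indicator (fun s => (ψ (r * s) : ℂ)) s * f r := fun s => by
      by_cases hs : s ∈ B
      · rw [hχ1 s hs, Set.indicator_of_mem hs, one_mul]
      · rw [hχ0 s hs, Set.indicator_of_notMem hs, zero_mul, zero_mul]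
    simp only [h1, integral_mul_const]
    by_cases hr : r ∈ D
    · rw [Set.indicator_of_mem hr, ha r (hDa r hr)]
      congr 1
      have h2 : B.indicator (fun s => (ψ (r * s) : ℂ)) = B.indicator fun _ => (1 : ℂ) :=
        Set.indicator_congr fun s hs => by rw [hr s hs, Circle.coe_one]
      rw [h2, integral_indicator_const _ hBo.isOpen.measurableSet]
      simp
    · rw [Set.indicator_of_notMem hr]
      have hr' : ∃ s ∈ ball t m, ψ (r * s) ≠ 1 := by
        by_contra! h
        exact hr h
      rw [integral_char_ball μ ψ m r hr', zero_mul]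
  have hD : IsClosed D := by
    have : D = ⋂ s ∈ (ball t m : Set F), {r | ψ (r * s) = 1} := by
      ext r
      simp [D]
    rw [this]
    exact isClosed_biInter fun s _ =>
      isClosed_eq (hψ.comp (continuous_mul_const s)) continuous_const
  -- The hypothesis `hM` makes ψ trivial on `ball t (M + a)`, so D contains a ball and has positive
  -- measure.
  have hsub : (ball t (M + a - m) : Set F) ⊆ D := fun r hr s hs => by
    have h1 : r * s ∈ ball t (M + a) := by
      have := mul_mem ht hr hs
      rwa [sub_add_cancel] at this
    have h2 : r * s = t ^ a * (t ^ (-a) * (r * s)) := by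
      rw [← mul_assoc, ← zpow_add₀ ht, add_neg_cancel, zpow_zero, one_mul]
    have h3 : t ^ (-a) * (r * s) ∈ ball t M := by
      have := (zpow_mul_mem ht (m := M + a) (k := -a)).mpr h1
      rwa [add_neg_cancel_right] at this
    rw [h2]
    refine hM _ h3 _ ?_
    have := (zpow_mul_mem ht (m := 0) (k := a)).mpr (one_mem (t := t))
    rwa [mul_one, zero_add] at this
  have hpos : ∀ m : ℤ, 0 < μ (ball t m) := fun m =>
    (ball_isOpen ht m).measure_pos μ ⟨0, zero_mem _⟩
  have hfin : ∀ m : ℤ, μ (ball t m) < ⊤ := fun m => (ball_isCompact m).measure_lt_top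
  have hDr : μ.real D ≠ 0 := by
    refine (ENNReal.toReal_pos ?_ ?_).ne'
    · exact ((hpos _).trans_le (measure_mono hsub)).ne'
    · exact ((measure_mono hDa).trans_lt (hfin a)).ne
  have hBr : μ.real B ≠ 0 := (ENNReal.toReal_pos (hpos m).ne' (hfin m).ne).ne'
  rw [hleft] at hswap
  simp only [hright] at hswap
  rw [integral_indicator_const _ hD.measurableSet, Complex.real_smul] at hswap
  refine mul_ne_zero ?_ (mul_ne_zero ?_ hf0) hswap.symm
  · exact_mod_cast hDr
  · exact_mod_cast hBr

end LocalBall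

namespace SOodd

open LocalBall ValuativeRel

section LowVec

variable {n : ℕ} {F : Type*} [Field F] {k : ℕ}

/-- The vectors in the coordinate `n - 1 - k`. -/
def lowVec (hk : k + 1 < n) : F →ₗ[F] midSpace n F :=
  midSingle ⟨n - 1 - k, by omega⟩
    (fun h => by
      have h := congrArg Fin.val h
      rw [Fin.val_zero] at h
      simp only at h
      omega)
    (fun h => by
      have h := congrArg Fin.val h
      rw [Fin.val_last] at h
      simp only at h
      omega)

theorem lowVec_lowSupport (hk : k + 1 < n) (s : F) : LowSupport k (lowVec hk s).1 := fun i hi => by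
  rw [lowVec, midSingle_coe, Pi.single_eq_of_ne]
  intro h
  rw [h] at hi
  simp only at hi
  omega

end LowVec

section Exchange

variable {n : ℕ} {F : Type*} [Field F] [NeZero n] [CharZero F] {V : Type*} [AddCommGroup V]
  [Module ℂ V] {ψ : AddChar F Circle} {σ : Representation ℂ (SOodd n F) V} {t : F} {ht : t ≠ 0}
  {κ : ℂ} {k : ℕ} {l : Module.Dual ℂ V}

/-- Along the root group, `radM c` acts on the function r ↦ l(σ(step r)v) as multiplication by an
additive character, which is what makes Fourier analysis available. -/
theorem IsExchangeForm.step_mul_radM (h : IsExchangeForm ψ σ t ht κ k l) (hk : k + 1 < n)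
    {c : midSpace n F} (hc : LowSupport k c.1) (r : F) (v : V) :
    l (σ (step (Nat.lt_of_succ_lt hk) r) (σ (radM c) v)) =
      (ψ (r * c.1 ⟨n - 1 - k, by omega⟩) : ℂ) * l (σ (step (Nat.lt_of_succ_lt hk) r) v) := by
  obtain ⟨u, hu, hu1, hu2⟩ := SOodd.step_mul_radM (Nat.lt_of_succ_lt hk) c hc r
  rw [← Module.End.mul_apply, ← map_mul, hu2, mul_assoc, map_mul, Module.End.mul_apply,
    h.opp c hc, map_mul, Module.End.mul_apply, h.unip u (rowSubgroup_mono (Nat.zero_le k) hu), hu1,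
    superForm_stepComm _ hk, mul_comm r]

/-- An element of the larger group only translates r, up to the character: the remaining factor lies
in `rowSubgroup n k F`. Integration over r thus gives the new equivariance. -/
theorem IsExchangeForm.step_mul_unip (h : IsExchangeForm ψ σ t ht κ k l) (hk : k < n)
    {u : SOodd n F} (hu : u ∈ rowSubgroup n (k + 1) F) (r : F) (v : V) :
    l (σ (step hk r) (σ u v)) =
      (ψ (superForm u) : ℂ) * l (σ (step hk (r + rowEntry k u)) v) := by
  have h1 := step_mem hk r
  have h2 := step_mem hk (r + rowEntry k u)
  have h3 : step hk r * u * (step hk (r + rowEntry k u))⁻¹ ∈ rowSubgroup n k F := by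
    refine mul_inv_mem_rowSubgroup hk (mul_mem h1 hu) h2 ?_
    rw [rowEntry_mul hk h1 hu.1, rowEntry_step, rowEntry_step]
  have h4 : superForm (step hk r * u * (step hk (r + rowEntry k u))⁻¹) = superForm u := by
    rw [superForm_mul (mul_mem h1 hu).1 (inv_mem h2).1, superForm_mul h1.1 hu.1,
      superForm_inv h2.1, superForm_step, superForm_step]
    ring
  have h5 := h.unip _ h3 (σ (step hk (r + rowEntry k u)) v)
  rwa [h4, ← Module.End.mul_apply, ← map_mul, inv_mul_cancel_right, map_mul,
    Module.End.mul_apply] at h5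

theorem IsExchangeForm.step_mul_tor (h : IsExchangeForm ψ σ t ht κ k l) (hk : k < n) (r : F)
    (v : V) : l (σ (step hk r) (σ (SOodd.tor t ht) v)) = κ ^ k * l (σ (step hk (t⁻¹ * r)) v) := by
  have h1 : step hk r * SOodd.tor t ht = SOodd.tor t ht * step hk (t⁻¹ * r) := by
    rw [step, step, tor_mul_radP, ← map_smul, smul_eq_mul, mul_inv_cancel_left₀ ht]
  rw [← Module.End.mul_apply, ← map_mul, h1, map_mul, Module.End.mul_apply, h.tor]

variable [ValuativeRel F] [TopologicalSpace F] [IsNonarchimedeanLocalField F]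

theorem continuous_step_apply (hσ : IsSmoothRep σ) (l : Module.Dual ℂ V) (hk : k < n) (v : V) :
    Continuous fun r => l (σ (step hk r) v) := by
  refine IsLocallyConstant.continuous ((IsLocallyConstant.iff_eventually_eq _).mpr fun r => ?_)
  have ho := isOpen_addStabilizer hσ (step_add hk) (continuous_step hk) v
  have h1 : ∀ᶠ s in nhds r, s - r ∈ (addStabilizer σ (step hk) (step_add hk) v : Set F) := by
    refine (continuous_sub_right r).continuousAt.eventually_mem ?_
    rw [sub_self]
    exact ho.mem_nhds (zero_mem _)
  filter_upwards [h1] with s hs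
  have hs' : σ (step hk (s - r)) v = v := hs
  rw [← add_sub_cancel r s, step_add, map_mul, Module.End.mul_apply, hs']

/-- One root exchange: integrate the old form over the root group `step`. One coordinate of the
opposite radical is lost, one entry of the first row is gained, and the Jacobian of r ↦ t⁻¹r
contributes one factor `κ`. -/
theorem IsExchangeForm.exists_succ (hσ : IsSmoothRep σ) (hψ : Continuous ψ) (hψ1 : ψ ≠ 1)
    (ht1 : valuation F t < 1) (hκ : κ = (resIndex t : ℂ)⁻¹)
    (h : IsExchangeForm ψ σ t ht κ k l) (hl : l ≠ 0) (hk : k + 1 < n) :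
    ∃ l' : Module.Dual ℂ V, l' ≠ 0 ∧ IsExchangeForm ψ σ t ht κ (k + 1) l' := by
  have hk' : k < n := Nat.lt_of_succ_lt hk
  let : MeasurableSpace F := borel F
  have : BorelSpace F := ⟨rfl⟩
  let μ : Measure F := Measure.addHaar
  obtain ⟨j, hj⟩ := exists_annihilator_subset ht ht1 hψ1
  have hlow_add : ∀ a b : F, radM (lowVec hk (a + b)) = radM (lowVec hk a) * radM (lowVec hk b) :=
    fun a b => by rw [map_add, radM_add]
  have hlow_cont : Continuous fun s : F => radM (lowVec hk s) :=
    continuous_radM.comp (continuous_midSingle _ _ _)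
  have hlow_entry : ∀ s : F, (lowVec hk s).1 ⟨n - 1 - k, by omega⟩ = s := fun s => by
    rw [lowVec, midSingle_coe, Pi.single_eq_same]
  have hlow : ∀ v, ∃ M : ℕ, ∀ s ∈ ball t (M : ℤ), σ (radM (lowVec hk s)) v = v := fun v =>
    exists_ball_subset ht1 ((isOpen_addStabilizer hσ hlow_add hlow_cont v).mem_nhds (zero_mem _))
  have hrad : ∀ v r s, l (σ (step hk' r) (σ (radM (lowVec hk s)) v)) =
      (ψ (r * s) : ℂ) * l (σ (step hk' r) v) := fun v r s => by
    rw [h.step_mul_radM hk (lowVec_lowSupport hk s), hlow_entry]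
  have hfix : ∀ v (M : ℕ), (∀ s ∈ ball t (M : ℤ), σ (radM (lowVec hk s)) v = v) → ∀ r,
      l (σ (step hk' r) v) ≠ 0 → ∀ s ∈ ball t (M : ℤ), ψ (r * s) = 1 := fun v M hM r hr s hs => by
    have h1 := hrad v r s
    rw [hM s hs] at h1
    exact Circle.ext (mul_right_cancel₀ hr (by rw [← h1, Circle.coe_one, one_mul]))
  -- Wherever the integrand is non-zero, invariance of v under small opposite root elements forces
  -- ψ(rs) = 1 for all small s, which bounds r.
  have hsupp : ∀ v, ∃ m : ℤ, ∀ r, r ∉ ball t m → l (σ (step hk' r) v) = 0 := fun v => by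
    obtain ⟨M, hM⟩ := hlow v
    refine ⟨j - M, fun r hr => ?_⟩
    by_contra hne
    exact hr (hj M r (hfix v M hM r hne))
  have hcont := continuous_step_apply hσ l hk'
  have hint : ∀ v, Integrable (fun r => l (σ (step hk' r) v)) μ := fun v => by
    obtain ⟨m, hm⟩ := hsupp v
    exact (hcont v).integrable_of_hasCompactSupport
      (HasCompactSupport.intro (ball_isCompact (t := t) m) fun r hr => hm r hr)
  let l' : Module.Dual ℂ V :=
    { toFun := fun v => ∫ r, l (σ (step hk' r) v) ∂μ
      map_add' := fun v w => by
        simp only [map_add]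
        exact integral_add (hint v) (hint w)
      map_smul' := fun c v => by
        simp only [map_smul, smul_eq_mul, RingHom.id_apply]
        exact integral_const_mul c _ }
  have hl' : ∀ v, l' v = ∫ r, l (σ (step hk' r) v) ∂μ := fun v => rfl
  refine ⟨l', fun h0 => ?_, fun u hu v => ?_, fun c hc v => ?_, fun v => ?_⟩
  · obtain ⟨v, hv⟩ : ∃ v, l v ≠ 0 := by
      by_contra! hcon
      exact hl (LinearMap.ext hcon)
    obtain ⟨m, hm⟩ := hsupp v
    obtain ⟨M, hM⟩ := hlow v
    obtain ⟨a, ha⟩ := exists_ball_subset ht1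
      ((isOpen_addStabilizer hσ (step_add hk') (continuous_step hk') v).mem_nhds (zero_mem _))
    have ha' : ∀ r ∈ ball t (a : ℤ), l (σ (step hk' r) v) = l v := fun r hr => by
      rw [mem_addStabilizer.mp (ha hr)]
    have h00 : l (σ (step hk' 0) v) = l v := ha' 0 (zero_mem _)
    -- The new form at `σ (radM (lowVec hk s)) v` is the Fourier coefficient at s of a function with
    -- value l v ≠ 0 at the origin, so it cannot vanish for all s.
    obtain ⟨s, hs⟩ := exists_fourier_ne_zero ht ht1 μ hψ hψ1 (hcont v) hm
      (fun r hr => by rw [ha' r hr, h00]) (by rw [h00]; exact hv)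
      (fun s hs r hr => hfix v M hM r (by rw [ha' r hr]; exact hv) s hs)
    refine hs ?_
    have h1 := LinearMap.congr_fun h0 (σ (radM (lowVec hk s)) v)
    rw [hl', LinearMap.zero_apply] at h1
    simpa only [hrad] using h1
  · rw [hl', hl']
    simp only [h.step_mul_unip hk' hu]
    rw [integral_const_mul, integral_add_right_eq_self (fun r => l (σ (step hk' r) v))]
  · rw [hl', hl']
    have hc' : LowSupport k c.1 := fun i hi => hc i (by omega)
    simp only [h.step_mul_radM hk hc']
    -- The condition for k + 1 drops exactly the coordinate paired with the integration variable, so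
    -- the character becomes trivial.
    rw [hc ⟨n - 1 - k, by omega⟩ (by simp only; omega)]
    simp
  · rw [hl', hl']
    simp only [h.step_mul_tor hk']
    rw [integral_const_mul, integral_inv_mul ht ht1 μ fun r => l (σ (step hk' r) v), ← hκ, pow_succ,
      mul_assoc]

theorem IsExchangeForm.exists_last (hσ : IsSmoothRep σ) (hψ : Continuous ψ) (hψ1 : ψ ≠ 1)
    (ht1 : valuation F t < 1) (hκ : κ = (resIndex t : ℂ)⁻¹)
    (h : IsExchangeForm ψ σ t ht κ 0 l) (hl : l ≠ 0) :
    ∃ l' : Module.Dual ℂ V, l' ≠ 0 ∧ IsExchangeForm ψ σ t ht κ (n - 1) l' := by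
  have key : ∀ k, k < n → ∃ l' : Module.Dual ℂ V, l' ≠ 0 ∧ IsExchangeForm ψ σ t ht κ k l' := by
    intro k
    induction k with
    | zero => exact fun _ => ⟨l, hl, h⟩
    | succ k ih =>
      intro hk
      obtain ⟨l₁, hl₁, h₁⟩ := ih (Nat.lt_of_succ_lt hk)
      exact h₁.exists_succ hσ hψ hψ1 ht1 hκ hl₁ hk
  exact key (n - 1) (Nat.sub_lt (Nat.pos_of_ne_zero (NeZero.ne n)) one_pos)

end Exchange

end SOodd

/-! ## From degenerate to non-degenerate characters -/

namespace SOodd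

open LocalBall ValuativeRel

/-! ### Elements of the simple root groups -/

section RootElements

variable {n : ℕ} {F : Type*} [Field F]

theorem rowEntry_eq_zero {k : ℕ} (hk : k < n) {u : SOodd n F} (hu : u ∈ rowSubgroup n k F) :
    rowEntry k u = 0 :=
  hu.2 _ (zero_lt_rowIndex hk) (by simp only; omega)

theorem mem_rowSubgroup_of_mem_unip [NeZero n] {u : SOodd n F} (hu : u ∈ unip n F) :
    u ∈ rowSubgroup n (n - 1 + 1) F := by
  rwa [Nat.sub_add_cancel (Nat.pos_of_ne_zero (NeZero.ne n)), rowSubgroup_self]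

variable [NeZero n]

theorem bil_stepVec_self {k : ℕ} (hk : k < n) (hk0 : k ≠ 0) (r : F) :
    bil (stepVec k hk r).1 (stepVec k hk r).1 = 0 := by
  rw [stepVec, midSingle_coe, bil_single_left, Pi.single_eq_of_ne, mul_zero]
  intro h
  have h := congrArg Fin.val h
  rw [Fin.val_rev] at h
  simp only at h
  omega

variable [CharZero F]

/-- For k = n-1 the step vector sits in coordinate 2n-1, which gives the entry (0, 1) and its mirror
image. For n = 1 the root is short and the vector anisotropic; the extra corner entry is then
allowed. -/
theorem step_inSimpleRootSubgroup (hk : n - 1 < n) (r : F) :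
    InSimpleRootSubgroup ⟨step hk r, (step_mem hk r).1⟩ ⟨0, Nat.pos_of_ne_zero (NeZero.ne n)⟩ := by
  intro i j hij h
  have hn := NeZero.ne n
  have hj := j.2
  have hi := i.2
  change mat (step hk r) i j ≠ 0 at h
  rw [step, radP_apply, if_neg hij.ne, stepVec_apply, stepVec_apply] at h
  simp only [Fin.val_rev] at h ⊢
  by_contra! hcon
  refine h ?_
  have h1 : (if i = 0 then if 2 * n + 1 - (j.val + 1) = n + (n - 1) then r else 0 else 0) = 0 := by
    split_ifs with h1 h2
    · have : i.val = 0 := by rw [h1, Fin.val_zero]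
      have := hcon.1 this
      omega
    · rfl
    · rfl
  have h2 : (if j = Fin.last _ then if i.val = n + (n - 1) then r else 0 else 0) = 0 := by
    split_ifs with h1 h2
    · have : j.val = 2 * n := by rw [h1, Fin.val_last]
      have := hcon.2.1 (by omega)
      omega
    · rfl
    · rfl
  have h3 : (if j = Fin.last _ then if i = 0 then
      bil (stepVec (n - 1) hk r).1 (stepVec (n - 1) hk r).1 / 2 else 0 else 0) = 0 := by
    split_ifs with h1 h2
    · have hj' : j.val = 2 * n := by rw [h1, Fin.val_last]
      have hi' : i.val = 0 := by rw [h2, Fin.val_zero]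
      rw [bil_stepVec_self hk (fun h0 => hcon.2.2 (by omega) hi' (by omega)), zero_div]
    · rfl
    · rfl
  rw [h1, h2, h3]
  simp

/-- The exchange commutators supply the remaining simple roots. The quadratic term survives only for
k = 0, which is the short root. -/
theorem stepComm_inSimpleRootSubgroup {k : ℕ} (hk : k + 1 < n) (r : F) :
    InSimpleRootSubgroup ⟨stepComm (Nat.lt_of_succ_lt hk) (lowVec_lowSupport hk (1 : F)) r,
      (stepComm_mem _ (lowVec_lowSupport hk 1) (lowVec hk 1).2.1 r).1⟩ ⟨n - 1 - k, by omega⟩ := by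
  intro i j hij h
  have hj := j.2
  have hi := i.2
  have hc : ∀ a : Fin (2 * n + 1), a.val ≠ n - 1 - k → (lowVec hk (1 : F)).1 a = 0 := fun a ha => by
    rw [lowVec, midSingle_coe, Pi.single_eq_of_ne]
    intro h
    exact ha (congrArg Fin.val h)
  simp only at h
  rw [stepComm_apply, if_neg hij.ne] at h
  simp only [Fin.val_rev]
  by_contra! hcon
  refine h ?_
  have h1 : (lowVec hk (1 : F)).1 i * (if j.val + k = n then r else 0) = 0 := by
    by_cases hi' : i.val = n - 1 - k
    · rw [if_neg, mul_zero]
      have := hcon.1 hi'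
      omega
    · rw [hc i hi', zero_mul]
  have h2 : (if i.val = n + k then r else 0) * (lowVec hk (1 : F)).1 j.rev = 0 := by
    by_cases hi' : i.val = n + k
    · rw [hc j.rev, mul_zero]
      rw [Fin.val_rev]
      have := hcon.2.1 (by omega)
      omega
    · rw [if_neg hi', zero_mul]
  have h3 : bil (stepVec k (Nat.lt_of_succ_lt hk) r).1 (stepVec k (Nat.lt_of_succ_lt hk) r).1 / 2 *
      ((lowVec hk (1 : F)).1 i * (lowVec hk (1 : F)).1 j.rev) = 0 := by
    by_cases hk0 : k = 0
    · by_cases hi' : i.val = n - 1 - k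
      · rw [hc j.rev, mul_zero, mul_zero]
        rw [Fin.val_rev]
        exact hcon.2.2 (by omega) hi'
      · rw [hc i hi', zero_mul, mul_zero]
    · rw [bil_stepVec_self _ hk0, zero_div, zero_mul]
  rw [h1, h2, h3]
  simp

end RootElements

/-! ### Twisted coinvariants and the remaining root group -/

section Generic

variable {n : ℕ} {F : Type*} [Field F] [NeZero n] [CharZero F] {V : Type*} [AddCommGroup V]
  [Module ℂ V] {ψ : AddChar F Circle} {σ : Representation ℂ (SOodd n F) V}

/-- The root group normalizes `rowSubgroup n k F` and preserves its character, hence acts on the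
twisted coinvariants. -/
theorem step_conj_mem {k : ℕ} (hk : k < n) {u : SOodd n F} (hu : u ∈ rowSubgroup n k F) (r : F) :
    step hk r * u * (step hk r)⁻¹ ∈ rowSubgroup n k F ∧
      superForm (step hk r * u * (step hk r)⁻¹) = superForm u := by
  have h1 := step_mem hk r
  have h2 := rowSubgroup_mono (Nat.le_succ k) hu
  refine ⟨mul_inv_mem_rowSubgroup hk (mul_mem h1 h2) h1 ?_, ?_⟩
  · rw [rowEntry_mul hk h1 hu.1, rowEntry_eq_zero hk hu, add_zero]
  · rw [superForm_mul (mul_mem h1 h2).1 (inv_mem h1).1, superForm_mul h1.1 hu.1,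
      superForm_inv h1.1, superForm_step]
    ring

/-- The kernel of the twisted coinvariants of `rowSubgroup n k F`. -/
def twistedKernel (ψ : AddChar F Circle) (σ : Representation ℂ (SOodd n F) V) (k : ℕ) :
    Submodule ℂ V :=
  Submodule.span ℂ {y | ∃ u ∈ rowSubgroup n k F, ∃ v, y = σ u v - (ψ (superForm u) : ℂ) • v}

theorem twistedKernel_le_comap {k : ℕ} (hk : k < n) (r : F) :
    twistedKernel ψ σ k ≤ (twistedKernel ψ σ k).comap (σ (step hk r)) := by
  refine Submodule.span_le.mpr ?_
  rintro _ ⟨u, hu, v, rfl⟩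
  refine Submodule.subset_span ⟨_, (step_conj_mem hk hu r).1, σ (step hk r) v, ?_⟩
  rw [(step_conj_mem hk hu r).2, ← Module.End.mul_apply (σ _) (σ (step hk r)), ← map_mul,
    inv_mul_cancel_right, map_mul, Module.End.mul_apply, map_sub, map_smul]

/-- The action of the root group on the twisted coinvariants. -/
def coinvariantsRep (ψ : AddChar F Circle) (σ : Representation ℂ (SOodd n F) V) {k : ℕ}
    (hk : k < n) : Representation ℂ (Multiplicative F) (V ⧸ twistedKernel ψ σ k) where
  toFun r := (twistedKernel ψ σ k).mapQ _ (σ (step hk r.toAdd)) (twistedKernel_le_comap hk _)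
  map_one' := Submodule.linearMap_qext _ (LinearMap.ext fun v => by
    have : step hk (0 : F) = 1 := by rw [step, map_zero, radP_zero]
    simp [this])
  map_mul' r s := Submodule.linearMap_qext _ (LinearMap.ext fun v => by
    simp [step_add])

theorem coinvariantsRep_mk {k : ℕ} (hk : k < n) (r : F) (v : V) :
    coinvariantsRep ψ σ hk (Multiplicative.ofAdd r) ((twistedKernel ψ σ k).mkQ v) =
      (twistedKernel ψ σ k).mkQ (σ (step hk r) v) := rfl

variable [ValuativeRel F] [TopologicalSpace F] [IsNonarchimedeanLocalField F]

/-- If a linear form that is equivariant under the kernel of a root is not invariant under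
the root group, then the representation is generic. -/
theorem isGeneric_of_ne (hσ : IsSmoothRep σ) (hψ : Continuous ψ) (hψ1 : ψ ≠ 1)
    {l : Module.Dual ℂ V} (hk : n - 1 < n)
    (hl : ∀ u ∈ rowSubgroup n (n - 1) F, ∀ v, l (σ u v) = (ψ (superForm u) : ℂ) * l v)
    {r₀ : F} {v₀ : V} (hne : l (σ (step hk r₀) v₀) ≠ l v₀) : IsGeneric σ := by
  obtain ⟨t, ht, ht1⟩ := exists_uniformizer F
  set V₀ := twistedKernel ψ σ (n - 1) with hV₀
  have hlV₀ : ∀ y ∈ V₀, l y = 0 := fun y hy => by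
    have h1 : V₀ ≤ LinearMap.ker l := by
      refine Submodule.span_le.mpr ?_
      rintro _ ⟨u, hu, v, rfl⟩
      rw [SetLike.mem_coe, LinearMap.mem_ker, map_sub, hl u hu, map_smul, smul_eq_mul, sub_self]
    exact h1 hy
  have hopen := fun v => isOpen_addStabilizer hσ (step_add hk) (continuous_step hk) v
  -- The difference, rather than v₀, is made to survive: an equivariant form takes the value (χ(r₀)
  -- - 1) ω(v₀) on it, which forces χ to be non-trivial.
  have hw₀ : V₀.mkQ (σ (step hk r₀) v₀ - v₀) ≠ 0 := fun h => by
    rw [Submodule.mkQ_apply, Submodule.Quotient.mk_eq_zero] at h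
    have := hlV₀ _ h
    rw [map_sub, sub_eq_zero] at this
    exact hne this
  obtain ⟨χ, m, hm, hm0⟩ := exists_equivariant_form (coinvariantsRep ψ σ hk) (fun x w => by
    obtain ⟨v, rfl⟩ := V₀.mkQ_surjective w
    obtain ⟨N, hN, hx⟩ := exists_nsmul_mem ht ht1 _ (hopen v) x.toAdd
    refine ⟨N, hN, ?_⟩
    have h1 : x ^ N = Multiplicative.ofAdd (N • x.toAdd) := rfl
    rw [h1, coinvariantsRep_mk, mem_addStabilizer.mp hx]) hw₀
  let ω : Module.Dual ℂ V := m.comp V₀.mkQ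
  have hω : ∀ v, ω v = m (V₀.mkQ v) := fun v => rfl
  have hω1 : ∀ r v, ω (σ (step hk r) v) = (χ (Multiplicative.ofAdd r) : ℂ) * ω v := fun r v => by
    rw [hω, ← coinvariantsRep_mk, hm, hω]
  have hω2 : ∀ u ∈ rowSubgroup n (n - 1) F, ∀ v, ω (σ u v) = (ψ (superForm u) : ℂ) * ω v :=
    fun u hu v => by
      have : V₀.mkQ (σ u v - (ψ (superForm u) : ℂ) • v) = 0 := by
        rw [Submodule.mkQ_apply, Submodule.Quotient.mk_eq_zero]
        exact Submodule.subset_span ⟨u, hu, v, rfl⟩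
      rw [map_sub, map_smul, sub_eq_zero] at this
      rw [hω, this, map_smul, smul_eq_mul, hω]
  have hv₀ : ((χ (Multiplicative.ofAdd r₀) : ℂ) - 1) * ω v₀ ≠ 0 := by
    rw [← hω, map_sub, hω1] at hm0
    rwa [sub_mul, one_mul]
  have hχ₀ : χ (Multiplicative.ofAdd r₀) ≠ 1 := fun h => by
    rw [h, Circle.coe_one, sub_self, zero_mul] at hv₀
    exact hv₀ rfl
  have hωv₀ : ω v₀ ≠ 0 := right_ne_zero_of_mul hv₀
  have hχs : ∀ r, σ (step hk r) v₀ = v₀ → χ (Multiplicative.ofAdd r) = 1 := fun r hr => by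
    have h1 := hω1 r v₀
    rw [hr] at h1
    exact Circle.ext (mul_right_cancel₀ hωv₀ (by rw [← h1, Circle.coe_one, one_mul]))
  -- χ is trivial on the open stabilizer of v₀ because ω(v₀) ≠ 0, hence it is locally constant.
  have hχc : Continuous fun r : F => χ (Multiplicative.ofAdd r) := by
    refine IsLocallyConstant.continuous ((IsLocallyConstant.iff_eventually_eq _).mpr fun r => ?_)
    have h1 : ∀ᶠ s in nhds r, s - r ∈ (addStabilizer σ (step hk) (step_add hk) v₀ : Set F) := by
      refine (continuous_sub_right r).continuousAt.eventually_mem ?_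
      rw [sub_self]
      exact (hopen v₀).mem_nhds (zero_mem _)
    filter_upwards [h1] with s hs
    rw [← add_sub_cancel r s, ofAdd_add, map_mul, hχs _ hs, mul_one]
  let Ξ : unip n F →* Circle :=
    { toFun := fun u => ψ (superForm u.1) * χ (Multiplicative.ofAdd (rowEntry (n - 1) u.1))
      map_one' := by
        rw [Subgroup.coe_one, superForm_one, rowEntry_eq_zero hk (one_mem _),
          AddChar.map_zero_eq_one, ofAdd_zero, map_one, one_mul]
      map_mul' := fun a b => by
        rw [Subgroup.coe_mul, superForm_mul a.2 b.2,
          rowEntry_mul hk (mem_rowSubgroup_of_mem_unip a.2) b.2, AddChar.map_add_eq_mul,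
          ofAdd_add, map_mul, mul_mul_mul_comm] }
  have hΞ : ∀ u, Ξ u = ψ (superForm u.1) * χ (Multiplicative.ofAdd (rowEntry (n - 1) u.1)) :=
    fun u => rfl
  have hn := Nat.pos_of_ne_zero (NeZero.ne n)
  refine ⟨Ξ, ⟨?_, fun i => ?_⟩, hasModel_of_form hσ (l := ω) (fun h => hωv₀ (by rw [h]; rfl)) ?_⟩
  · refine Continuous.mul ?_ ?_
    · refine hψ.comp (continuous_finsetSum _ fun i _ => ?_)
      exact (continuous_entry _ _).comp continuous_subtype_val
    · exact hχc.comp ((continuous_entry _ _).comp continuous_subtype_val)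
  · by_cases hi : i.val = 0
    · have : i = ⟨0, hn⟩ := Fin.ext hi
      rw [this]
      refine ⟨_, step_inSimpleRootSubgroup hk r₀, ?_⟩
      rw [hΞ]
      simp only
      rwa [superForm_step, rowEntry_step, AddChar.map_zero_eq_one, one_mul]
    · have hki : n - 1 - i.val + 1 < n := by omega
      have : i = ⟨n - 1 - (n - 1 - i.val), by omega⟩ := Fin.ext (by simp only; omega)
      obtain ⟨r, hr⟩ := AddChar.ne_one_iff.mp hψ1
      rw [this]
      refine ⟨_, stepComm_inSimpleRootSubgroup hki r, ?_⟩
      have hmem := stepComm_mem (Nat.lt_of_succ_lt hki) (lowVec_lowSupport hki (1 : F))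
        (lowVec hki 1).2.1 r
      rw [hΞ]
      simp only
      rw [superForm_stepComm _ hki, rowEntry_eq_zero hk (rowSubgroup_mono (Nat.zero_le _) hmem),
        lowVec, midSingle_coe, Pi.single_eq_same, one_mul, ofAdd_zero, map_one, mul_one]
      exact hr
  · intro u v
    have hu := mem_rowSubgroup_of_mem_unip u.2
    have hs := step_mem hk (rowEntry (n - 1) u.1)
    -- Factor u as an element of `rowSubgroup n (n - 1) F` times a root element; ω is equivariant
    -- under each factor.
    have h1 : u.1 * (step hk (rowEntry (n - 1) u.1))⁻¹ ∈ rowSubgroup n (n - 1) F :=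
      mul_inv_mem_rowSubgroup hk hu hs (by rw [rowEntry_step])
    have h2 : superForm (u.1 * (step hk (rowEntry (n - 1) u.1))⁻¹) = superForm u.1 := by
      rw [superForm_mul u.2 (inv_mem hs).1, superForm_inv hs.1, superForm_step]
      ring
    have h3 := hω2 _ h1 (σ (step hk (rowEntry (n - 1) u.1)) v)
    rw [← Module.End.mul_apply, ← map_mul, inv_mul_cancel_right, h2, hω1] at h3
    rw [h3, hΞ, Circle.coe_mul, mul_assoc]

end Generic

end SOodd

/-! ## Iwahori decomposition of congruence subgroups -/

namespace SOodd

open LocalBall ValuativeRel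

section Columns

variable {n : ℕ} {F : Type*} [Field F]

theorem mulVec_single_apply (g : SOodd n F) (i j : Fin (2 * n + 1)) (a : F) :
    (mat g *ᵥ Pi.single j a) i = mat g i j * a := by
  rw [Matrix.mulVec_single]
  simp

variable [NeZero n]

/-- The part of a vector outside the first and the last coordinate, negated. -/
def negMid (x : Fin (2 * n + 1) → F) : midSpace n F :=
  ⟨x 0 • Pi.single 0 1 + x (Fin.last _) • Pi.single (Fin.last _) 1 - x, by
    have h := last_ne_zero n
    constructor <;> simp [h, h.symm]⟩

theorem negMid_coe (x : Fin (2 * n + 1) → F) : (negMid x).1 =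
    x 0 • Pi.single 0 1 + x (Fin.last _) • Pi.single (Fin.last _) 1 - x := rfl

theorem negMid_apply (x : Fin (2 * n + 1) → F) {i : Fin (2 * n + 1)} (h0 : i ≠ 0)
    (h1 : i ≠ Fin.last _) : (negMid x).1 i = -x i := by
  rw [negMid_coe]
  simp [h0, h1]

/-- An element that preserves the lines of the first and the last coordinate vector commutes with
the torus. -/
theorem tor_mul_comm {m : SOodd n F} {t : F} (ht : t ≠ 0) {a b : F} (ha : a ≠ 0) (hb : b ≠ 0)
    (h0 : mat m *ᵥ Pi.single 0 1 = Pi.single 0 a)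
    (h1 : mat m *ᵥ Pi.single (Fin.last _) 1 = Pi.single (Fin.last _) b) :
    tor t ht * m = m * tor t ht := by
  have hinv : ∀ (j : Fin (2 * n + 1)) (c : F), c ≠ 0 → mat m *ᵥ Pi.single j 1 = Pi.single j c →
      mat m⁻¹ *ᵥ Pi.single j 1 = Pi.single j c⁻¹ := fun j c hc h => by
    have h2 : Pi.single j (1 : F) = c⁻¹ • (mat m *ᵥ Pi.single j 1 : Fin (2 * n + 1) → F) := by
      rw [h, ← Pi.single_smul, smul_eq_mul, inv_mul_cancel₀ hc]
    conv_lhs => rw [h2]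
    rw [Matrix.mulVec_smul, Matrix.mulVec_mulVec, ← mat_mul, inv_mul_cancel, mat_one,
      Matrix.one_mulVec, ← Pi.single_smul, smul_eq_mul, mul_one]
  have hcol : ∀ (g : SOodd n F) (i j : Fin (2 * n + 1)) (c : F), i ≠ j →
      mat g *ᵥ Pi.single j 1 = Pi.single j c → mat g i j = 0 := fun g i j c hij h => by
    have := congrFun h i
    rwa [mulVec_single_apply, mul_one, Pi.single_eq_of_ne hij] at this
  -- The inverse preserves the same two lines, and its columns are the reversed rows of m. So m is
  -- block diagonal, and the torus is scalar on each block.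
  have hrow : ∀ (i j : Fin (2 * n + 1)) (c : F), i ≠ j →
      mat m⁻¹ *ᵥ Pi.single i.rev 1 = Pi.single i.rev c → mat m i j = 0 := fun i j c hij h => by
    have h2 := hcol m⁻¹ j.rev i.rev c (fun h => hij (Fin.rev_injective h).symm) h
    rwa [mat_inv_apply, Fin.rev_rev, Fin.rev_rev] at h2
  refine mat_injective (Matrix.ext fun i j => ?_)
  rw [tor_mul_apply, mul_tor_apply]
  by_cases hij : i = j
  · rw [hij, mul_comm]
  have key : i = 0 ∨ i = Fin.last _ ∨ j = 0 ∨ j = Fin.last _ → mat m i j = 0 := by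
    rintro (rfl | rfl | rfl | rfl)
    · exact hrow _ _ _ hij (by rw [Fin.rev_zero]; exact hinv _ _ hb h1)
    · exact hrow _ _ _ hij (by rw [Fin.rev_last]; exact hinv _ _ ha h0)
    · exact hcol _ _ _ _ hij h0
    · exact hcol _ _ _ _ hij h1
  by_cases h : i = 0 ∨ i = Fin.last _ ∨ j = 0 ∨ j = Fin.last _
  · rw [key h, mul_zero, zero_mul]
  · push Not at h
    rw [torVal_mid t h.1 h.2.1, torVal_mid t h.2.2.1 h.2.2.2, mul_comm]

/-- For an isotropic vector the norm of the middle part is -2 times the product of the outer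
coordinates. This cancels the division by 2 in the Eichler transformations, so residue
characteristic 2 needs no separate treatment in the Iwahori decomposition. -/
theorem bil_negMid {x : Fin (2 * n + 1) → F} (hx : bil x x = 0) :
    bil (negMid x).1 (negMid x).1 = -2 * (x 0 * x (Fin.last _)) := by
  rw [negMid_coe]
  simp only [bil_add_left, bil_add_right, bil_sub_left, bil_sub_right, bil_smul_left,
    bil_smul_right, bil_single_left, bil_single_right, hx, Fin.rev_zero, Fin.rev_last]
  simp only [Pi.add_apply, Pi.sub_apply, Pi.smul_apply, smul_eq_mul, Pi.single_eq_same,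
    Pi.single_eq_of_ne (last_ne_zero n), Pi.single_eq_of_ne (last_ne_zero n).symm]
  ring

variable [CharZero F]

theorem radP_mulVec_first (q : midSpace n F) :
    mat (radP q) *ᵥ Pi.single 0 1 = Pi.single 0 1 := by
  rw [radP, mat_eichler, eichlerMat_mulVec, bil_first_self, bil_comm, bil_first_mid]
  simp

theorem radM_mulVec_last (q : midSpace n F) :
    mat (radM q) *ᵥ Pi.single (Fin.last _) 1 = Pi.single (Fin.last _) 1 := by
  rw [radM, mat_eichler, eichlerMat_mulVec, bil_last_self, bil_comm, bil_last_mid]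
  simp

/-- The radical moves the last coordinate vector to any isotropic vector with last coordinate 1; the
minus sign in `negMid` matches the term -(u, x) q of the transformation. -/
theorem radP_negMid {x : Fin (2 * n + 1) → F} (hx : bil x x = 0) (h1 : x (Fin.last _) = 1) :
    mat (radP (negMid x)) *ᵥ Pi.single (Fin.last _) 1 = x := by
  rw [radP, mat_eichler, eichlerMat_mulVec, bil_negMid hx, bil_first_last, bil_comm,
    bil_last_mid, negMid_coe, h1]
  module

theorem radM_negMid {x : Fin (2 * n + 1) → F} (hx : bil x x = 0) (h1 : x 0 = 1) :
    mat (radM (negMid x)) *ᵥ Pi.single 0 1 = x := by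
  rw [radM, mat_eichler, eichlerMat_mulVec, bil_negMid hx, bil_comm (Pi.single (Fin.last _) 1),
    bil_first_last, bil_comm, bil_first_mid, negMid_coe, h1]
  module

end Columns

section Iwahori

variable {n : ℕ} {F : Type*} [Field F] [ValuativeRel F] {t : F}
  (ht : t ≠ 0) (ht1 : valuation F t < 1)

theorem valuation_diag {m : ℕ} (hm : m ≠ 0) {g : SOodd n F} (hg : g ∈ congruence n t ht ht1 m)
    (i : Fin (2 * n + 1)) : valuation F (mat g i i) = 1 := by
  have h1 : valuation F (mat g i i - 1) < 1 := by
    have := hg i i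
    rw [Matrix.one_apply_eq] at this
    refine lt_of_le_of_lt (mem_ball.mp this) ?_
    rw [zpow_natCast]
    exact pow_lt_one₀ zero_le ht1 hm
  have h2 := (valuation F).map_one_add_of_lt h1
  rwa [add_sub_cancel] at h2

/-- The column of an element of a congruence subgroup, normalized to have the diagonal
entry `1`. -/
theorem normalized_column {m : ℕ} (hm : m ≠ 0) {g : SOodd n F} (hg : g ∈ congruence n t ht ht1 m)
    (j : Fin (2 * n + 1)) (hj : j.rev ≠ j) : ∃ x : Fin (2 * n + 1) → F,
      x j = 1 ∧ bil x x = 0 ∧ (∀ i, i ≠ j → x i ∈ ball t m) ∧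
      mat g *ᵥ Pi.single j 1 = mat g j j • x := by
  have hv := valuation_diag ht ht1 hm hg j
  have h0 : mat g j j ≠ 0 := fun h => by rw [h, map_zero] at hv; exact zero_ne_one hv
  refine ⟨(mat g j j)⁻¹ • (mat g *ᵥ Pi.single j 1), ?_, ?_, fun i hi => ?_, ?_⟩
  · rw [Pi.smul_apply, mulVec_single_apply, mul_one, smul_eq_mul, inv_mul_cancel₀ h0]
  · rw [bil_smul_left, bil_smul_right, bil_mulVec, bil_single_left, Pi.single_eq_of_ne hj]
    simp
  · have := hg i j
    rw [Matrix.one_apply_ne hi, sub_zero] at this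
    rw [Pi.smul_apply, mulVec_single_apply, mul_one, smul_eq_mul, mem_ball, map_mul, map_inv₀, hv,
      inv_one, one_mul]
    exact this
  · rw [smul_inv_smul₀ h0]

variable [NeZero n]

theorem negMid_mem_ball {x : Fin (2 * n + 1) → F} {m : ℕ}
    (hx : ∀ i, i ≠ 0 → i ≠ Fin.last _ → x i ∈ ball t m) (i : Fin (2 * n + 1)) :
    (negMid x).1 i ∈ ball t m := by
  by_cases h0 : i = 0
  · rw [h0, (negMid x).2.1]
    exact zero_mem _
  by_cases h1 : i = Fin.last _
  · rw [h1, (negMid x).2.2]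
    exact zero_mem _
  rw [negMid_apply x h0 h1]
  exact neg_mem (hx i h0 h1)

variable [CharZero F]

theorem radP_mem_congruence {q : midSpace n F} {m : ℕ} (hq : ∀ i, q.1 i ∈ ball t m)
    (hQ : bil q.1 q.1 / 2 ∈ ball t m) : radP q ∈ congruence n t ht ht1 m := fun i j => by
  rw [radP_apply, Matrix.one_apply]
  have h1 : (if i = 0 then q.1 j.rev else 0) ∈ ball t m := by
    split_ifs
    exacts [hq _, zero_mem _]
  have h2 : (if j = Fin.last _ then q.1 i else 0) ∈ ball t m := by
    split_ifs
    exacts [hq _, zero_mem _]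
  have h3 : (if j = Fin.last _ then if i = 0 then bil q.1 q.1 / 2 else 0 else 0) ∈ ball t m := by
    split_ifs
    exacts [hQ, zero_mem _, zero_mem _]
  have := sub_mem (sub_mem h1 h2) h3
  convert this using 1
  ring

theorem radM_mem_congruence {q : midSpace n F} {m : ℕ} (hq : ∀ i, q.1 i ∈ ball t m)
    (hQ : bil q.1 q.1 / 2 ∈ ball t m) : radM q ∈ congruence n t ht ht1 m := fun i j => by
  rw [radM_apply, Matrix.one_apply]
  have h1 : (if i = Fin.last _ then q.1 j.rev else 0) ∈ ball t m := by
    split_ifs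
    exacts [hq _, zero_mem _]
  have h2 : (if j = 0 then q.1 i else 0) ∈ ball t m := by
    split_ifs
    exacts [hq _, zero_mem _]
  have h3 : (if j = 0 then if i = Fin.last _ then bil q.1 q.1 / 2 else 0 else 0) ∈ ball t m := by
    split_ifs
    exacts [hQ, zero_mem _, zero_mem _]
  have := sub_mem (sub_mem h1 h2) h3
  convert this using 1
  ring

/-- The Iwahori decomposition with respect to the stabilizer of the first coordinate line. -/
theorem exists_iwahori {m : ℕ} (hm : m ≠ 0) {g : SOodd n F} (hg : g ∈ congruence n t ht ht1 m) :
    ∃ (q q' : midSpace n F) (h : SOodd n F), g = radP q * h * radM q' ∧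
      h ∈ congruence n t ht ht1 m ∧ tor t ht * h = h * tor t ht ∧
      ∀ s ∈ ball t 0, radM (s • q') ∈ congruence n t ht ht1 m := by
  have hl := last_ne_zero n
  -- The last column of g determines the left factor and the first column of g⁻¹ the right one. What
  -- remains preserves both coordinate lines and so commutes with the torus.
  obtain ⟨x, hx1, hx0, hxm, hx⟩ := normalized_column ht ht1 hm hg (Fin.last _)
    (by rw [Fin.rev_last]; exact hl.symm)
  obtain ⟨y, hy1, hy0, hym, hy⟩ := normalized_column ht ht1 hm (inv_mem hg) 0
    (by rw [Fin.rev_zero]; exact hl)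
  have hva := valuation_diag ht ht1 hm hg (Fin.last _)
  have hvb := valuation_diag ht ht1 hm (inv_mem hg) 0
  have ha : mat g (Fin.last _) (Fin.last _) ≠ 0 := fun h => by
    rw [h, map_zero] at hva; exact zero_ne_one hva
  have hb : mat g⁻¹ 0 0 ≠ 0 := fun h => by
    rw [h, map_zero] at hvb; exact zero_ne_one hvb
  have hP : radP (negMid x) ∈ congruence n t ht ht1 m := by
    refine radP_mem_congruence ht ht1 (negMid_mem_ball fun i _ h => hxm i h) ?_
    rw [bil_negMid hx0, hx1, mul_one, neg_mul, neg_div, mul_div_cancel_left₀ _ two_ne_zero]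
    exact neg_mem (hxm 0 hl.symm)
  have hM : ∀ s ∈ ball t 0, radM (s • negMid y) ∈ congruence n t ht ht1 m := fun s hs => by
    refine radM_mem_congruence ht ht1 (fun i => ?_) ?_
    · have := mul_mem ht hs (negMid_mem_ball (fun i h _ => hym i h) i)
      rwa [zero_add] at this
    · rw [Submodule.coe_smul, bil_smul_left, bil_smul_right, bil_negMid hy0, hy1, one_mul]
      have := mul_mem ht hs (mul_mem ht hs (hym _ hl))
      rw [zero_add, zero_add] at this
      convert neg_mem this using 1
      ring
  refine ⟨negMid x, -negMid y, (radP (negMid x))⁻¹ * g * radM (negMid y), ?_, ?_, ?_, ?_⟩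
  · rw [radM_neg]
    group
  · refine Subgroup.mul_mem _ (Subgroup.mul_mem _ (inv_mem hP) hg) ?_
    have := hM 1 one_mem
    rwa [one_smul] at this
  · refine tor_mul_comm ht (inv_ne_zero hb) ha ?_ ?_
    · have h1 : mat (radM (negMid y)) *ᵥ Pi.single 0 1 =
          (mat g⁻¹ 0 0)⁻¹ • (mat g⁻¹ *ᵥ Pi.single 0 1 : Fin (2 * n + 1) → F) := by
        rw [radM_negMid hy0 hy1, hy, inv_smul_smul₀ hb]
      rw [mat_mul, ← Matrix.mulVec_mulVec, h1, Matrix.mulVec_smul, Matrix.mulVec_mulVec,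
        ← mat_mul, mul_inv_cancel_right, ← radP_neg, radP_mulVec_first, ← Pi.single_smul,
        smul_eq_mul, mul_one]
    · rw [mat_mul, ← Matrix.mulVec_mulVec, radM_mulVec_last, mat_mul, ← Matrix.mulVec_mulVec, hx,
        ← radP_negMid hx0 hx1, Matrix.mulVec_smul, Matrix.mulVec_mulVec, radP_negMid hx0 hx1,
        ← mat_mul, inv_mul_cancel, mat_one, Matrix.one_mulVec, ← Pi.single_smul, smul_eq_mul,
        mul_one]
  · intro s hs
    have := hM (-s) (neg_mem hs)
    have h : s • -negMid y = (-s) • negMid y := by ext; simp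
    rwa [h]

end Iwahori

end SOodd

/-! ## Averaged forms and the growth of matrix coefficients -/

section Average

variable {G V : Type*} [Group G] [TopologicalSpace G] [IsTopologicalGroup G] [AddCommGroup V]
  [Module ℂ V]

theorem IsSmoothRep.continuous_inv_apply {σ : Representation ℂ G V} (hσ : IsSmoothRep σ)
    (l : Module.Dual ℂ V) (v : V) : Continuous fun g : G => l (σ g⁻¹ v) := by
  refine IsLocallyConstant.continuous ((IsLocallyConstant.iff_eventually_eq _).mpr fun g => ?_)
  have hc : Continuous fun h : G => g * h⁻¹ := by fun_prop
  have ho : {h : G | σ (g * h⁻¹) v = v} ∈ nhds g :=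
    ((hσ v).preimage hc).mem_nhds (by simp)
  filter_upwards [ho] with h hh
  have h1 : h⁻¹ = g⁻¹ * (g * h⁻¹) := by group
  rw [h1, map_mul, Module.End.mul_apply, hh]

variable [MeasurableSpace G] [BorelSpace G]

/-- Averaging a linear form over a compact open subgroup. -/
theorem IsSmoothRep.exists_averaged_form {σ : Representation ℂ G V} (hσ : IsSmoothRep σ)
    (μ : Measure G) [μ.IsHaarMeasure] {K : Subgroup G} (hKo : IsOpen (K : Set G))
    (hKc : IsCompact (K : Set G)) (l : Module.Dual ℂ V) :
    ∃ L : Module.Dual ℂ V, (∀ k ∈ K, ∀ v, L (σ k v) = L v) ∧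
      ∀ v c, (∀ k ∈ K, l (σ k v) = c) → L v = μ.real K * c := by
  have hint : ∀ v, IntegrableOn (fun g : G => l (σ g⁻¹ v)) K μ := fun v =>
    (hσ.continuous_inv_apply l v).continuousOn.integrableOn_compact' hKc hKo.measurableSet
  -- The inverse of g turns left invariance of μ into invariance of the averaged form under K.
  refine ⟨{ toFun := fun v => ∫ g in (K : Set G), l (σ g⁻¹ v) ∂μ
            map_add' := fun v w => by
              simp only [map_add]
              exact integral_add (hint v) (hint w)
            map_smul' := fun c v => by
              simp only [map_smul, smul_eq_mul, RingHom.id_apply]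
              exact integral_const_mul c _ }, fun k hk v => ?_, fun v c h => ?_⟩
  · change ∫ g in (K : Set G), l (σ g⁻¹ (σ k v)) ∂μ = ∫ g in (K : Set G), l (σ g⁻¹ v) ∂μ
    rw [← integral_indicator hKo.measurableSet, ← integral_indicator hKo.measurableSet,
      ← integral_mul_left_eq_self _ k]
    refine integral_congr_ae (Filter.Eventually.of_forall fun g => ?_)
    have h1 : k * g ∈ (K : Set G) ↔ g ∈ (K : Set G) := Subgroup.mul_mem_cancel_left K hk
    by_cases hg : g ∈ (K : Set G)
    · simp only [Set.indicator_of_mem hg, Set.indicator_of_mem (h1.mpr hg)]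
      rw [← Module.End.mul_apply, ← map_mul, _root_.mul_inv_rev, inv_mul_cancel_right]
    · simp only [Set.indicator_of_notMem hg, Set.indicator_of_notMem (mt h1.mp hg)]
  · change ∫ g in (K : Set G), l (σ g⁻¹ v) ∂μ = _
    rw [setIntegral_congr_fun hKo.measurableSet fun g hg => h g⁻¹ (inv_mem hg), setIntegral_const,
      Complex.real_smul]

theorem card_mul_le_lintegral {X ι : Type*} [MeasurableSpace X] (μ : Measure X) (s : Finset ι)
    {A : ι → Set X} (hA : ∀ i ∈ s, MeasurableSet (A i)) (hd : (s : Set ι).PairwiseDisjoint A)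
    {f : X → ENNReal} {c m : ENNReal} (hf : ∀ i ∈ s, ∀ x ∈ A i, f x = c)
    (hm : ∀ i ∈ s, μ (A i) = m) : s.card * (c * m) ≤ ∫⁻ x, f x ∂μ := by
  have h1 : ∫⁻ x in ⋃ i ∈ s, A i, f x ∂μ = s.card * (c * m) := by
    rw [lintegral_biUnion_finset hd hA, Finset.sum_congr rfl fun i hi => ?_, Finset.sum_const,
      nsmul_eq_mul]
    rw [setLIntegral_congr_fun (hA i hi) (hf i hi), setLIntegral_const, hm i hi]
  rw [← h1]
  exact setLIntegral_le_lintegral _ _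

/-- The exponents combine to (2n-1) - (n-1)(2 + 1/n) = 1/n > 0. -/
theorem one_lt_growth {q : ℝ} (hq : 1 < q) {n : ℕ} (hn : n ≠ 0) :
    1 < q ^ (2 * n - 1) * ((q⁻¹) ^ (n - 1)) ^ (2 + 1 / n : ℝ) := by
  have hq0 : 0 < q := by linarith
  have hn1 : 1 ≤ n := Nat.one_le_iff_ne_zero.mpr hn
  have hn0 : (n : ℝ) ≠ 0 := Nat.cast_ne_zero.mpr hn
  have h : q ^ (2 * n - 1) * ((q⁻¹) ^ (n - 1)) ^ (2 + 1 / n : ℝ) = q ^ (1 / n : ℝ) := by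
    rw [← Real.rpow_natCast, ← Real.rpow_natCast, Real.inv_rpow hq0.le, ← Real.rpow_neg hq0.le,
      ← Real.rpow_mul hq0.le, ← Real.rpow_add hq0, Nat.cast_sub (by omega), Nat.cast_sub hn1]
    congr 1
    push_cast
    field_simp
    ring
  rw [h]
  exact Real.one_lt_rpow hq (by positivity)

end Average

namespace SOodd

open LocalBall ValuativeRel

section Torus

variable {n : ℕ} {F : Type*} [Field F] {t : F} (ht : t ≠ 0)

/-- The vector with the given middle coordinates. -/
def midVec (n : ℕ) (x : {i : Fin (2 * n + 1) // i ≠ 0 ∧ i ≠ Fin.last _} → F) : midSpace n F :=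
  ⟨fun i => if h : i ≠ 0 ∧ i ≠ Fin.last _ then x ⟨i, h⟩ else 0, by simp, by simp⟩

theorem midVec_apply (x : {i : Fin (2 * n + 1) // i ≠ 0 ∧ i ≠ Fin.last _} → F) (i) :
    (midVec n x).1 i.1 = x i := dif_pos i.2

variable [NeZero n]

theorem card_mid : Fintype.card {i : Fin (2 * n + 1) // i ≠ 0 ∧ i ≠ Fin.last (2 * n)} =
    2 * n - 1 := by
  have h : (Finset.univ.filter fun i : Fin (2 * n + 1) => i ≠ 0 ∧ i ≠ Fin.last (2 * n)) =
      Finset.univ \ {0, Fin.last (2 * n)} := by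
    ext i
    simp
  rw [Fintype.card_subtype, h, Finset.card_sdiff_of_subset (Finset.subset_univ _),
    Finset.card_pair (last_ne_zero n).symm, Finset.card_univ, Fintype.card_fin]
  rfl

theorem apply_tor_pow {V : Type*} [AddCommGroup V] [Module ℂ V]
    {σ : Representation ℂ (SOodd n F) V} {l : Module.Dual ℂ V} {κ : ℂ}
    (hT : ∀ v, l (σ (tor t ht) v) = κ * l v) (M : ℕ) (v : V) :
    l (σ (tor t ht ^ M) v) = κ ^ M * l v := by
  induction M generalizing v with
  | zero => simp
  | succ M ih => rw [pow_succ', map_mul, Module.End.mul_apply, hT, ih, pow_succ', mul_assoc]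

variable [CharZero F]

theorem tor_pow_mul_radP (M : ℕ) (q : midSpace n F) :
    tor t ht ^ M * radP q = radP (t ^ M • q) * tor t ht ^ M := by
  induction M generalizing q with
  | zero => simp
  | succ M ih => rw [pow_succ, mul_assoc, tor_mul_radP, ← mul_assoc, ih, mul_assoc, smul_smul, pow_succ]

theorem radM_mul_tor_pow (M : ℕ) (q : midSpace n F) :
    radM q * tor t ht ^ M = tor t ht ^ M * radM (t ^ M • q) := by
  induction M generalizing q with
  | zero => simp
  | succ M ih =>
    have h : radM q * tor t ht = tor t ht * radM (t • q) := by
      rw [tor_mul_radM, inv_smul_smul₀ ht]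
    rw [pow_succ', ← mul_assoc, h, mul_assoc, ih, ← mul_assoc, smul_smul, pow_succ]

end Torus

/-! ### Coset counting and values on torus powers -/

section Growth

variable {n : ℕ} {F : Type*} [Field F] [NeZero n] [CharZero F] [ValuativeRel F]
  {t : F} (ht : t ≠ 0) (ht1 : valuation F t < 1)

/-- The extra factor t^e absorbs the 1/2 in the quadratic corner entry. -/
theorem radP_midVec_mem_congruence {e j : ℕ} (he : (2 : F)⁻¹ ∈ ball t (-e))
    {x : {i : Fin (2 * n + 1) // i ≠ 0 ∧ i ≠ Fin.last _} → F} (hx : ∀ i, x i ∈ ball t 0) :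
    radP (midVec n (t ^ (j + e) • x)) ∈ congruence n t ht ht1 j := by
  have h1 : ∀ i, (midVec n (t ^ (j + e) • x)).1 i ∈ ball t ((j + e : ℕ) : ℤ) := fun i => by
    by_cases hi : i ≠ 0 ∧ i ≠ Fin.last _
    · have := (zpow_mul_mem ht (k := ((j + e : ℕ) : ℤ)) (m := 0)).mpr (hx ⟨i, hi⟩)
      rw [zero_add, zpow_natCast] at this
      rwa [show (midVec n (t ^ (j + e) • x)).1 i = t ^ (j + e) * x ⟨i, hi⟩ from dif_pos hi]
    · rw [show (midVec n (t ^ (j + e) • x)).1 i = 0 from dif_neg hi]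
      exact zero_mem _
  refine radP_mem_congruence ht ht1 (fun i => ball_anti ht ht1 (by push_cast; omega) (h1 i)) ?_
  rw [div_eq_mul_inv]
  refine ball_anti ht ht1 (k := ((j + e : ℕ) + (j + e : ℕ)) + -e) (by push_cast; omega)
    (LocalBall.mul_mem ht (sum_mem fun i _ => LocalBall.mul_mem ht (h1 _) (h1 _)) he)

/-- Conjugation by the inverse torus power expands the radical by t^{-(m+e)}, so equal cosets give
t^{j-m}(x - y) ∈ t^j 𝒪. The shift e in the power cancels the one in the representatives. -/
theorem eq_of_coset_eq {j e m : ℕ} {R : Finset F}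
    (hR : ∀ x ∈ R, ∀ y ∈ R, x - y ∈ ball t m → x = y)
    {x y : {i : Fin (2 * n + 1) // i ≠ 0 ∧ i ≠ Fin.last _} → F} (hx : ∀ i, x i ∈ R)
    (hy : ∀ i, y i ∈ R) {k k' : SOodd n F} (hk : k ∈ congruence n t ht ht1 j)
    (hk' : k' ∈ congruence n t ht ht1 j)
    (h : radP (midVec n (t ^ (j + e) • x)) * tor t ht ^ (m + e) * k =
      radP (midVec n (t ^ (j + e) • y)) * tor t ht ^ (m + e) * k') : x = y := by
  set M := m + e with hM
  set w := midVec n (t ^ (j + e) • x) with hw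
  set w' := midVec n (t ^ (j + e) • y) with hw'
  have h1 : tor t ht ^ M * radP ((t ^ M)⁻¹ • (w - w')) = tor t ht ^ M * (k' * k⁻¹) := by
    rw [tor_pow_mul_radP, smul_inv_smul₀ (pow_ne_zero _ ht), sub_eq_neg_add, radP_add, radP_neg,
      mul_assoc, inv_mul_eq_iff_eq_mul, ← mul_assoc, ← mul_assoc, ← h, mul_inv_cancel_right]
  have h2 : radP ((t ^ M)⁻¹ • (w - w')) ∈ congruence n t ht ht1 j := by
    rw [mul_left_cancel h1]
    exact Subgroup.mul_mem _ hk' (inv_mem hk)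
  funext i
  refine hR _ (hx i) _ (hy i) ?_
  have h3 := h2 i.1 (Fin.last _)
  rw [radP_apply, Matrix.one_apply, if_pos rfl, if_neg i.2.1, if_neg i.2.1, if_pos rfl,
    if_neg i.2.2] at h3
  have h4 : (w.1 i.1, w'.1 i.1) = (t ^ (j + e) * x i, t ^ (j + e) * y i) := by
    rw [hw, hw', midVec_apply, midVec_apply]; rfl
  have h5 : ((t ^ M)⁻¹ • (w - w')).1 i.1 = (t ^ M)⁻¹ * (t ^ (j + e) * x i - t ^ (j + e) * y i) := by
    rw [← (Prod.mk.inj h4).1, ← (Prod.mk.inj h4).2]; rfl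
  have h6 : (t ^ M)⁻¹ * (t ^ (j + e) * x i - t ^ (j + e) * y i) ∈ ball t j := by
    rw [← h5]
    have := neg_mem h3
    convert this using 1
    ring
  have h7 : (t ^ M)⁻¹ * (t ^ (j + e) * x i - t ^ (j + e) * y i) =
      t ^ ((j : ℤ) - m) * (x i - y i) := by
    have : t ^ ((j : ℤ) - m) = (t ^ M)⁻¹ * t ^ (j + e) := by
      rw [← zpow_natCast, ← zpow_natCast, ← _root_.zpow_neg, ← zpow_add₀ ht]
      congr 1
      push_cast [hM]
      ring
    rw [this]
    ring
  rw [h7, show (j : ℤ) = m + (j - m) by ring, show (m : ℤ) + (j - m) - m = j - m by ring,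
    zpow_mul_mem ht] at h6
  exact h6

variable {V : Type*} [AddCommGroup V] [Module ℂ V] {σ : Representation ℂ (SOodd n F) V}
  {l : Module.Dual ℂ V} {κ : ℂ}

/-- Decompose k by Iwahori: the factor in the radical is absorbed by the form, the middle factor
commutes with the torus, and the opposite factor is contracted by the torus power and fixes v.
Averaging over the congruence subgroup therefore does not destroy the values on torus powers. -/
theorem apply_congruence_tor_pow (hN : ∀ q v, l (σ (radP q) v) = l v)
    (hT : ∀ v, l (σ (tor t ht) v) = κ * l v) {j : ℕ} (hj : j ≠ 0) {v : V}
    (hv : ∀ k ∈ congruence n t ht ht1 j, σ k v = v) (M : ℕ) {k : SOodd n F}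
    (hk : k ∈ congruence n t ht ht1 j) : l (σ k (σ (tor t ht ^ M) v)) = κ ^ M * l v := by
  obtain ⟨q, q', h, rfl, hh, hc, hM⟩ := exists_iwahori ht ht1 hj hk
  have hs : t ^ M ∈ ball t 0 := by
    have := (zpow_mul_mem ht (k := (M : ℤ)) (m := 0)).mpr one_mem
    rw [mul_one, zpow_natCast] at this
    exact ball_anti ht ht1 (by omega) this
  have hc' : h * tor t ht ^ M = tor t ht ^ M * h := ((show Commute (tor t ht) h from hc).pow_left M).symm
  rw [← Module.End.mul_apply, ← map_mul, mul_assoc, radM_mul_tor_pow, mul_assoc, ← mul_assoc h, hc',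
    mul_assoc (_ ^ M), map_mul, Module.End.mul_apply, hN, map_mul, Module.End.mul_apply,
    apply_tor_pow ht hT, map_mul, Module.End.mul_apply, hv _ (hM _ hs), hv _ hh]

end Growth

end SOodd

/-! ## Equivariant forms of representations that are not tempered -/

namespace SOodd

open LocalBall ValuativeRel
open scoped Pointwise

section Tempered

variable {n : ℕ} {F : Type*} [Field F] [ValuativeRel F]
  [TopologicalSpace F] [IsNonarchimedeanLocalField F] {t : F} (ht : t ≠ 0)
  (ht1 : valuation F t < 1) {V : Type*} [AddCommGroup V] [Module ℂ V]
  {σ : Representation ℂ (SOodd n F) V} {l : Module.Dual ℂ V} {κ : ℂ}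

theorem exists_congruence_fixing (hσ : IsSmoothRep σ) (v : V) :
    ∃ j : ℕ, j ≠ 0 ∧ ∀ k ∈ congruence n t ht ht1 j, σ k v = v := by
  obtain ⟨m, hm⟩ := exists_congruence_subset ht ht1 ((hσ v).mem_nhds (by simp) :
    {g : SOodd n F | σ g v = v} ∈ nhds 1)
  exact ⟨m + 1, Nat.succ_ne_zero m,
    fun k hk => hm (congruence_anti ht ht1 (Nat.le_succ m) hk)⟩

variable [NeZero n] [CharZero F]

/-- The `p`-th power integral of a matrix coefficient that is bi-invariant under a congruence
subgroup, estimated from below by its values on the powers of the torus element. -/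
theorem card_mul_le_lintegral_coeff [MeasurableSpace (SOodd n F)] [BorelSpace (SOodd n F)]
    (μ : Measure (SOodd n F)) [μ.IsHaarMeasure] {e j : ℕ} (he : (2 : F)⁻¹ ∈ ball t (-e)) {v : V}
    (hv : ∀ k ∈ congruence n t ht ht1 j, σ k v = v)
    (hl : ∀ k ∈ congruence n t ht ht1 j, ∀ w, l (σ k w) = l w) (p : ℝ) (m : ℕ) :
    ((resIndex t ^ m) ^ (2 * n - 1) : ℕ) *
      (‖l (σ (tor t ht ^ (m + e)) v)‖ₑ ^ p * μ (congruence n t ht ht1 j)) ≤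
        ∫⁻ g, ‖l (σ g v)‖ₑ ^ p ∂μ := by
  classical
  obtain ⟨R, hcard, hR0, hR⟩ := exists_representatives ht ht1 m
  have h1 : (Fintype.piFinset
      fun _ : {i : Fin (2 * n + 1) // i ≠ 0 ∧ i ≠ Fin.last (2 * n)} => R).card =
      (resIndex t ^ m) ^ (2 * n - 1) := by
    rw [Fintype.card_piFinset, Finset.prod_const, Finset.card_univ, card_mid, hcard]
  have ho := isOpen_congruence (n := n) ht ht1 j
  rw [← h1]
  -- The sets are disjoint left cosets inside one double coset of the torus power, indexed by
  -- vectors of 2n-1 representatives. They have equal Haar measure, and the coefficient is constant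
  -- on their union.
  refine card_mul_le_lintegral μ _ (A := fun x => (radP (midVec n (t ^ (j + e) • x)) *
    tor t ht ^ (m + e)) • (congruence n t ht ht1 j : Set (SOodd n F)))
    (fun x _ => (ho.smul _).measurableSet) (fun x hx y hy hxy => ?_) (fun x hx g hg => ?_)
    (fun x _ => measure_smul μ _ _)
  · refine Set.disjoint_left.mpr ?_
    rintro _ ⟨k, hk, rfl⟩ ⟨k', hk', h⟩
    rw [Finset.mem_coe, Fintype.mem_piFinset] at hx hy
    exact hxy (eq_of_coset_eq ht ht1 hR hx hy hk hk' h.symm)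
  · obtain ⟨k, hk, rfl⟩ := hg
    rw [Fintype.mem_piFinset] at hx
    simp only [smul_eq_mul]
    rw [map_mul, Module.End.mul_apply, hv k hk, map_mul, Module.End.mul_apply,
      hl _ (radP_midVec_mem_congruence ht ht1 he fun i => hR0 _ (hx i))]

/-- A representation is not tempered if it has a form that is invariant under the unipotent
radical of the stabilizer of an isotropic line and on which the torus acts by too large a
character. -/
theorem not_isTemperedRep (hσ : IsSmoothRep σ) (hl : l ≠ 0)
    (hN : ∀ q v, l (σ (radP q) v) = l v)
    (hT : ∀ v, l (σ (tor t ht) v) = (resIndex t : ℂ)⁻¹ ^ (n - 1) * l v)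
    (ht1 : valuation F t < 1) : ¬ IsTemperedRep σ := by
  intro htemp
  let _ : MeasurableSpace (SOodd n F) := borel _
  have : BorelSpace (SOodd n F) := ⟨rfl⟩
  set μ : Measure (SOodd n F) := Measure.haar with hμ
  have hn := NeZero.ne n
  obtain ⟨v, hlv⟩ : ∃ v, l v ≠ 0 := by
    by_contra! h
    exact hl (LinearMap.ext h)
  obtain ⟨j, hj, hv⟩ := exists_congruence_fixing ht ht1 hσ v
  obtain ⟨e, he⟩ := exists_mem_ball ht ht1 (2 : F)⁻¹
  set K := congruence n t ht ht1 j with hK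
  have hKo : IsOpen (K : Set (SOodd n F)) := isOpen_congruence ht ht1 j
  have hKc : IsCompact (K : Set (SOodd n F)) := isCompact_congruence ht ht1 j
  obtain ⟨L, hL, hL'⟩ := hσ.exists_averaged_form μ hKo hKc l
  obtain ⟨q, hq⟩ : ∃ q : ℝ, q = (resIndex t : ℝ) := ⟨_, rfl⟩
  have hq1 : 1 < q := by
    rw [hq]
    exact_mod_cast one_lt_resIndex ht ht1
  -- With ε = 1/n the number of cosets outgrows the decay of the p-th power of the coefficient, at
  -- the rate q^{1/n} per step.
  set p : ℝ := 2 + 1 / n with hp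
  have hp0 : 0 < p := by positivity
  have hpn : (0 : ℝ) < 1 / n := by positivity
  have hLs : IsSmoothForm σ L := ⟨⟨K, hKo⟩, hL⟩
  have hfin : ∫⁻ g, ‖L (σ g v)‖ₑ ^ p ∂μ < ⊤ := by
    have h1 := (htemp v L hLs _ hpn).2
    have h2 := lintegral_rpow_enorm_lt_top_of_eLpNorm_lt_top (ENNReal.ofReal_pos.mpr hp0).ne'
      ENNReal.ofReal_ne_top h1
    rwa [ENNReal.toReal_ofReal hp0.le] at h2
  have hK0 : 0 < μ.real K := by
    rw [measureReal_def]
    exact ENNReal.toReal_pos (hKo.measure_pos μ ⟨1, one_mem K⟩).ne' hKc.measure_lt_top.ne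
  set a : ℝ := μ.real K * ‖l v‖ with ha
  have ha0 : 0 < a := mul_pos hK0 (norm_pos_iff.mpr hlv)
  have hnorm : ∀ M : ℕ, ‖L (σ (tor t ht ^ M) v)‖ = a * ((q⁻¹) ^ (n - 1)) ^ M := fun M => by
    rw [hL' _ _ fun k hk => apply_congruence_tor_pow ht ht1 hN hT hj hv M hk]
    simp only [norm_mul, norm_pow, norm_inv, Complex.norm_natCast, Complex.norm_real,
      Real.norm_of_nonneg hK0.le, ha, hq]
    ring
  set b : ℝ := (q⁻¹) ^ (n - 1) with hb
  have hb0 : 0 < b := by positivity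
  have hX := one_lt_growth hq1 hn
  set C : ℝ := (∫⁻ g, ‖L (σ g v)‖ₑ ^ p ∂μ).toReal with hC
  have hbound : ∀ m : ℕ, (q ^ (2 * n - 1) * b ^ p) ^ m * ((a * b ^ e) ^ p * μ.real K) ≤ C := by
    intro m
    have h1 := ENNReal.toReal_mono hfin.ne
      (card_mul_le_lintegral_coeff ht ht1 μ he hv hL p m)
    rw [ENNReal.toReal_mul, ENNReal.toReal_mul, ← ENNReal.toReal_rpow, toReal_enorm,
      ENNReal.toReal_natCast, ← measureReal_def, hnorm] at h1
    refine le_of_eq_of_le ?_ h1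
    have h2 : a * b ^ (m + e) = b ^ m * (a * b ^ e) := by ring
    rw [h2, Real.mul_rpow (x := b ^ m) (by positivity) (by positivity), ← Real.rpow_natCast b m,
      ← Real.rpow_mul hb0.le, mul_comm (m : ℝ) p, Real.rpow_mul hb0.le, Real.rpow_natCast]
    push_cast
    rw [← hq]
    ring
  have hD : 0 < (a * b ^ e) ^ p * μ.real K := by positivity
  obtain ⟨m, hm⟩ := pow_unbounded_of_one_lt (C / ((a * b ^ e) ^ p * μ.real K)) hX
  rw [div_lt_iff₀ hD] at hm
  exact absurd (hbound m) (not_le.mpr hm)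

end Tempered

end SOodd

/-! ### The dichotomy at the last root group -/

theorem proposition4p3 {F : Type*} [Field F] [CharZero F] [ValuativeRel F] [TopologicalSpace F]
    [IsNonarchimedeanLocalField F] (n : ℕ) (hn : 1 ≤ n)
    (ψ : AddChar F Circle) (hψ : Continuous ψ) (hψ1 : ψ ≠ 1)
    {V : Type*} [AddCommGroup V] [Module ℂ V] (σ : Representation ℂ (SOodd n F) V)
    (hirr : σ.IsIrreducible) (hsm : IsSmoothRep σ) (htemp : IsTemperedRep σ)
    (hbes : SOodd.HasBesselModel ψ σ) :
    SOodd.IsGeneric σ := by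
  have : NeZero n := ⟨by omega⟩
  obtain ⟨t, ht, ht1⟩ := LocalBall.exists_uniformizer F
  obtain ⟨l₀, hl₀, h₀⟩ := hbes.exists_exchangeForm t ht (LocalBall.resIndex t : ℂ)⁻¹
  obtain ⟨l, hl, h⟩ := h₀.exists_last hsm hψ hψ1 ht1 rfl hl₀
  have hk : n - 1 < n := by omega
  by_contra hgen
  have hstep : ∀ r v, l (σ (SOodd.step hk r) v) = l v := fun r v => by
    by_contra hne
    exact hgen (SOodd.isGeneric_of_ne hsm hψ hψ1 hk h.unip hne)
  refine SOodd.not_isTemperedRep ht hsm hl (fun q v => ?_) h.tor ht1 htemp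
  have hu := SOodd.mem_rowSubgroup_of_mem_unip (SOodd.radP_mem_unip q)
  set r := SOodd.rowEntry (n - 1) (SOodd.radP q)
  -- Up to a root element, which is now known to act trivially on the form, `radP q` lies in
  -- `rowSubgroup n (n - 1) F`, and its character value is 1. So the form is invariant under the
  -- whole radical.
  have hm : SOodd.radP q * (SOodd.step hk r)⁻¹ ∈ SOodd.rowSubgroup n (n - 1) F :=
    SOodd.mul_inv_mem_rowSubgroup hk hu (SOodd.step_mem hk r) (SOodd.rowEntry_step hk r).symm
  have h1 := h.unip _ hm (σ (SOodd.step hk r) v)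
  have h2 : SOodd.superForm (SOodd.radP q * (SOodd.step hk r)⁻¹) = 0 := by
    rw [SOodd.superForm_mul (SOodd.radP_mem_unip q) (inv_mem (SOodd.step_mem hk r).1),
      SOodd.superForm_inv (SOodd.step_mem hk r).1, SOodd.superForm_radP, SOodd.superForm_step]
    simp
  rw [h2, AddChar.map_zero_eq_one, hstep, ← Module.End.mul_apply, ← map_mul,
    inv_mul_cancel_right] at h1
  simpa using h1
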